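/- Let $0\le a<b\le\infty$, $0<r\le 1$ and $0<p,q<\infty$. A weight on $(a,b)$ is a measurable function that is positive and finite almost everywhere on $(a,b)$. Let $u,v,w$ be weights on $(a,b)$ such that $\mathcal W(x):=\int_x^b w$ satisfies $0<\mathcal W(x)<\infty$ for all $x\in(a,b)$. For $a\le x<y\le b$ put $V_r(x,y)=\big(\int_x^y v^{\frac1{1-r}}\big)^{\frac{1-r}{r}}$ if $r<1$ and $V_1(x,y)=\operatorname{ess\,sup}_{s\in(x,y)}v(s)$. Let $N\in\mathbb Z\cup\{-\infty\}$ and let $\{x_k\}_{k=N}^\infty\subset[a,b]$ be a discretizing sequence of $\mathcal W$: it is strictly increasing, there is a constant $D\in(0,\infty)$ with $D^{-1}2^{-k}\le\mathcal W(x_k)\le D\,2^{-k}$ for all integers $k\ge N$, and $x_N=a$ if $N>-\infty$, while $\lim_{k\to-\infty}x_k=a$ if $N=-\infty$ (in which case $N+1=-\infty$ too). Consider the inequality $$\bigg(\int_a^b\Big(\int_a^t f(s)^r v(s)\,ds\Big)^{\frac qr}u(t)\,dt\bigg)^{\frac1q}\le C\bigg(\int_a^b\Big(\int_a^t f(s)\,ds\Big)^{p}w(t)\,dt\bigg)^{\frac1p}.\qquad(*)$$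 Define $$A_1=\sup_{k\ge N+1}2^{\frac kp}V_r(x_{k-1},x_k)\Big(\int_{x_k}^b u\Big)^{\frac1q},$$ $$A_2=\sup_{k\ge N+1}\Big(\int_{x_k}^b u\Big)^{\frac1q}\Big(\sum_{i=N+1}^k2^{i\frac r{p-r}}V_r(x_{i-1},x_i)^{\frac{pr}{p-r}}\Big)^{\frac{p-r}{pr}},$$ $$A_3=\bigg(\sum_{k=N+1}^\infty\Big(\int_{x_k}^{x_{k+1}}u\Big)\Big(\int_{x_k}^b u\Big)^{\frac q{p-q}}\sup_{N+1\le i\le k}2^{i\frac q{p-q}}V_r(x_{i-1},x_i)^{\frac{pq}{p-q}}\bigg)^{\frac{p-q}{pq}},$$ $$A_4=\bigg(\sum_{k=N+1}^\infty\Big(\int_{x_k}^{x_{k+1}}u\Big)\Big(\int_{x_k}^b u\Big)^{\frac q{p-q}}\Big(\sum_{i=N+1}^k2^{i\frac r{p-r}}V_r(x_{i-1},x_i)^{\frac{pr}{p-r}}\Big)^{\frac{q(p-r)}{r(p-q)}}\bigg)^{\frac{p-q}{pq}},$$ $$B_1=\sup_{k\ge N+1}2^{\frac kp}\operatorname*{ess\,sup}_{t\in(x_{k-1},x_k)}\Big(\int_t^{x_k}u\Big)^{\frac1q}V_r(x_{k-1},t),$$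 $$B_2=\sup_{k\ge N+1}2^{\frac kp}\bigg(\int_{x_{k-1}}^{x_k}\Big(\int_t^{x_k}u\Big)^{\frac q{1-q}}u(t)V_r(x_{k-1},t)^{\frac q{1-q}}dt\bigg)^{\frac{1-q}q},$$ $$B_3=\bigg(\sum_{k=N+1}^\infty2^{k\frac q{p-q}}\bigg(\int_{x_{k-1}}^{x_k}\Big(\int_t^{x_k}u\Big)^{\frac q{1-q}}u(t)V_r(x_{k-1},t)^{\frac q{1-q}}dt\bigg)^{\frac{p(1-q)}{p-q}}\bigg)^{\frac{p-q}{pq}},$$ $$B_4=\bigg(\sum_{k=N+1}^\infty2^{k\frac q{p-q}}\operatorname*{ess\,sup}_{t\in(x_{k-1},x_k)}\Big(\int_t^{x_k}u\Big)^{\frac p{p-q}}V_r(x_{k-1},t)^{\frac{pq}{p-q}}\bigg)^{\frac{p-q}{pq}}.$$ Choose $(A,B)$ as follows: (i) $(A_1,B_1)$ if $p\le r\le1\le q$; (ii) $(A_1,B_2)$ if $p\le q<1$ and $p\le r\le1$; (iii) $(A_2,B_1)$ if $r<p\le q$ and $r\le1\le q$; (iv) $(A_2,B_2)$ if $r<p\le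 q<1$; (v) $(A_3,B_3)$ if $q<p\le r\le1$; (vi) $(A_4,B_3)$ if $q<p$, $q<1$, $r<p$ and $r\le1$; (vii) $(A_4,B_4)$ if $r\le1\le q<p$. Then, in each of these cases, there is a constant $C\in(0,\infty)$ such that $(*)$ holds for all non-negative measurable $f$ on $(a,b)$ if and only if $\max\{A,B\}<\infty$. Moreover, the best constant $C\in(0,\infty]$ in $(*)$ (with value $\infty$ if there is no finite one) satisfies $C\approx A+B$, that is, $c^{-1}(A+B)\le C\le c\,(A+B)$ with a constant $c\in(0,\infty)$ that depends only on $p,q,r$ and on the constant $D$ of the discretizing sequence. -/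

import Mathlib

open MeasureTheory Filter Topology
open scoped ENNReal NNReal

noncomputable section

namespace TwoHardy

/-- The interval `(x, b)` of real numbers, where the right end point may be `∞`. -/
def interval (x : ℝ) (b : EReal) : Set ℝ := {t : ℝ | x < t ∧ (t : EReal) < b}

/-- A weight on `(a, b)`: a (Lebesgue) measurable function that is positive and finite
almost everywhere on `(a, b)`. -/
def IsWeight (a : ℝ) (b : EReal) (g : ℝ → ℝ≥0∞) : Prop :=
  AEMeasurable g (volume.restrict (interval a b)) ∧
    ∀ᵐ t ∂(volume.restrict (interval a b)), 0 < g t ∧ g t < ∞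

/-- The integral `∫_x^b g`; for `g = w` this is the function `𝒲`. -/
def tail (b : EReal) (g : ℝ → ℝ≥0∞) (x : ℝ) : ℝ≥0∞ := ∫⁻ t in interval x b, g t

/-- `V_r(x, y)` for `0 < r ≤ 1`. -/
def V (r : ℝ) (v : ℝ → ℝ≥0∞) (x y : ℝ) : ℝ≥0∞ :=
  if r < 1 then (∫⁻ s in Set.Ioo x y, v s ^ (1 / (1 - r))) ^ ((1 - r) / r)
  else essSup v (volume.restrict (Set.Ioo x y))

/-- `{x_k}_{k = N}^∞`, `N ∈ ℤ ∪ {-∞}`, is a discretizing sequence of `𝒲(x) = ∫_x^b w`, the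
constant in the equivalence `𝒲(x_k) ≈ 2^{-k}` being `D`. Only the values `x k` with `N ≤ k` matter.
Each term of such a sequence is a real number, since `𝒲(x_k) > 0` forces `x_k < b`. -/
structure IsDiscretizing (a : ℝ) (b : EReal) (w : ℝ → ℝ≥0∞) (D : ℝ≥0) (N : WithBot ℤ)
    (x : ℤ → ℝ) : Prop where
  strictMono : StrictMonoOn x {k : ℤ | N ≤ (k : WithBot ℤ)}
  mem : ∀ k : ℤ, N ≤ (k : WithBot ℤ) → a ≤ x k ∧ (x k : EReal) ≤ b
  upper : ∀ k : ℤ, N ≤ (k : WithBot ℤ) → tail b w (x k) ≤ D * (2 : ℝ≥0∞) ^ (-k)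
  lower : ∀ k : ℤ, N ≤ (k : WithBot ℤ) → (2 : ℝ≥0∞) ^ (-k) ≤ D * tail b w (x k)
  start : ∀ M : ℤ, N = (M : WithBot ℤ) → x M = a
  start_bot : N = ⊥ → Tendsto x atBot (𝓝 a)

/-- The inequality
`(∫_a^b (∫_a^t f^r v)^{q/r} u(t) dt)^{1/q} ≤ C (∫_a^b (∫_a^t f)^p w(t) dt)^{1/p}`
for all non-negative measurable `f` on `(a, b)`. -/
def MainInequality (p q r a : ℝ) (b : EReal) (u v w : ℝ → ℝ≥0∞) (C : ℝ≥0) : Prop :=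
  ∀ f : ℝ → ℝ≥0∞, AEMeasurable f (volume.restrict (interval a b)) →
    (∫⁻ t in interval a b, (∫⁻ s in Set.Ioo a t, f s ^ r * v s) ^ (q / r) * u t) ^ (1 / q) ≤
      C * (∫⁻ t in interval a b, (∫⁻ s in Set.Ioo a t, f s) ^ p * w t) ^ (1 / p)

/-- The best constant in the inequality (`∞` if it fails for every finite constant). -/
def bestConst (p q r a : ℝ) (b : EReal) (u v w : ℝ → ℝ≥0∞) : ℝ≥0∞ :=
  ⨅ (C : ℝ≥0) (_ : 0 < C ∧ MainInequality p q r a b u v w C), (C : ℝ≥0∞)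

/-- The indices `k ∈ ℤ` with `N + 1 ≤ k`; all of `ℤ` if `N = -∞`. -/
abbrev Idx (N : WithBot ℤ) : Type := {k : ℤ // N < (k : WithBot ℤ)}

/-- The indices `i ∈ ℤ` with `N + 1 ≤ i ≤ k`. -/
abbrev IdxLE (N : WithBot ℤ) (k : ℤ) : Type := {i : ℤ // N < (i : WithBot ℤ) ∧ i ≤ k}

section Quantities

variable (p q r : ℝ) (b : EReal) (u v : ℝ → ℝ≥0∞) (N : WithBot ℤ) (x : ℤ → ℝ)

def A₁ : ℝ≥0∞ :=
  ⨆ k : Idx N, (2 : ℝ≥0∞) ^ ((k : ℝ) / p) * V r v (x (k - 1)) (x k) * tail b u (x k) ^ (1 / q)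

def A₂ : ℝ≥0∞ :=
  ⨆ k : Idx N, tail b u (x k) ^ (1 / q) *
    (∑' i : IdxLE N k, (2 : ℝ≥0∞) ^ ((i : ℝ) * (r / (p - r))) *
      V r v (x (i - 1)) (x i) ^ (p * r / (p - r))) ^ ((p - r) / (p * r))

def A₃ : ℝ≥0∞ :=
  (∑' k : Idx N, (∫⁻ t in Set.Ioo (x k) (x (k + 1)), u t) * tail b u (x k) ^ (q / (p - q)) *
    ⨆ i : IdxLE N k, (2 : ℝ≥0∞) ^ ((i : ℝ) * (q / (p - q))) *
      V r v (x (i - 1)) (x i) ^ (p * q / (p - q))) ^ ((p - q) / (p * q))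

def A₄ : ℝ≥0∞ :=
  (∑' k : Idx N, (∫⁻ t in Set.Ioo (x k) (x (k + 1)), u t) * tail b u (x k) ^ (q / (p - q)) *
    (∑' i : IdxLE N k, (2 : ℝ≥0∞) ^ ((i : ℝ) * (r / (p - r))) *
      V r v (x (i - 1)) (x i) ^ (p * r / (p - r))) ^ (q * (p - r) / (r * (p - q)))) ^
    ((p - q) / (p * q))

def B₁ : ℝ≥0∞ :=
  ⨆ k : Idx N, (2 : ℝ≥0∞) ^ ((k : ℝ) / p) *
    essSup (fun t => (∫⁻ s in Set.Ioo t (x k), u s) ^ (1 / q) * V r v (x (k - 1)) t)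
      (volume.restrict (Set.Ioo (x (k - 1)) (x k)))

def B₂ : ℝ≥0∞ :=
  ⨆ k : Idx N, (2 : ℝ≥0∞) ^ ((k : ℝ) / p) *
    (∫⁻ t in Set.Ioo (x (k - 1)) (x k), (∫⁻ s in Set.Ioo t (x k), u s) ^ (q / (1 - q)) * u t *
      V r v (x (k - 1)) t ^ (q / (1 - q))) ^ ((1 - q) / q)

def B₃ : ℝ≥0∞ :=
  (∑' k : Idx N, (2 : ℝ≥0∞) ^ ((k : ℝ) * (q / (p - q))) *
    (∫⁻ t in Set.Ioo (x (k - 1)) (x k), (∫⁻ s in Set.Ioo t (x k), u s) ^ (q / (1 - q)) * u t *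
      V r v (x (k - 1)) t ^ (q / (1 - q))) ^ (p * (1 - q) / (p - q))) ^ ((p - q) / (p * q))

def B₄ : ℝ≥0∞ :=
  (∑' k : Idx N, (2 : ℝ≥0∞) ^ ((k : ℝ) * (q / (p - q))) *
    essSup (fun t => (∫⁻ s in Set.Ioo t (x k), u s) ^ (p / (p - q)) *
        V r v (x (k - 1)) t ^ (p * q / (p - q)))
      (volume.restrict (Set.Ioo (x (k - 1)) (x k)))) ^ ((p - q) / (p * q))

end Quantities

/-- The inequality holds with some finite constant if and only if `max {A, B} < ∞`, and its best
constant is equivalent to `A + B`, with equivalence constant `c`. -/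
def CharacterizedBy (p q r a : ℝ) (b : EReal) (u v w : ℝ → ℝ≥0∞) (c : ℝ≥0) (A B : ℝ≥0∞) : Prop :=
  ((∃ C : ℝ≥0, 0 < C ∧ MainInequality p q r a b u v w C) ↔ max A B < ∞) ∧
    bestConst p q r a b u v w ≤ c * (A + B) ∧ A + B ≤ c * bestConst p q r a b u v w

end TwoHardy

end

/-! The points $x_k$ cut $(a,b)$ into cells $(x_{k-1},x_k)$, and both sides of the inequality are
discretized along them. Put $a_k = 2^{-k/p}\int_{x_{k-1}}^{x_k} f$ (`coef`). Because $\mathcal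
W(x_k)\approx 2^{-k}$ decays geometrically, $\int_a^b(\int_a^t f)^p w \approx \sum_k a_k^p$
(`exists_energy_le`, `exists_le_energy`). On the left, for $t$ in the $k$-th cell the inner integral
splits at $x_{k-1}$. The part before $x_{k-1}$ gives a discrete Hardy sum, the rest a Hardy operator
living on one cell (`hardyLHS_le`). Conversely, functions on the cells can be glued with prescribed
coefficients (`tsum_cellU_le`, `tsum_localHardy_le`), so the inequality controls each of the two
parts. The best constant is therefore equivalent to the sum of a discrete constant, which is $A$,
and a local constant, which is $B$.

Both parts come from one weighted Hardy inequality on a linear order, $\int(\int_{s\le t} g^r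
z\,d\nu)^{q/r}d\mu(t)\le K(\int g^p d\nu)^{q/p}$. Let $\Phi(t)$ be the largest value of $(\int_{s\le
t}g^r z\,d\nu)^{1/r}$ over the unit ball of $L^p(\nu)$. The inequality is governed by the supremum
of $\Phi(t)^q\mu[t,\infty)$ if $p\le q$, and by $\int\Phi^{pq/(p-q)}\mu[t,\infty)^{q/(p-q)}d\mu$ if
$q<p$.

Sufficiency (`hardy_upper_of_le`, `hardy_upper_of_lt`): decompose along the dyadic levels of
$H(t)=\int_{s\le t}g^r z\,d\nu$. At least half of $2^j$ is accumulated within two adjacent levels,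
so $2^{j-1}$ is bounded by the $g$-mass there times $\Phi$. The masses are summable because each
level is used twice.

Necessity (`TestBound`, `TestBound.exists_lintegral_le`): superpose functions nearly extremal for
$\Phi(t_j)$, one for each dyadic level of $\Phi$, and use $\ell^p$ duality. A Hardy inequality with
geometric weights turns the resulting sum into the integral.

For the discrete part the order is the index set, $\nu$ is counting measure, and the kernel weights
are $2^{k/p}V_r(x_{k-1},x_k)$. For the local part the order is $\mathbb R$, $\nu$ is Lebesgue
measure on a cell, $p=1$, and $\Phi(t)=V_r(x_{k-1},t)$. The cells are then summed by
$\ell^1\subset\ell^{q/p}$ if $p\le q$ and by Hölder and duality if $q<p$. -/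

namespace TwoHardy

/-! ### Measures on linear orders and their rays -/

/-- Linear orders in which initial and final segments are measurable and can be exhausted by
countably many closed rays. -/
class CofinalOrder (α : Type*) [LinearOrder α] [MeasurableSpace α] : Prop where
  measurableSet_Iic : ∀ t : α, MeasurableSet (Set.Iic t)
  exists_cofinal : ∀ S : Set α, ∃ T ⊆ S, T.Countable ∧ ∀ s ∈ S, ∃ t ∈ T, s ≤ t
  exists_coinitial : ∀ S : Set α, ∃ T ⊆ S, T.Countable ∧ ∀ s ∈ S, ∃ t ∈ T, t ≤ s

/-- Covers the index set of the cells; together with the instance for ℝ it lets one abstract Hardy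
inequality serve both the discrete and the local part. -/
instance CofinalOrder.of_countable {α : Type*} [LinearOrder α] [MeasurableSpace α] [Countable α]
    [MeasurableSingletonClass α] : CofinalOrder α where
  measurableSet_Iic _ := (Set.to_countable _).measurableSet
  exists_cofinal S := ⟨S, subset_rfl, Set.to_countable S, fun s hs => ⟨s, hs, le_rfl⟩⟩
  exists_coinitial S := ⟨S, subset_rfl, Set.to_countable S, fun s hs => ⟨s, hs, le_rfl⟩⟩

instance CofinalOrder.real : CofinalOrder ℝ where
  measurableSet_Iic _ := _root_.measurableSet_Iic
  exists_cofinal S := by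
    obtain ⟨D, hDc, hD⟩ := TopologicalSpace.exists_countable_dense S
    -- A dense subset of `S` can miss an isolated greatest element, so that element is added. Below
    -- any other point of `S` the set of larger points is open and nonempty.
    refine ⟨(Subtype.val '' D) ∪ {m | IsGreatest S m}, ?_, ?_, fun s hs => ?_⟩
    · rintro x (⟨y, -, rfl⟩ | hx)
      exacts [y.2, hx.1]
    · refine (hDc.image _).union (Set.Subsingleton.countable fun x hx y hy => hx.unique hy)
    · by_cases h : IsGreatest S s
      · exact ⟨s, Or.inr h, le_rfl⟩
      · have : ∃ s' ∈ S, s < s' := by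
          by_contra! h'
          exact h ⟨hs, fun y hy => h' y hy⟩
        obtain ⟨s', hs', hlt⟩ := this
        obtain ⟨y, hyD, hy⟩ := hD.exists_mem_open
          (isOpen_lt continuous_const continuous_subtype_val : IsOpen {y : S | s < y})
          ⟨⟨s', hs'⟩, hlt⟩
        exact ⟨y, Or.inl ⟨y, hyD, rfl⟩, le_of_lt hy⟩
  exists_coinitial S := by
    obtain ⟨D, hDc, hD⟩ := TopologicalSpace.exists_countable_dense S
    refine ⟨(Subtype.val '' D) ∪ {m | IsLeast S m}, ?_, ?_, fun s hs => ?_⟩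
    · rintro x (⟨y, -, rfl⟩ | hx)
      exacts [y.2, hx.1]
    · refine (hDc.image _).union (Set.Subsingleton.countable fun x hx y hy => hx.unique hy)
    · by_cases h : IsLeast S s
      · exact ⟨s, Or.inr h, le_rfl⟩
      · have : ∃ s' ∈ S, s' < s := by
          by_contra! h'
          exact h ⟨hs, fun y hy => h' y hy⟩
        obtain ⟨s', hs', hlt⟩ := this
        obtain ⟨y, hyD, hy⟩ := hD.exists_mem_open
          (isOpen_lt continuous_subtype_val continuous_const : IsOpen {y : S | y < s})
          ⟨⟨s', hs'⟩, hlt⟩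
        exact ⟨y, Or.inl ⟨y, hyD, rfl⟩, le_of_lt hy⟩

theorem antitone_measure_inter_Ici {α : Type*} [LinearOrder α] [MeasurableSpace α]
    (μ : Measure α) (E : Set α) :
    Antitone fun t => μ (E ∩ Set.Ici t) := fun _ _ h =>
  measure_mono (Set.inter_subset_inter_right _ (Set.Ici_subset_Ici.2 h))

theorem antitone_measure_Ici {α : Type*} [LinearOrder α] [MeasurableSpace α] (μ : Measure α) :
    Antitone fun t => μ (Set.Ici t) := fun _ _ h =>
  measure_mono (Set.Ici_subset_Ici.2 h)

section Order

variable {α : Type*} [LinearOrder α] [MeasurableSpace α] [CofinalOrder α]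

theorem measurableSet_of_isLowerSet {S : Set α} (hS : IsLowerSet S) : MeasurableSet S := by
  obtain ⟨T, hTS, hTc, hT⟩ := CofinalOrder.exists_cofinal S
  have : S = ⋃ t ∈ T, Set.Iic t := by
    ext s
    simp only [Set.mem_iUnion, Set.mem_Iic, exists_prop]
    exact ⟨hT s, fun ⟨t, ht, h⟩ => hS h (hTS ht)⟩
  rw [this]
  exact MeasurableSet.biUnion hTc fun t _ => CofinalOrder.measurableSet_Iic t

theorem measurableSet_of_isUpperSet {S : Set α} (hS : IsUpperSet S) : MeasurableSet S :=
  (measurableSet_of_isLowerSet hS.compl).of_compl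

theorem measurable_of_monotone {H : α → ℝ≥0∞} (hH : Monotone H) : Measurable H :=
  measurable_of_Iic fun _ => measurableSet_of_isLowerSet fun _ _ hab ha => (hH hab).trans ha

theorem measurable_of_antitone {H : α → ℝ≥0∞} (hH : Antitone H) : Measurable H :=
  measurable_of_Iic fun _ => measurableSet_of_isUpperSet fun _ _ hab ha => (hH hab).trans ha

/-- Continuity from below: `S` is a countable directed union of its pieces below points of `S`. -/
theorem measure_le_of_forall_Iic {μ : Measure α} {S : Set α} {K : ℝ≥0∞}
    (h : ∀ t ∈ S, μ (S ∩ Set.Iic t) ≤ K) : μ S ≤ K := by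
  obtain ⟨T, hTS, hTc, hT⟩ := CofinalOrder.exists_cofinal S
  have : S = ⋃ t ∈ T, S ∩ Set.Iic t := by
    ext s
    simp only [Set.mem_iUnion, Set.mem_Iic, exists_prop, Set.mem_inter_iff]
    exact ⟨fun hs => (hT s hs).imp fun t ht => ⟨ht.1, hs, ht.2⟩, fun ⟨t, _, h, _⟩ => h⟩
  rw [this, measure_biUnion_eq_iSup hTc]
  · exact iSup₂_le fun t ht => h t (hTS ht)
  · intro x hx y hy
    rcases le_total x y with hxy | hxy
    · exact ⟨y, hy, Set.inter_subset_inter_right _ (Set.Iic_subset_Iic.2 hxy), subset_rfl⟩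
    · exact ⟨x, hx, subset_rfl, Set.inter_subset_inter_right _ (Set.Iic_subset_Iic.2 hxy)⟩

theorem measure_le_of_forall_Ici {μ : Measure α} {S : Set α} {K : ℝ≥0∞}
    (h : ∀ t ∈ S, μ (S ∩ Set.Ici t) ≤ K) : μ S ≤ K := by
  obtain ⟨T, hTS, hTc, hT⟩ := CofinalOrder.exists_coinitial S
  have : S = ⋃ t ∈ T, S ∩ Set.Ici t := by
    ext s
    simp only [Set.mem_iUnion, Set.mem_Ici, exists_prop, Set.mem_inter_iff]
    exact ⟨fun hs => (hT s hs).imp fun t ht => ⟨ht.1, hs, ht.2⟩, fun ⟨t, _, h, _⟩ => h⟩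
  rw [this, measure_biUnion_eq_iSup hTc]
  · exact iSup₂_le fun t ht => h t (hTS ht)
  · intro x hx y hy
    rcases le_total x y with hxy | hxy
    · exact ⟨x, hx, subset_rfl, Set.inter_subset_inter_right _ (Set.Ici_subset_Ici.2 hxy)⟩
    · exact ⟨y, hy, Set.inter_subset_inter_right _ (Set.Ici_subset_Ici.2 hxy), subset_rfl⟩

/-- Chebyshev-type argument: the points of `E` whose tail `E ∩ Ici t` has measure at most `K` form a
final piece of measure at most `K`. On the remaining piece the integrand exceeds `K ^ s`. -/
theorem rpow_mul_sub_le_lintegral (μ : Measure α) {E : Set α} (hE : MeasurableSet E) {s : ℝ}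
    (hs : 0 < s) (K : ℝ≥0∞) : K ^ s * (μ E - K) ≤ ∫⁻ t in E, μ (E ∩ Set.Ici t) ^ s ∂μ := by
  set S : Set α := {t | μ (E ∩ Set.Ici t) ≤ K} with hSdef
  have hS : MeasurableSet S := measurableSet_of_isUpperSet fun a b hab ha =>
    (antitone_measure_inter_Ici μ E hab).trans ha
  have h1 : μ (E ∩ S) ≤ K := measure_le_of_forall_Ici fun t ht =>
    (measure_mono (Set.inter_subset_inter_left _ Set.inter_subset_left)).trans ht.2
  calc K ^ s * (μ E - K) ≤ K ^ s * μ (E \ S) := by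
        gcongr
        refine (tsub_le_tsub_left h1 _).trans ?_
        rw [← Set.sdiff_inter_self_eq_sdiff, Set.inter_comm S E]
        exact le_measure_sdiff
    _ = ∫⁻ _ in E \ S, K ^ s ∂μ := by rw [setLIntegral_const]
    _ ≤ ∫⁻ t in E \ S, μ (E ∩ Set.Ici t) ^ s ∂μ := by
        refine setLIntegral_mono' (hE.diff hS) fun t ht => ?_
        exact ENNReal.rpow_le_rpow (not_le.1 ht.2).le hs.le
    _ ≤ _ := lintegral_mono_set Set.sdiff_subset

/-- A substitute, valid for measures with atoms, for integrating the derivative of a power of the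
tail. It comes from the preceding bound with `K` half the measure of `E`, or `K = 1` when that
measure is infinite. -/
theorem rpow_measure_le_lintegral (μ : Measure α) {E : Set α} (hE : MeasurableSet E) {s : ℝ}
    (hs : 0 < s) :
    μ E ^ (1 + s) ≤ 2 ^ (1 + s) * ∫⁻ t in E, μ (E ∩ Set.Ici t) ^ s ∂μ := by
  by_cases htop : μ E = ∞
  · have h := rpow_mul_sub_le_lintegral μ hE hs 1
    rw [htop] at h
    simp only [ENNReal.one_rpow, one_mul, ENNReal.top_sub ENNReal.one_ne_top, top_le_iff] at h
    rw [h, ENNReal.mul_top (by positivity)]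
    exact le_top
  · have h := rpow_mul_sub_le_lintegral μ hE hs (μ E / 2)
    rw [ENNReal.sub_half htop] at h
    calc μ E ^ (1 + s) = 2 ^ (1 + s) * ((μ E / 2) ^ s * (μ E / 2)) := by
          conv_rhs => enter [2, 2]; rw [← ENNReal.rpow_one (μ E / 2)]
          rw [← ENNReal.rpow_add_of_nonneg _ _ hs.le zero_le_one, add_comm s 1,
            ← ENNReal.mul_rpow_of_nonneg _ _ (by positivity),
            ENNReal.mul_div_cancel (by norm_num) (by norm_num)]
      _ ≤ _ := by gcongr

end Order

/-! ### Dyadic level sets -/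

/-- The level set `{2 ^ j < H ≤ 2 ^ (j + 1)}`. -/
def level {α : Type*} (H : α → ℝ≥0∞) (j : ℤ) : Set α :=
  {t | (2 : ℝ≥0∞) ^ (j : ℝ) < H t ∧ H t ≤ (2 : ℝ≥0∞) ^ ((j : ℝ) + 1)}

theorem two_rpow_ne_zero (s : ℝ) : (2 : ℝ≥0∞) ^ s ≠ 0 :=
  (ENNReal.rpow_pos (by norm_num) (by norm_num)).ne'

theorem two_rpow_ne_top (s : ℝ) : (2 : ℝ≥0∞) ^ s ≠ ∞ :=
  by simp [ENNReal.rpow_eq_top_iff]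

theorem two_rpow_add (s t : ℝ) : (2 : ℝ≥0∞) ^ (s + t) = 2 ^ s * 2 ^ t :=
  ENNReal.rpow_add _ _ (by norm_num) (by norm_num)

theorem two_rpow_mono {s t : ℝ} (h : s ≤ t) : (2 : ℝ≥0∞) ^ s ≤ 2 ^ t :=
  ENNReal.rpow_le_rpow_of_exponent_le (by norm_num) h

theorem exists_mem_level {α : Type*} {H : α → ℝ≥0∞} {t : α} (h0 : H t ≠ 0) (h1 : H t ≠ ∞) :
    ∃ j, t ∈ level H j := by
  obtain ⟨n, hn⟩ := ENNReal.exists_mem_Ioc_zpow h0 h1 (y := 2) (by norm_num) (by norm_num)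
  refine ⟨n, ?_⟩
  rw [← ENNReal.rpow_intCast, ← ENNReal.rpow_intCast] at hn
  push_cast at hn
  exact hn

theorem pairwise_disjoint_level {α : Type*} (H : α → ℝ≥0∞) :
    Pairwise (Function.onFun Disjoint (level H)) := by
  have key : ∀ i j : ℤ, i < j → Disjoint (level H i) (level H j) := by
    intro i j hij
    rw [Set.disjoint_left]
    rintro t ⟨-, h1⟩ ⟨h2, -⟩
    have : (i : ℝ) + 1 ≤ j := by exact_mod_cast hij
    exact absurd (h2.trans_le (h1.trans (two_rpow_mono this))) (lt_irrefl _)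
  intro i j hij
  rcases lt_or_gt_of_ne hij with h | h
  exacts [key i j h, (key j i h).symm]

section Level

variable {α : Type*} [LinearOrder α] [MeasurableSpace α] [CofinalOrder α]

theorem measurableSet_level {H : α → ℝ≥0∞} (hH : Monotone H) (j : ℤ) :
    MeasurableSet (level H j) :=
  measurable_of_monotone hH measurableSet_Ioc

theorem lintegral_le_tsum_level {μ : Measure α} {H G : α → ℝ≥0∞} (hH : Monotone H)
    {c : ℤ → ℝ≥0∞} (h0 : ∀ᵐ t ∂μ, (H t = 0 ∨ H t = ∞) → G t = 0)
    (hc : ∀ j, ∀ t ∈ level H j, G t ≤ c j) :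
    ∫⁻ t, G t ∂μ ≤ ∑' j : ℤ, c j * μ (level H j) := by
  calc ∫⁻ t, G t ∂μ ≤ ∫⁻ t, ∑' j : ℤ, (level H j).indicator (fun _ => c j) t ∂μ := by
        refine lintegral_mono_ae ?_
        filter_upwards [h0] with t ht
        by_cases h : H t = 0 ∨ H t = ∞
        · simp [ht h]
        · push Not at h
          obtain ⟨j, hj⟩ := exists_mem_level h.1 h.2
          refine (hc j t hj).trans ?_
          refine le_trans ?_ (ENNReal.le_tsum j)
          simp [hj]
    _ = _ := by
        rw [lintegral_tsum fun j =>
          (measurable_const.indicator (measurableSet_level hH j)).aemeasurable]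
        refine tsum_congr fun j => ?_
        rw [lintegral_indicator_const (measurableSet_level hH j)]

end Level

/-! ### Inequalities for sums -/

/-- A discrete Hardy inequality with geometric weights. -/
theorem exists_tsum_geometric_hardy {s κ : ℝ} (hs : 0 < s) (hκ : 0 < κ) :
    ∃ c : ℝ≥0, ∀ e : ℤ → ℝ≥0∞,
      ∑' j : ℤ, (2 : ℝ≥0∞) ^ (s * j) * (∑' n : ℕ, e (j + n)) ^ κ ≤
        c * ∑' j : ℤ, (2 : ℝ≥0∞) ^ (s * j) * e j ^ κ := by
  have geo : ∀ t : ℝ, 0 < t → ∑' n : ℕ, (2 : ℝ≥0∞) ^ (-(t * n)) ≠ ∞ := by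
    intro t ht
    have : ∀ n : ℕ, (2 : ℝ≥0∞) ^ (-(t * n)) = ((2 : ℝ≥0∞) ^ (-t)) ^ n := by
      intro n
      rw [← ENNReal.rpow_natCast, ← ENNReal.rpow_mul]
      congr 1; ring
    simp_rw [this]
    rw [ENNReal.tsum_geometric]
    refine ENNReal.inv_ne_top.2 (tsub_pos_of_lt ?_).ne'
    exact ENNReal.rpow_lt_one_of_one_lt_of_neg (by norm_num) (by linarith)
  -- Half of the geometric gain is spent on pulling the power `κ` inside the sum over `n`, the other
  -- half on summing over the shifts `n`.
  set ε := s / 2 / κ with hε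
  have hε0 : 0 < ε := by positivity
  have hεκ : ε * κ = s / 2 := by rw [hε]; field_simp
  set G1 := ∑' n : ℕ, (2 : ℝ≥0∞) ^ (-(ε * n)) with hG1
  set G2 := ∑' n : ℕ, (2 : ℝ≥0∞) ^ (-(s / 2 * n)) with hG2
  have hG1t : G1 ^ κ ≠ ∞ := ENNReal.rpow_ne_top_of_nonneg hκ.le (geo ε hε0)
  have hG2t : G2 ≠ ∞ := geo _ (by positivity)
  refine ⟨(G1 ^ κ * G2).toNNReal, fun e => ?_⟩
  rw [ENNReal.coe_toNNReal (ENNReal.mul_ne_top hG1t hG2t)]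
  -- Each `2 ^ (ε n) * e (j + n)` is dominated by the `ℓ^κ` norm `m ^ (1 / κ)`, and the factors `2 ^
  -- (-ε n)` are summable. This avoids Hölder and so works for `κ` on either side of 1.
  have hpt : ∀ j : ℤ, (∑' n : ℕ, e (j + n)) ^ κ ≤
      G1 ^ κ * ∑' n : ℕ, (2 : ℝ≥0∞) ^ (s / 2 * n) * e (j + n) ^ κ := by
    intro j
    set m := ∑' n : ℕ, (2 : ℝ≥0∞) ^ (s / 2 * n) * e (j + n) ^ κ with hm
    have : ∑' n : ℕ, e (j + n) ≤ G1 * m ^ (1 / κ) := by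
      rw [hG1, ← ENNReal.tsum_mul_right]
      refine ENNReal.tsum_le_tsum fun n => ?_
      have h1 : (2 : ℝ≥0∞) ^ (ε * n) * e (j + n) ≤ m ^ (1 / κ) := by
        rw [one_div, ENNReal.le_rpow_inv_iff hκ, ENNReal.mul_rpow_of_nonneg _ _ hκ.le,
          ← ENNReal.rpow_mul]
        refine le_trans (le_of_eq ?_) (ENNReal.le_tsum n)
        congr 2
        rw [← hεκ]; ring
      calc e (j + n) = (2 : ℝ≥0∞) ^ (-(ε * n)) * ((2 : ℝ≥0∞) ^ (ε * n) * e (j + n)) := by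
            rw [← mul_assoc, ← two_rpow_add]; simp
        _ ≤ _ := by gcongr
    calc (∑' n : ℕ, e (j + n)) ^ κ ≤ (G1 * m ^ (1 / κ)) ^ κ := by gcongr
      _ = _ := by
        rw [ENNReal.mul_rpow_of_nonneg _ _ hκ.le, ← ENNReal.rpow_mul, one_div,
          inv_mul_cancel₀ hκ.ne', ENNReal.rpow_one]
  calc ∑' j : ℤ, (2 : ℝ≥0∞) ^ (s * j) * (∑' n : ℕ, e (j + n)) ^ κ
      ≤ ∑' j : ℤ, ∑' n : ℕ,
          G1 ^ κ * (2 ^ (-(s / 2 * n)) * (2 ^ (s * ((j + n : ℤ) : ℝ)) * e (j + n) ^ κ)) := by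
        refine ENNReal.tsum_le_tsum fun j => ?_
        refine (mul_le_mul_right (hpt j) _).trans (le_of_eq ?_)
        rw [ENNReal.tsum_mul_left, mul_left_comm, ← ENNReal.tsum_mul_left]
        congr 1
        refine tsum_congr fun n => ?_
        rw [← mul_assoc, ← mul_assoc, ← two_rpow_add, ← two_rpow_add]
        congr 2; push_cast; ring
    _ = ∑' n : ℕ, G1 ^ κ * (2 ^ (-(s / 2 * n)) * ∑' j : ℤ, 2 ^ (s * (j : ℝ)) * e j ^ κ) := by
        rw [ENNReal.tsum_comm]
        refine tsum_congr fun n => ?_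
        rw [ENNReal.tsum_mul_left, ENNReal.tsum_mul_left]
        congr 2
        exact (Equiv.addRight (n : ℤ)).tsum_eq fun j : ℤ => (2 : ℝ≥0∞) ^ (s * (j : ℝ)) * e j ^ κ
    _ = _ := by
        rw [ENNReal.tsum_mul_left, ENNReal.tsum_mul_right, mul_assoc]

/-- One factor is kept in `y ^ κ = y * y ^ (κ - 1)` and the other is bounded by the power of the
whole sum. -/
theorem tsum_rpow_le_rpow_tsum {ι : Type*} (y : ι → ℝ≥0∞) {κ : ℝ} (hκ : 1 ≤ κ) :
    ∑' j, y j ^ κ ≤ (∑' j, y j) ^ κ := by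
  have split : ∀ x : ℝ≥0∞, x ^ κ = x * x ^ (κ - 1) := by
    intro x
    conv_rhs => enter [1]; rw [← ENNReal.rpow_one x]
    rw [← ENNReal.rpow_add_of_nonneg _ _ zero_le_one (by linarith)]
    congr 1; ring
  rw [split (∑' j, y j), ← ENNReal.tsum_mul_right]
  refine ENNReal.tsum_le_tsum fun j => ?_
  rw [split]
  refine mul_le_mul_right (ENNReal.rpow_le_rpow (ENNReal.le_tsum j) (by linarith)) _

theorem tsum_rpow_mul_rpow_le {ι : Type*} [Countable ι] (y T : ι → ℝ≥0∞) {a b : ℝ} (ha : 0 ≤ a)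
    (hb : 0 ≤ b) (hab : a + b = 1) :
    ∑' j, y j ^ a * T j ^ b ≤ (∑' j, y j) ^ a * (∑' j, T j) ^ b := by
  let _ : MeasurableSpace ι := ⊤
  simp only [← lintegral_count]
  exact ENNReal.lintegral_mul_norm_pow_le measurable_from_top.aemeasurable
    measurable_from_top.aemeasurable ha hb hab

/-! ### Upper bounds in the abstract Hardy inequality -/

section Sufficiency

variable {α : Type*} [LinearOrder α] [MeasurableSpace α] [CofinalOrder α]

theorem measure_le_of_ae_Ici {μ : Measure α} {S : Set α} {K : ℝ≥0∞}
    (h : ∀ᵐ t ∂μ, t ∈ S → μ (S ∩ Set.Ici t) ≤ K) : μ S ≤ K := by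
  set G : Set α := {t | t ∈ S → μ (S ∩ Set.Ici t) ≤ K} with hG
  have h0 : μ Gᶜ = 0 := h
  calc μ S ≤ μ (S ∩ G) + μ (S \ G) := measure_le_inter_add_sdiff _ _ _
    _ ≤ K + 0 := by
      gcongr
      · exact measure_le_of_forall_Ici fun t ht =>
          (measure_mono (Set.inter_subset_inter_left _ Set.inter_subset_left)).trans (ht.2 ht.1)
      · exact (measure_mono fun x hx => hx.2).trans h0.le
    _ = K := add_zero _

variable {ν μ : Measure α} {h e Φ : α → ℝ≥0∞} {P Q : ℝ}

/-- The points where `H ≤ 2 ^ (j - 1)` contribute at most `2 ^ (j - 1)` to `H t > 2 ^ j`. What is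
left is at least `2 ^ (j - 1)` and comes from the levels `j - 1` and `j` to the left of `t`, where
`hΦ` applies. -/
theorem two_rpow_le_of_mem_level (hP : 0 < P)
    (hΦ : ∀ t F, MeasurableSet F → F ⊆ Set.Iic t →
      ∫⁻ s in F, h s ∂ν ≤ (∫⁻ s in F, e s ∂ν) ^ (1 / P) * Φ t)
    {j : ℤ} {t : α} (ht : t ∈ level (fun t => ∫⁻ s in Set.Iic t, h s ∂ν) j) :
    (2 : ℝ≥0∞) ^ ((j : ℝ) - 1) ≤
      (∫⁻ s in level (fun t => ∫⁻ s in Set.Iic t, h s ∂ν) (j - 1) ∪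
        level (fun t => ∫⁻ s in Set.Iic t, h s ∂ν) j, e s ∂ν) ^ (1 / P) * Φ t := by
  set H : α → ℝ≥0∞ := fun t => ∫⁻ s in Set.Iic t, h s ∂ν with hH
  have hmono : Monotone H := fun a b hab => lintegral_mono_set (Set.Iic_subset_Iic.2 hab)
  set I : Set α := {s | H s ≤ 2 ^ ((j : ℝ) - 1)} with hI
  have hIm : MeasurableSet I := measurableSet_of_isLowerSet fun a b hab ha => (hmono hab).trans ha
  have hIle : ∫⁻ s in I, h s ∂ν ≤ 2 ^ ((j : ℝ) - 1) := by
    rw [← withDensity_apply _ hIm]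
    refine measure_le_of_forall_Iic fun s hs => ?_
    refine (measure_mono Set.inter_subset_right).trans ?_
    rw [withDensity_apply _ (CofinalOrder.measurableSet_Iic s)]
    exact hs
  set F := level H (j - 1) ∪ level H j with hF
  have hFm : MeasurableSet F := (measurableSet_level hmono _).union (measurableSet_level hmono _)
  have hsub : Set.Iic t ⊆ I ∪ (F ∩ Set.Iic t) := by
    intro s hs
    by_cases h1 : s ∈ I
    · exact Or.inl h1
    · refine Or.inr ⟨?_, hs⟩
      have h1 : (2 : ℝ≥0∞) ^ ((j : ℝ) - 1) < H s := not_le.1 h1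
      by_cases h2 : H s ≤ 2 ^ (j : ℝ)
      · refine Or.inl ⟨?_, ?_⟩
        · push_cast; exact h1
        · push_cast; simpa using h2
      · exact Or.inr ⟨not_le.1 h2, (hmono hs).trans ht.2⟩
  have hX : ∫⁻ s in F ∩ Set.Iic t, h s ∂ν ≤ (∫⁻ s in F, e s ∂ν) ^ (1 / P) * Φ t := by
    refine (hΦ t _ (hFm.inter (CofinalOrder.measurableSet_Iic t)) Set.inter_subset_right).trans ?_
    gcongr
    exact Set.inter_subset_left
  refine le_trans ?_ hX
  have h3 : (2 : ℝ≥0∞) ^ (j : ℝ) < 2 ^ ((j : ℝ) - 1) + ∫⁻ s in F ∩ Set.Iic t, h s ∂ν :=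
    calc (2 : ℝ≥0∞) ^ (j : ℝ) < H t := ht.1
      _ ≤ ∫⁻ s in I ∪ (F ∩ Set.Iic t), h s ∂ν := lintegral_mono_set hsub
      _ ≤ _ := lintegral_union_le _ _ _
      _ ≤ _ := by gcongr
  have h4 : (2 : ℝ≥0∞) ^ (j : ℝ) = 2 ^ ((j : ℝ) - 1) + 2 ^ ((j : ℝ) - 1) := by
    rw [← two_mul]
    conv_rhs => enter [1]; rw [← ENNReal.rpow_one 2]
    rw [← two_rpow_add]; congr 1; ring
  rw [h4] at h3
  exact (lt_of_add_lt_add_left h3).le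

theorem tsum_lintegral_level_union_le (H : α → ℝ≥0∞) (hH : Monotone H) :
    ∑' j : ℤ, ∫⁻ s in level H (j - 1) ∪ level H j, e s ∂ν ≤ 2 * ∫⁻ s, e s ∂ν := by
  have h1 : ∑' j : ℤ, ∫⁻ s in level H j, e s ∂ν ≤ ∫⁻ s, e s ∂ν := by
    rw [← lintegral_iUnion (measurableSet_level hH) (pairwise_disjoint_level H)]
    exact setLIntegral_le_lintegral _ _
  calc ∑' j : ℤ, ∫⁻ s in level H (j - 1) ∪ level H j, e s ∂ν
      ≤ ∑' j : ℤ, (∫⁻ s in level H (j - 1), e s ∂ν + ∫⁻ s in level H j, e s ∂ν) :=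
        ENNReal.tsum_le_tsum fun j => lintegral_union_le _ _ _
    _ = (∑' j : ℤ, ∫⁻ s in level H j, e s ∂ν) + ∑' j : ℤ, ∫⁻ s in level H j, e s ∂ν := by
        rw [ENNReal.tsum_add]
        congr 1
        exact (Equiv.subRight (1 : ℤ)).tsum_eq fun j : ℤ => ∫⁻ s in level H j, e s ∂ν
    _ ≤ _ := by rw [two_mul]; gcongr

/-- Since `e` has finite integral, `H` can be infinite only where `Φ` is, and that happens on a
`μ`-null set. On level `j` the value of `H` is at most `4 * 2 ^ (j - 1)`, which gives the constant.
-/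
theorem lintegral_rpow_le_tsum_level (hP : 0 < P) (hQ : 0 < Q)
    (hΦ : ∀ t F, MeasurableSet F → F ⊆ Set.Iic t →
      ∫⁻ s in F, h s ∂ν ≤ (∫⁻ s in F, e s ∂ν) ^ (1 / P) * Φ t)
    (he : ∫⁻ s, e s ∂ν ≠ ∞) (hfin : ∀ᵐ t ∂μ, Φ t = ∞ → μ (Set.Ici t) = 0) :
    ∫⁻ t, (∫⁻ s in Set.Iic t, h s ∂ν) ^ Q ∂μ ≤ 4 ^ Q * ∑' j : ℤ,
      ((2 : ℝ≥0∞) ^ ((j : ℝ) - 1)) ^ Q *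
        μ (level (fun t => ∫⁻ s in Set.Iic t, h s ∂ν) j) := by
  set H : α → ℝ≥0∞ := fun t => ∫⁻ s in Set.Iic t, h s ∂ν with hH
  have hmono : Monotone H := fun a b hab => lintegral_mono_set (Set.Iic_subset_Iic.2 hab)
  have htop : ∀ t, H t = ∞ → Φ t = ∞ := by
    intro t ht
    by_contra hne
    have h1 := hΦ t (Set.Iic t) (CofinalOrder.measurableSet_Iic t) subset_rfl
    have h2 : (∫⁻ s in Set.Iic t, e s ∂ν) ^ (1 / P) ≠ ∞ :=
      ENNReal.rpow_ne_top_of_nonneg (by positivity)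
        (ne_top_of_le_ne_top he (setLIntegral_le_lintegral _ _))
    exact ENNReal.mul_ne_top h2 hne (top_le_iff.1 (ht ▸ h1))
  have hnull : μ {t | H t = ∞} = 0 := by
    refine le_antisymm (measure_le_of_ae_Ici ?_) zero_le
    filter_upwards [hfin] with t ht hts
    exact (measure_mono Set.inter_subset_right).trans (ht (htop t hts)).le
  have h0 : ∀ᵐ t ∂μ, (H t = 0 ∨ H t = ∞) → H t ^ Q = 0 := by
    have : ∀ᵐ t ∂μ, H t ≠ ∞ := by simpa [ae_iff] using hnull
    filter_upwards [this] with t ht hh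
    rcases hh with hh | hh
    · rw [hh, ENNReal.zero_rpow_of_pos hQ]
    · exact absurd hh ht
  refine (lintegral_le_tsum_level hmono h0 (c := fun j => (2 ^ ((j : ℝ) + 1)) ^ Q)
    fun j t ht => ENNReal.rpow_le_rpow ht.2 hQ.le).trans (le_of_eq ?_)
  rw [← ENNReal.tsum_mul_left]
  refine tsum_congr fun j => ?_
  rw [← mul_assoc, ← ENNReal.mul_rpow_of_nonneg _ _ hQ.le]
  congr 2
  have : (4 : ℝ≥0∞) = 2 ^ (2 : ℝ) := by norm_num
  rw [this, ← two_rpow_add]; congr 1; ring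

/-- Upper bound in the weighted Hardy inequality for exponents `P ≤ Q`. -/
theorem hardy_upper_of_le (hP : 0 < P) (hPQ : P ≤ Q)
    (hΦ : ∀ t F, MeasurableSet F → F ⊆ Set.Iic t →
      ∫⁻ s in F, h s ∂ν ≤ (∫⁻ s in F, e s ∂ν) ^ (1 / P) * Φ t)
    (he : ∫⁻ s, e s ∂ν ≠ ∞) {A : ℝ≥0∞} (hA : A ≠ ∞)
    (hAle : ∀ᵐ t ∂μ, Φ t ^ Q * μ (Set.Ici t) ≤ A) :
    ∫⁻ t, (∫⁻ s in Set.Iic t, h s ∂ν) ^ Q ∂μ ≤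
      4 ^ Q * 2 ^ (Q / P) * (A * (∫⁻ s, e s ∂ν) ^ (Q / P)) := by
  have hQ : 0 < Q := hP.trans_le hPQ
  set H : α → ℝ≥0∞ := fun t => ∫⁻ s in Set.Iic t, h s ∂ν with hH
  have hmono : Monotone H := fun a b hab => lintegral_mono_set (Set.Iic_subset_Iic.2 hab)
  have hfin : ∀ᵐ t ∂μ, Φ t = ∞ → μ (Set.Ici t) = 0 := by
    filter_upwards [hAle] with t ht hΦt
    by_contra hne
    rw [hΦt, ENNReal.top_rpow_of_pos hQ, ENNReal.top_mul hne] at ht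
    exact hA (top_le_iff.1 ht)
  refine (lintegral_rpow_le_tsum_level hP hQ hΦ he hfin).trans ?_
  rw [mul_assoc]
  gcongr
  set y : ℤ → ℝ≥0∞ := fun j => ∫⁻ s in level H (j - 1) ∪ level H j, e s ∂ν with hy
  -- It suffices to bound the measure of `level H j ∩ Ici t` for almost every `t` in the level;
  -- there `2 ^ (j - 1)` is controlled by `Φ t` at the same point `t`, so the hypothesis on `Φ t ^ Q
  -- * μ (Ici t)` applies.
  have hterm : ∀ j : ℤ, ((2 : ℝ≥0∞) ^ ((j : ℝ) - 1)) ^ Q * μ (level H j) ≤ A * y j ^ (Q / P) := by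
    intro j
    have h0 : ((2 : ℝ≥0∞) ^ ((j : ℝ) - 1)) ^ Q ≠ 0 := by
      rw [← ENNReal.rpow_mul]; exact two_rpow_ne_zero _
    have h1 : ((2 : ℝ≥0∞) ^ ((j : ℝ) - 1)) ^ Q ≠ ∞ := by
      rw [← ENNReal.rpow_mul]; exact two_rpow_ne_top _
    rw [mul_comm, ← ENNReal.le_div_iff_mul_le (Or.inl h0) (Or.inl h1)]
    refine measure_le_of_ae_Ici ?_
    filter_upwards [hAle] with t ht htj
    rw [ENNReal.le_div_iff_mul_le (Or.inl h0) (Or.inl h1), mul_comm]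
    calc ((2 : ℝ≥0∞) ^ ((j : ℝ) - 1)) ^ Q * μ (level H j ∩ Set.Ici t)
        ≤ (y j ^ (1 / P) * Φ t) ^ Q * μ (Set.Ici t) := by
          gcongr
          · exact two_rpow_le_of_mem_level hP hΦ htj
          · exact Set.inter_subset_right
      _ = (Φ t ^ Q * μ (Set.Ici t)) * y j ^ (Q / P) := by
          rw [ENNReal.mul_rpow_of_nonneg _ _ hQ.le, ← ENNReal.rpow_mul, one_div_mul_eq_div]
          ring
      _ ≤ _ := by gcongr
  calc ∑' j : ℤ, ((2 : ℝ≥0∞) ^ ((j : ℝ) - 1)) ^ Q * μ (level H j)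
      ≤ ∑' j : ℤ, A * y j ^ (Q / P) := ENNReal.tsum_le_tsum hterm
    _ ≤ A * (∑' j : ℤ, y j) ^ (Q / P) := by
        rw [ENNReal.tsum_mul_left]
        gcongr
        exact tsum_rpow_le_rpow_tsum _ ((one_le_div hP).2 hPQ)
    _ ≤ A * (2 * ∫⁻ s, e s ∂ν) ^ (Q / P) := by
        gcongr
        exact tsum_lintegral_level_union_le H hmono
    _ = _ := by
        rw [ENNReal.mul_rpow_of_nonneg _ _ (by positivity)]
        ring

/-- Upper bound in the weighted Hardy inequality for exponents `Q < P`. -/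
theorem hardy_upper_of_lt (hQ : 0 < Q) (hQP : Q < P) (hΦm : Monotone Φ)
    (hΦ : ∀ t F, MeasurableSet F → F ⊆ Set.Iic t →
      ∫⁻ s in F, h s ∂ν ≤ (∫⁻ s in F, e s ∂ν) ^ (1 / P) * Φ t)
    (he : ∫⁻ s, e s ∂ν ≠ ∞)
    (hA : ∫⁻ t, Φ t ^ (P * Q / (P - Q)) * μ (Set.Ici t) ^ (Q / (P - Q)) ∂μ ≠ ∞) :
    ∫⁻ t, (∫⁻ s in Set.Iic t, h s ∂ν) ^ Q ∂μ ≤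
      4 ^ Q * 2 ^ (Q / P) * 2 *
        ((∫⁻ t, Φ t ^ (P * Q / (P - Q)) * μ (Set.Ici t) ^ (Q / (P - Q)) ∂μ) ^ ((P - Q) / P) *
          (∫⁻ s, e s ∂ν) ^ (Q / P)) := by
  have hP : 0 < P := hQ.trans hQP
  have hd : 0 < P - Q := sub_pos.2 hQP
  set R := P * Q / (P - Q) with hR
  set σ := Q / (P - Q) with hσ
  have hR0 : 0 < R := by positivity
  have hσ0 : 0 < σ := by positivity
  set H : α → ℝ≥0∞ := fun t => ∫⁻ s in Set.Iic t, h s ∂ν with hH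
  have hmono : Monotone H := fun a b hab => lintegral_mono_set (Set.Iic_subset_Iic.2 hab)
  set g : α → ℝ≥0∞ := fun t => Φ t ^ R * μ (Set.Ici t) ^ σ with hg
  have hgm : Measurable g := ((measurable_of_monotone hΦm).pow_const _).mul
    ((measurable_of_antitone (antitone_measure_Ici μ)).pow_const _)
  have hfin : ∀ᵐ t ∂μ, Φ t = ∞ → μ (Set.Ici t) = 0 := by
    filter_upwards [ae_lt_top hgm hA] with t ht hΦt
    by_contra hne
    refine ht.ne ?_
    simp only [hg, hΦt, ENNReal.top_rpow_of_pos hR0]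
    exact ENNReal.top_mul (by simp [hne, hσ0.le])
  refine (lintegral_rpow_le_tsum_level hP hQ hΦ he hfin).trans ?_
  rw [mul_assoc, mul_assoc]
  gcongr
  set y : ℤ → ℝ≥0∞ := fun j => ∫⁻ s in level H (j - 1) ∪ level H j, e s ∂ν with hy
  have hterm : ∀ j : ℤ, ((2 : ℝ≥0∞) ^ ((j : ℝ) - 1)) ^ Q * μ (level H j) ≤
      2 * (y j ^ (Q / P) * (∫⁻ t in level H j, g t ∂μ) ^ ((P - Q) / P)) := by
    intro j
    have hσ1 : 0 < 1 + σ := by positivity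
    have e1 : Q * (1 + σ) = R := by rw [hσ, hR]; field_simp; ring
    have e2 : (P - Q) / P = (1 + σ)⁻¹ := by rw [hσ]; field_simp; ring
    have e3 : R / P * (1 + σ)⁻¹ = Q / P := by rw [hσ, hR]; field_simp; ring
    -- Raising to the power `1 + σ = P / (P - Q)` lets the measure of the level be replaced by an
    -- integral of its tails, and under that integral the pointwise bound of `2 ^ (j - 1)` by `Φ t`
    -- can be inserted.
    have hpow : (((2 : ℝ≥0∞) ^ ((j : ℝ) - 1)) ^ Q * μ (level H j)) ^ (1 + σ) ≤
        2 ^ (1 + σ) * (y j ^ (R / P) * ∫⁻ t in level H j, g t ∂μ) := by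
      calc (((2 : ℝ≥0∞) ^ ((j : ℝ) - 1)) ^ Q * μ (level H j)) ^ (1 + σ)
          = ((2 : ℝ≥0∞) ^ ((j : ℝ) - 1)) ^ R * μ (level H j) ^ (1 + σ) := by
            rw [ENNReal.mul_rpow_of_nonneg _ _ hσ1.le, ← ENNReal.rpow_mul _ Q, e1]
        _ ≤ ((2 : ℝ≥0∞) ^ ((j : ℝ) - 1)) ^ R *
            (2 ^ (1 + σ) * ∫⁻ t in level H j, μ (level H j ∩ Set.Ici t) ^ σ ∂μ) := by
            gcongr
            exact rpow_measure_le_lintegral μ (measurableSet_level hmono j) hσ0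
        _ = 2 ^ (1 + σ) * ∫⁻ t in level H j,
              ((2 : ℝ≥0∞) ^ ((j : ℝ) - 1)) ^ R * μ (level H j ∩ Set.Ici t) ^ σ ∂μ := by
            rw [lintegral_const_mul _ ((measurable_of_antitone
              (antitone_measure_inter_Ici μ _)).pow_const _)]
            ring
        _ ≤ 2 ^ (1 + σ) * ∫⁻ t in level H j, y j ^ (R / P) * g t ∂μ := by
            gcongr 2 ^ (1 + σ) * ?_
            refine setLIntegral_mono' (measurableSet_level hmono j) fun t ht => ?_
            calc ((2 : ℝ≥0∞) ^ ((j : ℝ) - 1)) ^ R * μ (level H j ∩ Set.Ici t) ^ σ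
                ≤ (y j ^ (1 / P) * Φ t) ^ R * μ (Set.Ici t) ^ σ := by
                  gcongr
                  · exact two_rpow_le_of_mem_level hP hΦ ht
                  · exact Set.inter_subset_right
              _ = _ := by
                  rw [ENNReal.mul_rpow_of_nonneg _ _ hR0.le, ← ENNReal.rpow_mul,
                    one_div_mul_eq_div, mul_assoc]
        _ = _ := by rw [lintegral_const_mul _ hgm]
    rw [e2]
    calc ((2 : ℝ≥0∞) ^ ((j : ℝ) - 1)) ^ Q * μ (level H j)
        = ((((2 : ℝ≥0∞) ^ ((j : ℝ) - 1)) ^ Q * μ (level H j)) ^ (1 + σ)) ^ (1 + σ)⁻¹ := by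
          rw [ENNReal.rpow_rpow_inv hσ1.ne']
      _ ≤ (2 ^ (1 + σ) * (y j ^ (R / P) * ∫⁻ t in level H j, g t ∂μ)) ^ (1 + σ)⁻¹ := by gcongr
      _ = _ := by
          rw [ENNReal.mul_rpow_of_nonneg _ _ (by positivity),
            ENNReal.mul_rpow_of_nonneg _ _ (by positivity), ← ENNReal.rpow_mul,
            mul_inv_cancel₀ hσ1.ne', ENNReal.rpow_one, ← ENNReal.rpow_mul, e3]
  have hsumg : ∑' j : ℤ, ∫⁻ t in level H j, g t ∂μ ≤ ∫⁻ t, g t ∂μ := by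
    rw [← lintegral_iUnion (measurableSet_level hmono) (pairwise_disjoint_level H)]
    exact setLIntegral_le_lintegral _ _
  calc ∑' j : ℤ, ((2 : ℝ≥0∞) ^ ((j : ℝ) - 1)) ^ Q * μ (level H j)
      ≤ ∑' j : ℤ, 2 * (y j ^ (Q / P) * (∫⁻ t in level H j, g t ∂μ) ^ ((P - Q) / P)) :=
        ENNReal.tsum_le_tsum hterm
    _ ≤ 2 * ((∑' j : ℤ, y j) ^ (Q / P) *
          (∑' j : ℤ, ∫⁻ t in level H j, g t ∂μ) ^ ((P - Q) / P)) := by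
        rw [ENNReal.tsum_mul_left]
        gcongr
        -- Hölder over the levels, with the exponents `Q / P` and `(P - Q) / P` adding to 1.
        exact tsum_rpow_mul_rpow_le _ _ (by positivity) (by positivity) (by field_simp; ring)
    _ ≤ 2 * ((2 * ∫⁻ s, e s ∂ν) ^ (Q / P) * (∫⁻ t, g t ∂μ) ^ ((P - Q) / P)) := by
        gcongr
        exact tsum_lintegral_level_union_le H hmono
    _ = _ := by
        rw [ENNReal.mul_rpow_of_nonneg _ _ (by positivity)]
        ring

end Sufficiency

/-! ### Lower bounds in the abstract Hardy inequality -/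

/-- Passes from finite approximations of `φ` to `φ` itself, including `φ = ∞`, for which the
conclusion forces `m = 0`. -/
theorem rpow_mul_le_of_forall_lt {φ m K : ℝ≥0∞} {Q : ℝ} (hQ : 0 < Q) (hK : K ≠ ∞)
    (h : ∀ l : ℝ≥0, (l : ℝ≥0∞) < φ → (l : ℝ≥0∞) ^ Q * m ≤ K) : φ ^ Q * m ≤ K := by
  by_cases hm : m = 0
  · simp [hm]
  have h1 : φ ≤ (K / m) ^ Q⁻¹ := by
    refine ENNReal.le_of_forall_nnreal_lt fun l hl => ?_
    rw [ENNReal.le_rpow_inv_iff hQ, ENNReal.le_div_iff_mul_le (Or.inl hm) (Or.inr hK)]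
    exact h l hl
  rwa [ENNReal.le_rpow_inv_iff hQ, ENNReal.le_div_iff_mul_le (Or.inl hm) (Or.inr hK)] at h1

/-- The equality case of Hölder: the test sequence is `c j = (l j ^ κ / S) ^ (1 / P)`, with `κ = P /
(P - Q)` and `S` the sum being estimated. -/
theorem sum_rpow_le_of_test {ι : Type*} {P Q : ℝ} (hQ : 0 < Q) (hQP : Q < P) (J : Finset ι)
    (l : ι → ℝ≥0) (K : ℝ≥0)
    (h : ∀ c : ι → ℝ≥0, ∑ j ∈ J, c j ^ P ≤ 1 → ∑ j ∈ J, c j ^ Q * l j ≤ K) :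
    ∑ j ∈ J, l j ^ (P / (P - Q)) ≤ K ^ (P / (P - Q)) := by
  have hP : 0 < P := hQ.trans hQP
  have hd : 0 < P - Q := sub_pos.2 hQP
  set κ := P / (P - Q) with hκ
  have hκ0 : 0 < κ := by positivity
  set S := ∑ j ∈ J, l j ^ κ with hS
  by_cases hS0 : S = 0
  · rw [hS0]; exact zero_le
  have hc := h (fun j => (l j ^ κ / S) ^ (1 / P)) (by
    have : ∀ j ∈ J, ((l j ^ κ / S) ^ (1 / P)) ^ P = l j ^ κ / S := by
      intro j _
      rw [← NNReal.rpow_mul, one_div_mul_cancel hP.ne', NNReal.rpow_one]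
    rw [Finset.sum_congr rfl this, ← Finset.sum_div, div_self hS0])
  have : ∀ j ∈ J, ((l j ^ κ / S) ^ (1 / P)) ^ Q * l j = l j ^ κ * S ^ (-(Q / P)) := by
    intro j _
    by_cases hl : l j = 0
    · rw [hl, NNReal.zero_rpow hκ0.ne']; simp
    rw [← NNReal.rpow_mul, NNReal.div_rpow, one_div_mul_eq_div, div_mul_eq_mul_div,
      ← NNReal.rpow_mul, NNReal.rpow_neg, div_eq_mul_inv]
    congr 1
    conv_lhs => enter [2]; rw [← NNReal.rpow_one (l j)]
    rw [← NNReal.rpow_add hl]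
    congr 1; rw [hκ]; field_simp; ring
  rw [Finset.sum_congr rfl this, ← Finset.sum_mul, ← hS] at hc
  have h2 : S * S ^ (-(Q / P)) = S ^ κ⁻¹ := by
    conv_lhs => enter [1]; rw [← NNReal.rpow_one S]
    rw [← NNReal.rpow_add hS0]
    congr 1; rw [hκ]; field_simp; ring
  rw [h2] at hc
  calc S = (S ^ κ⁻¹) ^ κ := by rw [← NNReal.rpow_mul, inv_mul_cancel₀ hκ0.ne', NNReal.rpow_one]
    _ ≤ _ := by gcongr

/-- The dual description of weighted `ℓ^{P/(P-Q)}`-norms. -/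
theorem tsum_rpow_le_of_test {ι : Type*} {P Q : ℝ} (hQ : 0 < Q) (hQP : Q < P)
    (m : ι → ℝ≥0∞) (K : ℝ≥0)
    (h : ∀ (J : Finset ι) (c l : ι → ℝ≥0), (∀ j ∈ J, (l j : ℝ≥0∞) < m j) →
      ∑ j ∈ J, c j ^ P ≤ 1 → ∑ j ∈ J, c j ^ Q * l j ≤ K) :
    ∑' j, m j ^ (P / (P - Q)) ≤ (2 * (K : ℝ≥0∞)) ^ (P / (P - Q)) := by
  classical
  have hP : 0 < P := hQ.trans hQP
  have hd : 0 < P - Q := sub_pos.2 hQP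
  set κ := P / (P - Q) with hκ
  have hκ0 : 0 < κ := by positivity
  have hfin : ∀ j, m j ≠ ∞ := by
    intro j hj
    have := h {j} (fun _ => 1) (fun _ => K + 1) (by simp [hj]) (by simp)
    simp at this
  rw [ENNReal.tsum_eq_iSup_sum]
  refine iSup_le fun J => ?_
  lift m to ι → ℝ≥0 using hfin
  -- Test values must lie strictly below `m j`; halving the nonzero ones achieves this and costs the
  -- factor 2.
  have key := sum_rpow_le_of_test hQ hQP (J.filter fun j => m j ≠ 0) (fun j => m j / 2) K
    (fun c hc => by
      refine h _ c _ (fun j hj => ?_) hc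
      have := (Finset.mem_filter.1 hj).2
      exact ENNReal.coe_lt_coe.2 (NNReal.half_lt_self this))
  have h3 : ∑ j ∈ J, m j ^ κ ≤ (2 * K) ^ κ := by
    calc ∑ j ∈ J, m j ^ κ = ∑ j ∈ J.filter fun j => m j ≠ 0, m j ^ κ := by
          symm
          refine Finset.sum_filter_of_ne fun j _ hj h0 => hj ?_
          rw [h0, NNReal.zero_rpow hκ0.ne']
      _ = 2 ^ κ * ∑ j ∈ J.filter fun j => m j ≠ 0, (m j / 2) ^ κ := by
          rw [Finset.mul_sum]
          refine Finset.sum_congr rfl fun j _ => ?_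
          rw [← NNReal.mul_rpow]
          congr 1; field_simp
      _ ≤ 2 ^ κ * K ^ κ := by gcongr
      _ = _ := (NNReal.mul_rpow).symm
  have h4 := ENNReal.coe_le_coe.2 h3
  rw [ENNReal.ofNNReal_finsetSum, ENNReal.coe_rpow_of_nonneg _ hκ0.le] at h4
  push_cast at h4
  refine le_trans (le_of_eq (Finset.sum_congr rfl fun j _ => ?_)) h4
  rw [ENNReal.coe_rpow_of_nonneg _ hκ0.le]

/-- The combinatorial consequence of a Hardy inequality with constant `K`: superpositions of
bumps that are nearly extremal for `Φ t` obey the inequality. -/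
def TestBound {α : Type*} [LinearOrder α] [MeasurableSpace α] (μ : Measure α) (Φ : α → ℝ≥0∞)
    (P Q : ℝ) (K : ℝ≥0) : Prop :=
  ∀ (J : Finset ℤ) (c l : ℤ → ℝ≥0) (t : ℤ → α) (E : ℤ → Set α),
    Pairwise (Function.onFun Disjoint E) → (∀ j, MeasurableSet (E j)) →
    (∀ j, E j ⊆ Set.Ici (t j)) → (∀ j ∈ J, (l j : ℝ≥0∞) < Φ (t j)) → ∑ j ∈ J, c j ^ P ≤ 1 →
    ∑ j ∈ J, ((c j : ℝ≥0∞) * l j) ^ Q * μ (E j) ≤ K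

section Necessity

variable {α : Type*} [LinearOrder α] [MeasurableSpace α] [CofinalOrder α]
  {μ : Measure α} {Φ : α → ℝ≥0∞} {P Q : ℝ} {K : ℝ≥0}

/-- A single bump suffices: all its mass sits at index 0, on the ray `Ici t`, and the other sets are
empty. -/
theorem TestBound.rpow_mul_measure_le (h : TestBound μ Φ P Q K) (hQ : 0 < Q) (t : α) :
    Φ t ^ Q * μ (Set.Ici t) ≤ K := by
  refine rpow_mul_le_of_forall_lt hQ ENNReal.coe_ne_top fun l hl => ?_
  have := h {0} (fun _ => 1) (fun _ => l) (fun _ => t) (fun j => if j = 0 then Set.Ici t else ∅)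
    (by
      intro i j hij
      by_cases hi : i = 0
      · have : j ≠ 0 := fun hj => hij (hi.trans hj.symm)
        simp [Function.onFun, this]
      · simp [Function.onFun, hi])
    (by
      intro j
      by_cases hj : j = 0
      · simp only [hj, if_true]
        exact measurableSet_of_isUpperSet (isUpperSet_Ici t)
      · simp [hj])
    (by
      intro j
      by_cases hj : j = 0 <;> simp [hj])
    (by simpa using hl) (by simp)
  simpa using this

theorem exists_lt_mul_measure_inter_Ici {S : Set α} {a b : ℝ≥0∞} (ha0 : a ≠ 0) (ha : a ≠ ∞)
    (h : b < a * μ S) : ∃ t ∈ S, b < a * μ (S ∩ Set.Ici t) := by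
  by_contra! hcon
  refine absurd h (not_lt.2 ?_)
  rw [mul_comm, ← ENNReal.le_div_iff_mul_le (Or.inl ha0) (Or.inl ha)]
  refine measure_le_of_forall_Ici fun t ht => ?_
  rw [ENNReal.le_div_iff_mul_le (Or.inl ha0) (Or.inl ha), mul_comm]
  exact hcon t ht

/-- One bump per dyadic level of `Φ`, placed at a point `t j` so far to the left in its level that
`level Φ j ∩ Ici (t j)` still carries enough measure. Its height is `2 ^ j < Φ (t j)`, and the
conclusion is the dual form of the resulting bounds. -/
theorem TestBound.tsum_le (h : TestBound μ Φ P Q K) (hQ : 0 < Q) (hQP : Q < P) (hΦ : Monotone Φ) :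
    ∑' j : ℤ, (2 : ℝ≥0∞) ^ (P * Q / (P - Q) * j) * μ (level Φ j) ^ (P / (P - Q)) ≤
      (2 * (K : ℝ≥0∞)) ^ (P / (P - Q)) := by
  classical
  have hP : 0 < P := hQ.trans hQP
  have hd : 0 < P - Q := sub_pos.2 hQP
  rcases isEmpty_or_nonempty α with hα | hα
  · have : ∀ j, level Φ j = ∅ := fun j => Set.eq_empty_of_isEmpty _
    have h0 : 0 < P / (P - Q) := by positivity
    simp [this, ENNReal.zero_rpow_of_pos h0]
  have hm : ∀ j : ℤ, (2 : ℝ≥0∞) ^ (P * Q / (P - Q) * j) * μ (level Φ j) ^ (P / (P - Q)) =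
      ((2 : ℝ≥0∞) ^ (Q * j) * μ (level Φ j)) ^ (P / (P - Q)) := by
    intro j
    rw [ENNReal.mul_rpow_of_nonneg _ _ (by positivity), ← ENNReal.rpow_mul]
    congr 2; ring
  simp_rw [hm]
  refine tsum_rpow_le_of_test hQ hQP _ K fun J c l hl hc => ?_
  have hex : ∀ j, ∃ t, j ∈ J → t ∈ level Φ j ∧
      (l j : ℝ≥0∞) < 2 ^ (Q * j) * μ (level Φ j ∩ Set.Ici t) := by
    intro j
    by_cases hj : j ∈ J
    · obtain ⟨t, ht, htl⟩ := exists_lt_mul_measure_inter_Ici (two_rpow_ne_zero _)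
        (two_rpow_ne_top _) (hl j hj)
      exact ⟨t, fun _ => ⟨ht, htl⟩⟩
    · exact ⟨Classical.arbitrary α, fun h => absurd h hj⟩
  choose t ht using hex
  have htwo : ∀ j : ℤ, (((2 : ℝ≥0) ^ (j : ℝ) : ℝ≥0) : ℝ≥0∞) = (2 : ℝ≥0∞) ^ (j : ℝ) := fun j => by
    rw [ENNReal.coe_rpow_of_ne_zero (by norm_num)]; norm_num
  have key := h J c (fun j => (2 : ℝ≥0) ^ (j : ℝ)) t (fun j => level Φ j ∩ Set.Ici (t j))
    (fun i j hij => (pairwise_disjoint_level Φ hij).mono Set.inter_subset_left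
      Set.inter_subset_left)
    (fun j => (measurableSet_level hΦ j).inter (measurableSet_of_isUpperSet (isUpperSet_Ici _)))
    (fun j => Set.inter_subset_right)
    (fun j hj => by rw [htwo]; exact (ht j hj).1.1) hc
  have : ((∑ j ∈ J, c j ^ Q * l j : ℝ≥0) : ℝ≥0∞) ≤ K := by
    refine le_trans ?_ key
    rw [ENNReal.ofNNReal_finsetSum]
    refine Finset.sum_le_sum fun j hj => ?_
    rw [ENNReal.coe_mul, ENNReal.coe_rpow_of_nonneg _ hQ.le, htwo,
      ENNReal.mul_rpow_of_nonneg _ _ hQ.le, mul_assoc, ← ENNReal.rpow_mul, mul_comm (j : ℝ)]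
    gcongr
    exact (ht j hj).2.le
  exact_mod_cast this

end Necessity

/-- Lower bound for the best constant in the weighted Hardy inequality for exponents `Q < P`. -/
theorem TestBound.exists_lintegral_le {P Q : ℝ} (hQ : 0 < Q) (hQP : Q < P) :
    ∃ c : ℝ≥0, ∀ (α : Type) [LinearOrder α] [MeasurableSpace α] [CofinalOrder α]
      (μ : Measure α) (Φ : α → ℝ≥0∞) (K : ℝ≥0), Monotone Φ → TestBound μ Φ P Q K →
      ∫⁻ t, Φ t ^ (P * Q / (P - Q)) * μ (Set.Ici t) ^ (Q / (P - Q)) ∂μ ≤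
        c * (K : ℝ≥0∞) ^ (P / (P - Q)) := by
  have hP : 0 < P := hQ.trans hQP
  have hd : 0 < P - Q := sub_pos.2 hQP
  set R := P * Q / (P - Q) with hR
  set σ := Q / (P - Q) with hσ
  set κ := P / (P - Q) with hκ
  have hR0 : 0 < R := by positivity
  have hσ0 : 0 < σ := by positivity
  have hκ0 : 0 < κ := by positivity
  have hσκ : σ + 1 = κ := by rw [hσ, hκ]; field_simp; ring
  obtain ⟨c, hc⟩ := exists_tsum_geometric_hardy hR0 hκ0
  refine ⟨2 ^ R * c * 2 ^ κ, fun α _ _ _ μ Φ K hΦ h => ?_⟩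
  have hM : ∀ t, Φ t = ∞ → μ (Set.Ici t) = 0 := by
    -- A positive measure to the right of a point with `Φ t = ∞` would contradict the one-bump
    -- bound.
    intro t ht
    by_contra hne
    have := h.rpow_mul_measure_le hQ t
    rw [ht, ENNReal.top_rpow_of_pos hQ, ENNReal.top_mul hne] at this
    exact ENNReal.coe_ne_top (top_le_iff.1 this)
  have hnull : μ {t | Φ t = ∞} = 0 := by
    refine le_antisymm (measure_le_of_forall_Ici fun t ht => ?_) zero_le
    exact (measure_mono Set.inter_subset_right).trans (hM t ht).le
  set e : ℤ → ℝ≥0∞ := fun j => μ (level Φ j) with he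
  set S : ℤ → ℝ≥0∞ := fun j => ∑' n : ℕ, e (j + n) with hS
  -- By monotonicity of `Φ`, everything to the right of `t` lies in levels of index at least `j`,
  -- apart from the null set where `Φ = ∞`.
  have hIci : ∀ j, ∀ t ∈ level Φ j, μ (Set.Ici t) ≤ S j := by
    intro j t ht
    have hsub : Set.Ici t ⊆ {t | Φ t = ∞} ∪ ⋃ n : ℕ, level Φ (j + n) := by
      intro x hx
      by_cases hxt : Φ x = ∞
      · exact Or.inl hxt
      · have hlt : (2 : ℝ≥0∞) ^ (j : ℝ) < Φ x := ht.1.trans_le (hΦ hx)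
        obtain ⟨i, hi⟩ := exists_mem_level (ne_bot_of_gt hlt) hxt
        have hij : j ≤ i := by
          by_contra! hij
          have : (i : ℝ) + 1 ≤ j := by exact_mod_cast hij
          exact absurd (hlt.trans_le (hi.2.trans (two_rpow_mono this))) (lt_irrefl _)
        refine Or.inr (Set.mem_iUnion.2 ⟨(i - j).toNat, ?_⟩)
        rwa [Int.toNat_of_nonneg (by lia), add_sub_cancel]
    calc μ (Set.Ici t) ≤ μ {t | Φ t = ∞} + μ (⋃ n : ℕ, level Φ (j + n)) :=
          (measure_mono hsub).trans (measure_union_le _ _)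
      _ ≤ 0 + S j := by
          gcongr
          · exact hnull.le
          · exact measure_iUnion_le _
      _ = S j := zero_add _
  have heS : ∀ j, e j ≤ S j := fun j => by
    refine le_trans (le_of_eq ?_) (ENNReal.le_tsum 0)
    simp
  calc ∫⁻ t, Φ t ^ R * μ (Set.Ici t) ^ σ ∂μ
      ≤ ∑' j : ℤ, ((2 : ℝ≥0∞) ^ ((j : ℝ) + 1)) ^ R * S j ^ σ * e j := by
        refine lintegral_le_tsum_level hΦ (Eventually.of_forall fun t ht => ?_) fun j t ht => ?_
        · rcases ht with ht | ht
          · rw [ht, ENNReal.zero_rpow_of_pos hR0, zero_mul]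
          · rw [hM t ht, ENNReal.zero_rpow_of_pos hσ0, mul_zero]
        · gcongr
          · exact ht.2
          · exact hIci j t ht
    _ ≤ ∑' j : ℤ, 2 ^ R * ((2 : ℝ≥0∞) ^ (R * j) * S j ^ κ) := by
        refine ENNReal.tsum_le_tsum fun j => ?_
        calc ((2 : ℝ≥0∞) ^ ((j : ℝ) + 1)) ^ R * S j ^ σ * e j
            ≤ ((2 : ℝ≥0∞) ^ ((j : ℝ) + 1)) ^ R * S j ^ σ * S j ^ (1 : ℝ) := by
              rw [ENNReal.rpow_one]; gcongr; exact heS j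
          _ = _ := by
              rw [mul_assoc, ← ENNReal.rpow_add_of_nonneg _ _ hσ0.le zero_le_one, hσκ,
                ← mul_assoc, ← two_rpow_add, ← ENNReal.rpow_mul]
              congr 2; ring
    -- The tails `S j` are replaced by the single level measures `e j` through the geometric Hardy
    -- inequality, whose weight here is `2 ^ (R j)`.
    _ ≤ 2 ^ R * (c * ∑' j : ℤ, (2 : ℝ≥0∞) ^ (R * j) * e j ^ κ) := by
        rw [ENNReal.tsum_mul_left]
        gcongr
        exact hc e
    _ ≤ 2 ^ R * (c * (2 * (K : ℝ≥0∞)) ^ κ) := by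
        gcongr
        exact h.tsum_le hQ hQP hΦ
    _ = _ := by
        rw [ENNReal.mul_rpow_of_nonneg _ _ hκ0.le]
        push_cast [ENNReal.coe_rpow_of_nonneg _ hR0.le, ENNReal.coe_rpow_of_nonneg _ hκ0.le]
        ring

/-- A Hardy inequality implies the corresponding `TestBound`, by superposition. -/
theorem TestBound.of_forall {α : Type*} [LinearOrder α] [MeasurableSpace α] [CofinalOrder α]
    {ν μ : Measure α} {z Φ : α → ℝ≥0∞} {p q r : ℝ} {K : ℝ≥0} (hp : 0 < p) (hq : 0 < q)
    (hr : 0 < r)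
    (h : ∀ g : α → ℝ≥0∞, Measurable g → ∫⁻ s, g s ^ p ∂ν ≤ 1 →
      ∫⁻ t, (∫⁻ s in Set.Iic t, g s ^ r * z s ∂ν) ^ (q / r) ∂μ ≤ K)
    (hΦ : ∀ (t : α) (l : ℝ≥0), (l : ℝ≥0∞) < Φ t → ∃ g : α → ℝ≥0∞, Measurable g ∧
      ∫⁻ s, g s ^ p ∂ν ≤ 1 ∧ (l : ℝ≥0∞) ^ r ≤ ∫⁻ s in Set.Iic t, g s ^ r * z s ∂ν) :
    TestBound μ Φ p q K := by
  classical
  intro J c l t E hEd hEm hEt hl hc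
  have hex : ∀ j, ∃ g : α → ℝ≥0∞, Measurable g ∧ ∫⁻ s, g s ^ p ∂ν ≤ 1 ∧
      (j ∈ J → (l j : ℝ≥0∞) ^ r ≤ ∫⁻ s in Set.Iic (t j), g s ^ r * z s ∂ν) := by
    intro j
    by_cases hj : j ∈ J
    · obtain ⟨g, h1, h2, h3⟩ := hΦ (t j) (l j) (hl j hj)
      exact ⟨g, h1, h2, fun _ => h3⟩
    · exact ⟨0, measurable_zero, by simp [ENNReal.zero_rpow_of_pos hp], fun h => absurd h hj⟩
  choose g hgm hg1 hgl using hex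
  -- The superposition is a supremum, not a sum: its `p`-th power is then bounded by the sum of the
  -- `p`-th powers for every `p > 0`, while it still dominates each bump.
  set G : α → ℝ≥0∞ := fun s => ⨆ j ∈ J, (c j : ℝ≥0∞) * g j s with hG
  have hGm : Measurable G :=
    Measurable.biSup (J : Set ℤ) J.countable_toSet fun j _ => (hgm j).const_mul _
  have hGp : ∀ s, G s ^ p ≤ ∑ j ∈ J, (c j : ℝ≥0∞) ^ p * g j s ^ p := by
    intro s
    have : G s ≤ (∑ j ∈ J, (c j : ℝ≥0∞) ^ p * g j s ^ p) ^ p⁻¹ := by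
      refine iSup₂_le fun j hj => ?_
      rw [ENNReal.le_rpow_inv_iff hp, ENNReal.mul_rpow_of_nonneg _ _ hp.le]
      exact Finset.single_le_sum (f := fun j => (c j : ℝ≥0∞) ^ p * g j s ^ p)
        (fun _ _ => zero_le) hj
    rwa [ENNReal.le_rpow_inv_iff hp] at this
  have hG1 : ∫⁻ s, G s ^ p ∂ν ≤ 1 := by
    calc ∫⁻ s, G s ^ p ∂ν ≤ ∫⁻ s, ∑ j ∈ J, (c j : ℝ≥0∞) ^ p * g j s ^ p ∂ν := lintegral_mono hGp
      _ = ∑ j ∈ J, (c j : ℝ≥0∞) ^ p * ∫⁻ s, g j s ^ p ∂ν := by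
          rw [lintegral_finsetSum _ fun j _ => ((hgm j).pow_const p).const_mul _]
          exact Finset.sum_congr rfl fun j _ => lintegral_const_mul _ ((hgm j).pow_const p)
      _ ≤ ∑ j ∈ J, (c j : ℝ≥0∞) ^ p := by
          refine Finset.sum_le_sum fun j _ => ?_
          exact mul_le_of_le_one_right' (hg1 j)
      _ ≤ 1 := by
          have := ENNReal.coe_le_coe.2 hc
          rw [ENNReal.ofNNReal_finsetSum] at this
          refine le_trans (le_of_eq (Finset.sum_congr rfl fun j _ => ?_)) this
          rw [ENNReal.coe_rpow_of_nonneg _ hp.le]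
  refine le_trans ?_ (h G hGm hG1)
  have hpt : ∀ j ∈ J, ∀ x ∈ E j, ((c j : ℝ≥0∞) * l j) ^ q ≤
      (∫⁻ s in Set.Iic x, G s ^ r * z s ∂ν) ^ (q / r) := by
    intro j hj x hx
    have h1 : ((c j : ℝ≥0∞) * l j) ^ r ≤ ∫⁻ s in Set.Iic x, G s ^ r * z s ∂ν := by
      calc ((c j : ℝ≥0∞) * l j) ^ r = (c j : ℝ≥0∞) ^ r * (l j : ℝ≥0∞) ^ r :=
            ENNReal.mul_rpow_of_nonneg _ _ hr.le
        _ ≤ (c j : ℝ≥0∞) ^ r * ∫⁻ s in Set.Iic (t j), g j s ^ r * z s ∂ν := by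
            gcongr; exact hgl j hj
        _ = ∫⁻ s in Set.Iic (t j), (c j : ℝ≥0∞) ^ r * (g j s ^ r * z s) ∂ν :=
            (lintegral_const_mul' _ _ (ENNReal.rpow_ne_top_of_nonneg hr.le
              ENNReal.coe_ne_top)).symm
        _ ≤ ∫⁻ s in Set.Iic (t j), G s ^ r * z s ∂ν := by
            refine lintegral_mono fun s => ?_
            rw [← mul_assoc, ← ENNReal.mul_rpow_of_nonneg _ _ hr.le]
            gcongr
            exact le_iSup₂ (f := fun j (_ : j ∈ J) => (c j : ℝ≥0∞) * g j s) j hj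
        _ ≤ _ := lintegral_mono_set (Set.Iic_subset_Iic.2 (hEt j hx))
    calc ((c j : ℝ≥0∞) * l j) ^ q = (((c j : ℝ≥0∞) * l j) ^ r) ^ (q / r) := by
          rw [← ENNReal.rpow_mul, mul_div_cancel₀ _ hr.ne']
      _ ≤ _ := by gcongr
  calc ∑ j ∈ J, ((c j : ℝ≥0∞) * l j) ^ q * μ (E j)
      = ∑ j ∈ J, ∫⁻ _ in E j, ((c j : ℝ≥0∞) * l j) ^ q ∂μ := by simp
    _ ≤ ∑ j ∈ J, ∫⁻ x in E j, (∫⁻ s in Set.Iic x, G s ^ r * z s ∂ν) ^ (q / r) ∂μ :=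
        Finset.sum_le_sum fun j hj => setLIntegral_mono' (hEm j) (hpt j hj)
    _ = ∫⁻ x in ⋃ j ∈ J, E j, (∫⁻ s in Set.Iic x, G s ^ r * z s ∂ν) ^ (q / r) ∂μ := by
        rw [lintegral_biUnion_finset (fun i _ j _ hij => hEd hij) (fun j _ => hEm j)]
    _ ≤ _ := setLIntegral_le_lintegral _ _

/-! ### Hölder's inequality and near-extremal functions -/

section Extremal

variable {α : Type*} [MeasurableSpace α] {ν : Measure α} {g z : α → ℝ≥0∞} {p r : ℝ}

theorem lintegral_rpow_mul_le (hr : 0 < r) (hrp : r < p) (hg : AEMeasurable g ν) {S F : Set α}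
    (hz : AEMeasurable z (ν.restrict S)) (hFS : F ⊆ S) :
    ∫⁻ s in F, g s ^ r * z s ∂ν ≤ ((∫⁻ s in F, g s ^ p ∂ν) ^ (1 / p) *
      (∫⁻ s in S, z s ^ (p / (p - r)) ∂ν) ^ ((p - r) / (p * r))) ^ r := by
  have hp : 0 < p := hr.trans hrp
  have hd : 0 < p - r := sub_pos.2 hrp
  have hmono : ν.restrict F ≤ ν.restrict S := Measure.restrict_mono hFS le_rfl
  have h := ENNReal.lintegral_mul_norm_pow_le (μ := ν.restrict F) (f := fun s => g s ^ p)
    (g := fun s => z s ^ (p / (p - r))) (hg.restrict.pow_const p)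
    ((hz.mono_measure hmono).pow_const _) (p := r / p) (q := (p - r) / p) (by positivity)
    (by positivity) (by field_simp; ring)
  calc ∫⁻ s in F, g s ^ r * z s ∂ν
      = ∫⁻ s in F, (g s ^ p) ^ (r / p) * (z s ^ (p / (p - r))) ^ ((p - r) / p) ∂ν := by
        refine lintegral_congr fun s => ?_
        rw [← ENNReal.rpow_mul, ← ENNReal.rpow_mul, mul_div_cancel₀ _ hp.ne',
          div_mul_div_cancel₀ hd.ne', div_self hp.ne', ENNReal.rpow_one]
    _ ≤ _ := h
    _ ≤ (∫⁻ s in F, g s ^ p ∂ν) ^ (r / p) *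
        (∫⁻ s in S, z s ^ (p / (p - r)) ∂ν) ^ ((p - r) / p) := by gcongr
    _ = _ := by
        rw [ENNReal.mul_rpow_of_nonneg _ _ hr.le, ← ENNReal.rpow_mul, ← ENNReal.rpow_mul]
        congr 2 <;> field_simp

/-- The extremal function is proportional to `z ^ (1 / (p - r))`. As the integral of `z ^ (p / (p -
r))` may be infinite, that function is replaced by a simple minorant `G` of finite positive integral
`s₀`, and the test function is `(G / s₀) ^ (1 / p)` on `S`. -/
theorem exists_lt_lintegral_rpow_mul [SigmaFinite ν] (hr : 0 < r) (hrp : r < p) {S : Set α}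
    (hS : MeasurableSet S) (hz : ∀ᵐ s ∂(ν.restrict S), z s ≠ ∞) {l : ℝ≥0}
    (hl : (l : ℝ≥0∞) < (∫⁻ s in S, z s ^ (p / (p - r)) ∂ν) ^ ((p - r) / (p * r))) :
    ∃ g : α → ℝ≥0∞, Measurable g ∧ (∀ s ∉ S, g s = 0) ∧ ∫⁻ s, g s ^ p ∂ν ≤ 1 ∧
      (l : ℝ≥0∞) ^ r ≤ ∫⁻ s in S, g s ^ r * z s ∂ν := by
  have hp : 0 < p := hr.trans hrp
  have hd : 0 < p - r := sub_pos.2 hrp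
  have hl' : (l : ℝ≥0∞) ^ (p * r / (p - r)) < ∫⁻ s in S, z s ^ (p / (p - r)) ∂ν := by
    have := ENNReal.rpow_lt_rpow hl (z := p * r / (p - r)) (by positivity)
    rwa [← ENNReal.rpow_mul, div_mul_div_cancel₀ (by positivity), div_self hd.ne',
      ENNReal.rpow_one] at this
  have hcoe : ∫⁻ s in S, z s ^ (p / (p - r)) ∂ν =
      ∫⁻ s in S, ((z s ^ (p / (p - r))).toNNReal : ℝ≥0∞) ∂ν := by
    refine lintegral_congr_ae ?_
    filter_upwards [hz] with s hs
    rw [ENNReal.coe_toNNReal (ENNReal.rpow_ne_top_of_nonneg (by positivity) hs)]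
  rw [hcoe] at hl'
  obtain ⟨G, hGle, hGtop, hGl⟩ := exists_lt_lintegral_simpleFunc_of_lt_lintegral hl'
  set s₀ := ∫⁻ s in S, (G s : ℝ≥0∞) ∂ν with hs₀
  have hs0 : s₀ ≠ 0 := ne_bot_of_gt hGl
  have hGz : ∀ s, (G s : ℝ≥0∞) ≤ z s ^ (p / (p - r)) := fun s =>
    (ENNReal.coe_le_coe.2 (hGle s)).trans ENNReal.coe_toNNReal_le_self
  have hGm : Measurable fun s => (G s : ℝ≥0∞) := G.measurable.coe_nnreal_ennreal
  refine ⟨S.indicator fun s => ((G s : ℝ≥0∞) / s₀) ^ (1 / p),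
    ((hGm.div_const _).pow_const _).indicator hS, fun s hs => Set.indicator_of_notMem hs _, ?_, ?_⟩
  · have : ∀ s, (S.indicator (fun s => ((G s : ℝ≥0∞) / s₀) ^ (1 / p)) s) ^ p =
        S.indicator (fun s => (G s : ℝ≥0∞) / s₀) s := by
      intro s
      by_cases hs : s ∈ S
      · simp only [Set.indicator_of_mem hs]
        rw [← ENNReal.rpow_mul, one_div_mul_cancel hp.ne', ENNReal.rpow_one]
      · simp only [Set.indicator_of_notMem hs]
        exact ENNReal.zero_rpow_of_pos hp
    simp_rw [this]
    rw [lintegral_indicator hS]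
    simp_rw [div_eq_mul_inv]
    rw [lintegral_mul_const _ hGm, ← hs₀, ENNReal.mul_inv_cancel hs0 hGtop.ne]
  · have hle : ∫⁻ s in S, (G s : ℝ≥0∞) * s₀ ^ (-(r / p)) ∂ν ≤
        ∫⁻ s in S, (S.indicator (fun s => ((G s : ℝ≥0∞) / s₀) ^ (1 / p)) s) ^ r * z s ∂ν := by
      refine setLIntegral_mono' hS fun s hs => ?_
      rw [Set.indicator_of_mem hs, ← ENNReal.rpow_mul, one_div_mul_eq_div,
        ENNReal.div_rpow_of_nonneg _ _ (by positivity),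
        div_eq_mul_inv ((G s : ℝ≥0∞) ^ (r / p)), ← ENNReal.rpow_neg,
        mul_right_comm]
      gcongr
      -- Only part of the power of `G` is enlarged: `G ^ ((p - r) / p) ≤ z`, which leaves the factor
      -- `G ^ (r / p)` belonging to the test function.
      calc (G s : ℝ≥0∞) = (G s : ℝ≥0∞) ^ (r / p) * (G s : ℝ≥0∞) ^ ((p - r) / p) := by
            rw [← ENNReal.rpow_add_of_nonneg _ _ (by positivity) (by positivity), ← add_div,
              add_sub_cancel, div_self hp.ne', ENNReal.rpow_one]
        _ ≤ (G s : ℝ≥0∞) ^ (r / p) * (z s ^ (p / (p - r))) ^ ((p - r) / p) := by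
            gcongr; exact hGz s
        _ = _ := by
            rw [← ENNReal.rpow_mul, div_mul_div_cancel₀ hd.ne', div_self hp.ne', ENNReal.rpow_one]
    refine le_trans ?_ hle
    rw [lintegral_mul_const _ hGm, ← hs₀]
    calc (l : ℝ≥0∞) ^ r = ((l : ℝ≥0∞) ^ (p * r / (p - r))) ^ ((p - r) / p) := by
          rw [← ENNReal.rpow_mul]; congr 1; field_simp
      _ ≤ s₀ ^ ((p - r) / p) := by gcongr
      _ = s₀ * s₀ ^ (-(r / p)) := by
          conv_rhs => enter [1]; rw [← ENNReal.rpow_one s₀]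
          rw [← ENNReal.rpow_add _ _ hs0 hGtop.ne]
          congr 1; field_simp; ring

end Extremal

/-! ### The Hardy inequality with the inner exponent `r` -/

section Hardy

variable {α : Type*} [LinearOrder α] [MeasurableSpace α] [CofinalOrder α]
  {ν μ : Measure α} {h e Φ : α → ℝ≥0∞} {p q r : ℝ}

/-- Substitution of `p / r`, `q / r`, `Φ ^ r` for `P`, `Q`, `Φ`. -/
theorem hardy_upper_rpow_of_le (hr : 0 < r) (hp : 0 < p) (hpq : p ≤ q)
    (hΦ : ∀ t F, MeasurableSet F → F ⊆ Set.Iic t →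
      ∫⁻ s in F, h s ∂ν ≤ ((∫⁻ s in F, e s ∂ν) ^ (1 / p) * Φ t) ^ r)
    (he : ∫⁻ s, e s ∂ν ≠ ∞) {A : ℝ≥0∞} (hA : A ≠ ∞)
    (hAle : ∀ᵐ t ∂μ, Φ t ^ q * μ (Set.Ici t) ≤ A) :
    ∫⁻ t, (∫⁻ s in Set.Iic t, h s ∂ν) ^ (q / r) ∂μ ≤
      4 ^ (q / r) * 2 ^ (q / p) * 2 * (A * (∫⁻ s, e s ∂ν) ^ (q / p)) := by
  have h1 := hardy_upper_of_le (ν := ν) (μ := μ) (h := h) (e := e) (Φ := fun t => Φ t ^ r)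
    (P := p / r) (Q := q / r) (by positivity) (by gcongr) (fun t F hF hFt => by
      refine (hΦ t F hF hFt).trans (le_of_eq ?_)
      rw [ENNReal.mul_rpow_of_nonneg _ _ hr.le, ← ENNReal.rpow_mul]
      congr 2; field_simp) he hA (by
      filter_upwards [hAle] with t ht
      rwa [← ENNReal.rpow_mul, mul_div_cancel₀ _ hr.ne'])
  rw [div_div_div_cancel_right₀ hr.ne'] at h1
  refine h1.trans ?_
  gcongr ?_ * _
  -- The factor 2 is not needed here; it makes the constant agree with that of the case `q < p`.
  exact le_mul_of_one_le_right' (by norm_num)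

theorem hardy_upper_rpow_of_lt (hr : 0 < r) (hq : 0 < q) (hqp : q < p) (hΦm : Monotone Φ)
    (hΦ : ∀ t F, MeasurableSet F → F ⊆ Set.Iic t →
      ∫⁻ s in F, h s ∂ν ≤ ((∫⁻ s in F, e s ∂ν) ^ (1 / p) * Φ t) ^ r)
    (he : ∫⁻ s, e s ∂ν ≠ ∞)
    (hA : ∫⁻ t, Φ t ^ (p * q / (p - q)) * μ (Set.Ici t) ^ (q / (p - q)) ∂μ ≠ ∞) :
    ∫⁻ t, (∫⁻ s in Set.Iic t, h s ∂ν) ^ (q / r) ∂μ ≤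
      4 ^ (q / r) * 2 ^ (q / p) * 2 *
        ((∫⁻ t, Φ t ^ (p * q / (p - q)) * μ (Set.Ici t) ^ (q / (p - q)) ∂μ) ^ ((p - q) / p) *
          (∫⁻ s, e s ∂ν) ^ (q / p)) := by
  have hp : 0 < p := hq.trans hqp
  have hd : 0 < p - q := sub_pos.2 hqp
  have e1 : p / r - q / r = (p - q) / r := by ring
  have e2 : r * (p / r * (q / r) / ((p - q) / r)) = p * q / (p - q) := by field_simp
  have e3 : q / r / ((p - q) / r) = q / (p - q) := by field_simp
  have e4 : (p - q) / r / (p / r) = (p - q) / p := by field_simp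
  have h1 := hardy_upper_of_lt (ν := ν) (μ := μ) (h := h) (e := e) (Φ := fun t => Φ t ^ r)
    (P := p / r) (Q := q / r) (by positivity) (by gcongr)
    (fun a b hab => ENNReal.rpow_le_rpow (hΦm hab) hr.le) (fun t F hF hFt => by
      refine (hΦ t F hF hFt).trans (le_of_eq ?_)
      rw [ENNReal.mul_rpow_of_nonneg _ _ hr.le, ← ENNReal.rpow_mul]
      congr 2; field_simp) he (by
      simpa only [← ENNReal.rpow_mul, e1, e2, e3] using hA)
  simpa only [← ENNReal.rpow_mul, e1, e2, e3, e4, div_div_div_cancel_right₀ hr.ne'] using h1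

end Hardy

/-! ### The local inequality on one cell -/

/-- The power of the left-hand side of the Hardy inequality localized to `(y, z)`. -/
noncomputable def localHardy (q r : ℝ) (u v f : ℝ → ℝ≥0∞) (y z : ℝ) : ℝ≥0∞ :=
  ∫⁻ t in Set.Ioo y z, (∫⁻ s in Set.Ioo y t, f s ^ r * v s) ^ (q / r) * u t

theorem V_mono {r : ℝ} (hr : 0 < r) (v : ℝ → ℝ≥0∞) (y : ℝ) : Monotone (V r v y) := by
  intro s t hst
  unfold V
  split_ifs with h
  · have : 0 < (1 - r) / r := div_pos (sub_pos.2 h) hr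
    gcongr
  · exact essSup_mono_measure
      (Measure.absolutelyContinuous_of_le
        (Measure.restrict_mono (Set.Ioo_subset_Ioo_right hst) le_rfl))

section Local

variable {q r y z : ℝ} {u v f : ℝ → ℝ≥0∞}

theorem restrict_Iic_restrict_Ioo {t : ℝ} (ht : t ∈ Set.Ioo y z) :
    (volume.restrict (Set.Ioo y z)).restrict (Set.Iic t) = volume.restrict (Set.Ioo y t) := by
  rw [Measure.restrict_restrict measurableSet_Iic]
  have : Set.Iic t ∩ Set.Ioo y z = Set.Ioc y t := by
    ext s
    simp only [Set.mem_inter_iff, Set.mem_Iic, Set.mem_Ioo, Set.mem_Ioc]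
    exact ⟨fun h => ⟨h.2.1, h.1⟩, fun h => ⟨h.2, h.1, h.2.trans_lt ht.2⟩⟩
  rw [this]
  exact Measure.restrict_congr_set Ioo_ae_eq_Ioc.symm

theorem withDensity_Ici {t : ℝ} (ht : t ∈ Set.Ioo y z) :
    (volume.restrict (Set.Ioo y z)).withDensity u (Set.Ici t) = ∫⁻ s in Set.Ioo t z, u s := by
  rw [withDensity_apply _ measurableSet_Ici, Measure.restrict_restrict measurableSet_Ici]
  have : Set.Ici t ∩ Set.Ioo y z = Set.Ico t z := by
    ext s
    simp only [Set.mem_inter_iff, Set.mem_Ici, Set.mem_Ioo, Set.mem_Ico]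
    exact ⟨fun h => ⟨h.1, h.2.2⟩, fun h => ⟨h.1, ht.1.trans_le h.1, h.2⟩⟩
  rw [this, Measure.restrict_congr_set Ioo_ae_eq_Ico.symm]

theorem lintegral_withDensity_restrict (hu : AEMeasurable u (volume.restrict (Set.Ioo y z)))
    {G : ℝ → ℝ≥0∞} (hG : Measurable G) :
    ∫⁻ t, G t ∂((volume.restrict (Set.Ioo y z)).withDensity u) =
      ∫⁻ t in Set.Ioo y z, G t * u t := by
  rw [lintegral_withDensity_eq_lintegral_mul₀ hu hG.aemeasurable]
  exact lintegral_congr fun t => mul_comm _ _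

theorem localHardy_eq (hu : AEMeasurable u (volume.restrict (Set.Ioo y z))) (hr : 0 < r)
    (hq : 0 < q) :
    localHardy q r u v f y z = ∫⁻ t, (∫⁻ s in Set.Iic t, f s ^ r * v s
      ∂(volume.restrict (Set.Ioo y z))) ^ (q / r)
        ∂((volume.restrict (Set.Ioo y z)).withDensity u) := by
  rw [lintegral_withDensity_restrict hu]
  · refine setLIntegral_congr_fun measurableSet_Ioo fun t ht => ?_
    simp only [restrict_Iic_restrict_Ioo ht]
  · refine measurable_of_monotone fun a b hab => ?_
    gcongr

/-- Up to a null set `F` lies in `(y, min t z)`. For `r < 1` the bound is Hölder with `p = 1`; for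
`r = 1` the essential supremum of `v` is taken out. The minimum with `z` makes `Φ` a monotone
function on all of ℝ, as the abstract inequality requires. -/
theorem lintegral_le_V (hr : 0 < r) (hr1 : r ≤ 1)
    (hv : AEMeasurable v (volume.restrict (Set.Ioo y z)))
    (hf : AEMeasurable f (volume.restrict (Set.Ioo y z))) (t : ℝ) (F : Set ℝ)
    (hFt : F ⊆ Set.Iic t) :
    ∫⁻ s in F, f s ^ r * v s ∂(volume.restrict (Set.Ioo y z)) ≤
      ((∫⁻ s in F, f s ∂(volume.restrict (Set.Ioo y z))) ^ ((1 : ℝ) / 1) *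
        V r v y (min t z)) ^ r := by
  set ν := volume.restrict (Set.Ioo y z) with hν
  set S := Set.Ioo y (min t z) with hS
  have hSz : S ⊆ Set.Ioo y z := Set.Ioo_subset_Ioo_right (min_le_right _ _)
  have hνS : ν.restrict S = volume.restrict S := Measure.restrict_restrict_of_subset hSz
  have hF : F =ᵐ[ν] (F ∩ S : Set ℝ) := by
    have h1 : ∀ᵐ s ∂ν, s ∈ Set.Ioo y z := ae_restrict_mem measurableSet_Ioo
    have h2 : ∀ᵐ s ∂ν, s ≠ t := ae_restrict_of_ae (Measure.ae_ne volume t)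
    filter_upwards [h1, h2] with s hs hst
    refine propext ⟨fun h => ⟨h, hs.1, lt_min (lt_of_le_of_ne (hFt h) hst) hs.2⟩, fun h => h.1⟩
  rw [Measure.restrict_congr_set hF]
  have hvS : AEMeasurable v (ν.restrict S) := hv.restrict
  unfold V
  split_ifs with h
  · have := lintegral_rpow_mul_le (p := 1) hr h hf hvS (Set.inter_subset_right (s := F) (t := S))
    simpa only [ENNReal.rpow_one, one_mul, hνS] using this
  · have hr1 : r = 1 := le_antisymm hr1 (not_lt.1 h)
    subst hr1
    simp only [ENNReal.rpow_one, div_one]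
    rw [← hνS, ← lintegral_mul_const'' _ hf.restrict]
    refine lintegral_mono_ae ?_
    have h3 : ∀ᵐ s ∂(ν.restrict (F ∩ S)), v s ≤ essSup v (ν.restrict S) :=
      ae_mono (Measure.restrict_mono Set.inter_subset_right le_rfl) (ENNReal.ae_le_essSup v)
    filter_upwards [h3] with s hs
    gcongr

/-- Near-optimality of `V` among functions of integral at most 1: for `r < 1` the near-extremal
function of Hölder's inequality, for `r = 1` the normalized indicator of the set where `v` exceeds
`l`. -/
theorem exists_lt_V (hr : 0 < r) (hr1 : r ≤ 1)
    (hv : AEMeasurable v (volume.restrict (Set.Ioo y z)))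
    (hvfin : ∀ᵐ s ∂(volume.restrict (Set.Ioo y z)), v s ≠ ∞) {l : ℝ≥0}
    (hl : (l : ℝ≥0∞) < V r v y z) :
    ∃ g : ℝ → ℝ≥0∞, Measurable g ∧ (∀ s ∉ Set.Ioo y z, g s = 0) ∧ ∫⁻ s, g s ≤ 1 ∧
      (l : ℝ≥0∞) ^ r ≤ ∫⁻ s in Set.Ioo y z, g s ^ r * v s := by
  unfold V at hl
  split_ifs at hl with h
  · have := exists_lt_lintegral_rpow_mul (p := 1) hr h (measurableSet_Ioo (a := y) (b := z))
      hvfin (l := l) (by simpa only [one_mul] using hl)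
    simpa only [ENNReal.rpow_one] using this
  · have hr1 : r = 1 := le_antisymm hr1 (not_lt.1 h)
    subst hr1
    simp only [ENNReal.rpow_one]
    set S : Set ℝ := {s | (l : ℝ≥0∞) < hv.mk v s} ∩ Set.Ioo y z with hS
    have hSm : MeasurableSet S :=
      (measurableSet_lt measurable_const hv.measurable_mk).inter measurableSet_Ioo
    have hS0 : volume S ≠ 0 := by
      intro h0
      refine absurd hl (not_lt.2 (essSup_le_of_ae_le _ ?_))
      have h1 : ∀ᵐ s ∂(volume.restrict (Set.Ioo y z)), hv.mk v s ≤ l := by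
        rw [ae_iff, Measure.restrict_apply₀'  measurableSet_Ioo.nullMeasurableSet]
        simpa only [not_le] using h0
      filter_upwards [h1, hv.ae_eq_mk] with s h2 h3
      rwa [h3]
    have hStop : volume S ≠ ∞ := ne_top_of_le_ne_top measure_Ioo_lt_top.ne
      (measure_mono (Set.inter_subset_right (t := Set.Ioo y z)))
    refine ⟨S.indicator fun _ => (volume S)⁻¹, measurable_const.indicator hSm, fun s hs =>
      Set.indicator_of_notMem (fun h => hs h.2) _, ?_, ?_⟩
    · rw [lintegral_indicator_const hSm, ENNReal.inv_mul_cancel hS0 hStop]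
    · calc (l : ℝ≥0∞) = ∫⁻ s in S, (volume S)⁻¹ * l := by
            rw [setLIntegral_const, mul_right_comm, ENNReal.inv_mul_cancel hS0 hStop, one_mul]
        _ ≤ ∫⁻ s in S, S.indicator (fun _ => (volume S)⁻¹) s * hv.mk v s := by
            refine setLIntegral_mono' hSm fun s hs => ?_
            rw [Set.indicator_of_mem hs]
            gcongr
            exact hs.1.le
        _ ≤ ∫⁻ s in Set.Ioo y z, S.indicator (fun _ => (volume S)⁻¹) s * hv.mk v s :=
            lintegral_mono_set Set.inter_subset_right
        _ = _ := by
            refine lintegral_congr_ae ?_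
            filter_upwards [hv.ae_eq_mk] with s hs
            rw [hs]

theorem localHardy_le_of_le (hr : 0 < r) (hr1 : r ≤ 1) (hq : 1 ≤ q)
    (hu : AEMeasurable u (volume.restrict (Set.Ioo y z)))
    (hv : AEMeasurable v (volume.restrict (Set.Ioo y z)))
    (hf : AEMeasurable f (volume.restrict (Set.Ioo y z)))
    (hfin : ∫⁻ s in Set.Ioo y z, f s ≠ ∞) {A : ℝ≥0∞} (hA : A ≠ ∞)
    (hAle : ∀ᵐ t ∂(volume.restrict (Set.Ioo y z)),
      V r v y t ^ q * ∫⁻ s in Set.Ioo t z, u s ≤ A) :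
    localHardy q r u v f y z ≤
      4 ^ (q / r) * 2 ^ q * 2 * (A * (∫⁻ s in Set.Ioo y z, f s) ^ q) := by
  rw [localHardy_eq hu hr (by linarith)]
  have := hardy_upper_rpow_of_le (p := 1) (q := q) (Φ := fun t => V r v y (min t z))
    (μ := (volume.restrict (Set.Ioo y z)).withDensity u) hr one_pos hq
    (fun t F _ hFt => lintegral_le_V hr hr1 hv hf t F hFt) hfin hA (by
      refine (withDensity_absolutelyContinuous _ _).ae_le ?_
      filter_upwards [hAle, ae_restrict_mem measurableSet_Ioo] with t ht hmem
      rwa [withDensity_Ici hmem, min_eq_left hmem.2.le])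
  simpa only [div_one] using this

theorem lintegral_local_eq (hr : 0 < r) (hu : AEMeasurable u (volume.restrict (Set.Ioo y z)))
    {a b : ℝ} :
    ∫⁻ t, V r v y (min t z) ^ a * (volume.restrict (Set.Ioo y z)).withDensity u (Set.Ici t) ^ b
        ∂((volume.restrict (Set.Ioo y z)).withDensity u) =
      ∫⁻ t in Set.Ioo y z, (∫⁻ s in Set.Ioo t z, u s) ^ b * u t * V r v y t ^ a := by
  rw [lintegral_withDensity_restrict hu]
  · refine setLIntegral_congr_fun measurableSet_Ioo fun t ht => ?_
    simp only [withDensity_Ici ht, min_eq_left ht.2.le]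
    ring
  · refine Measurable.mul ?_ ((measurable_of_antitone (antitone_measure_Ici _)).pow_const _)
    refine (measurable_of_monotone fun s t hst => ?_).pow_const _
    exact V_mono hr v y (min_le_min_right z hst)

theorem localHardy_le_of_lt (hr : 0 < r) (hr1 : r ≤ 1) (hq : 0 < q) (hq1 : q < 1)
    (hu : AEMeasurable u (volume.restrict (Set.Ioo y z)))
    (hv : AEMeasurable v (volume.restrict (Set.Ioo y z)))
    (hf : AEMeasurable f (volume.restrict (Set.Ioo y z)))
    (hfin : ∫⁻ s in Set.Ioo y z, f s ≠ ∞)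
    (hA : ∫⁻ t in Set.Ioo y z, (∫⁻ s in Set.Ioo t z, u s) ^ (q / (1 - q)) * u t *
      V r v y t ^ (q / (1 - q)) ≠ ∞) :
    localHardy q r u v f y z ≤ 4 ^ (q / r) * 2 ^ q * 2 *
      ((∫⁻ t in Set.Ioo y z, (∫⁻ s in Set.Ioo t z, u s) ^ (q / (1 - q)) * u t *
        V r v y t ^ (q / (1 - q))) ^ (1 - q) * (∫⁻ s in Set.Ioo y z, f s) ^ q) := by
  rw [← lintegral_local_eq hr hu] at hA ⊢
  rw [localHardy_eq hu hr hq]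
  have := hardy_upper_rpow_of_lt (p := 1) (q := q) (Φ := fun t => V r v y (min t z))
    (μ := (volume.restrict (Set.Ioo y z)).withDensity u) hr hq hq1
    (fun s t hst => V_mono hr v y (min_le_min_right z hst))
    (fun t F _ hFt => lintegral_le_V hr hr1 hv hf t F hFt) hfin (by simpa only [one_mul] using hA)
  simpa only [div_one, one_mul] using this

/-- Feeds the near-extremal functions for `V` on `(y, t)` into the superposition argument, with
exponent `p = 1`. -/
theorem testBound_local (hr : 0 < r) (hr1 : r ≤ 1) (hq : 0 < q)
    (hu : AEMeasurable u (volume.restrict (Set.Ioo y z)))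
    (hv : AEMeasurable v (volume.restrict (Set.Ioo y z)))
    (hvfin : ∀ᵐ s ∂(volume.restrict (Set.Ioo y z)), v s ≠ ∞) {K : ℝ≥0}
    (hK : ∀ g : ℝ → ℝ≥0∞, Measurable g → ∫⁻ s in Set.Ioo y z, g s ≤ 1 →
      localHardy q r u v g y z ≤ K) :
    TestBound ((volume.restrict (Set.Ioo y z)).withDensity u) (fun t => V r v y (min t z))
      1 q K := by
  refine TestBound.of_forall (ν := volume.restrict (Set.Ioo y z)) (z := v) one_pos hq hr
    (fun g hg hg1 => ?_) fun t l hl => ?_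
  · rw [← localHardy_eq hu hr hq]
    exact hK g hg (by simpa only [ENNReal.rpow_one] using hg1)
  · have hsub : Set.Ioo y (min t z) ⊆ Set.Ioo y z := Set.Ioo_subset_Ioo_right (min_le_right _ _)
    have hle : volume.restrict (Set.Ioo y (min t z)) ≤ volume.restrict (Set.Ioo y z) :=
      Measure.restrict_mono hsub le_rfl
    obtain ⟨g, hg, -, hg1, hgl⟩ := exists_lt_V hr hr1 (hv.mono_measure hle) (ae_mono hle hvfin) hl
    refine ⟨g, hg, ?_, hgl.trans ?_⟩
    · simp only [ENNReal.rpow_one]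
      exact (setLIntegral_le_lintegral _ _).trans hg1
    · rw [Measure.restrict_restrict measurableSet_Iic]
      exact lintegral_mono_set fun s hs => ⟨(hs.2.trans_le (min_le_left _ _)).le, hsub hs⟩

theorem rpow_V_mul_le_of_localHardy_le (hr : 0 < r) (hr1 : r ≤ 1) (hq : 0 < q)
    (hu : AEMeasurable u (volume.restrict (Set.Ioo y z)))
    (hv : AEMeasurable v (volume.restrict (Set.Ioo y z)))
    (hvfin : ∀ᵐ s ∂(volume.restrict (Set.Ioo y z)), v s ≠ ∞) {K : ℝ≥0}
    (hK : ∀ g : ℝ → ℝ≥0∞, Measurable g → ∫⁻ s in Set.Ioo y z, g s ≤ 1 →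
      localHardy q r u v g y z ≤ K) {t : ℝ} (ht : t ∈ Set.Ioo y z) :
    V r v y t ^ q * ∫⁻ s in Set.Ioo t z, u s ≤ K := by
  have := (testBound_local hr hr1 hq hu hv hvfin hK).rpow_mul_measure_le hq t
  rwa [withDensity_Ici ht, min_eq_left ht.2.le] at this

end Local

theorem exists_local_lower {q : ℝ} (hq : 0 < q) (hq1 : q < 1) :
    ∃ c : ℝ≥0, ∀ (r : ℝ) (u v : ℝ → ℝ≥0∞) (y z : ℝ) (K : ℝ≥0), 0 < r → r ≤ 1 →
      AEMeasurable u (volume.restrict (Set.Ioo y z)) →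
      AEMeasurable v (volume.restrict (Set.Ioo y z)) →
      (∀ᵐ s ∂(volume.restrict (Set.Ioo y z)), v s ≠ ∞) →
      (∀ g : ℝ → ℝ≥0∞, Measurable g → ∫⁻ s in Set.Ioo y z, g s ≤ 1 →
        localHardy q r u v g y z ≤ K) →
      ∫⁻ t in Set.Ioo y z, (∫⁻ s in Set.Ioo t z, u s) ^ (q / (1 - q)) * u t *
        V r v y t ^ (q / (1 - q)) ≤ c * (K : ℝ≥0∞) ^ (1 / (1 - q)) := by
  obtain ⟨c, hc⟩ := TestBound.exists_lintegral_le hq hq1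
  refine ⟨c, fun r u v y z K hr hr1 hu hv hvfin hK => ?_⟩
  rw [← lintegral_local_eq hr hu]
  simpa only [one_mul] using hc ℝ _ _ K
    (fun s t hst => V_mono hr v y (min_le_min_right z hst))
    (testBound_local hr hr1 hq hu hv hvfin hK)

/-! ### The discrete Hardy inequality -/

theorem iSup_rpow {ι : Sort*} (y : ι → ℝ≥0∞) {s : ℝ} (hs : 0 < s) :
    (⨆ i, y i) ^ s = ⨆ i, y i ^ s :=
  (ENNReal.orderIsoRpow s hs).map_iSup y

/-- The norm of the functional `a ↦ ‖(a i * y i)_{i ≤ k}‖_r` on `ℓ^p`. -/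
noncomputable def discreteNorm {α : Type*} [LinearOrder α] (p r : ℝ) (y : α → ℝ≥0∞) (k : α) :
    ℝ≥0∞ :=
  if r < p then (∑' i : Set.Iic k, y i ^ (p * r / (p - r))) ^ ((p - r) / (p * r))
  else ⨆ i : Set.Iic k, y i

theorem discreteNorm_mono {α : Type*} [LinearOrder α] {p r : ℝ} (hr : 0 < r) (y : α → ℝ≥0∞) :
    Monotone (discreteNorm p r y) := by
  intro k l hkl
  unfold discreteNorm
  split_ifs with h
  · have h1 : 0 < p - r := sub_pos.2 h
    have h2 : 0 < p := hr.trans h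
    have := ENNReal.tsum_mono_subtype (fun i => y i ^ (p * r / (p - r))) (Set.Iic_subset_Iic.2 hkl)
    gcongr
  · exact iSup_le fun i => le_iSup (fun i : Set.Iic l => y i) ⟨i, i.2.trans hkl⟩

section Discrete

variable {α : Type*} [MeasurableSpace α] [MeasurableSingletonClass α] [Countable α]
  {p q r : ℝ} {y U a : α → ℝ≥0∞}

theorem setLIntegral_count (S : Set α) (f : α → ℝ≥0∞) :
    ∫⁻ i in S, f i ∂Measure.count = ∑' i : S, f i := by
  rw [lintegral_countable _ S.to_countable]
  simp

theorem lintegral_count_withDensity (f : α → ℝ≥0∞) :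
    ∫⁻ i, f i ∂(Measure.count.withDensity U) = ∑' i, f i * U i := by
  rw [lintegral_withDensity_eq_lintegral_mul _ (Measurable.of_discrete) (Measurable.of_discrete),
    lintegral_count]
  exact tsum_congr fun i => mul_comm _ _

variable [LinearOrder α]

theorem count_withDensity_Ici (k : α) :
    Measure.count.withDensity U (Set.Ici k) = ∑' j : Set.Ici k, U j := by
  rw [withDensity_apply _ (Set.to_countable _).measurableSet, setLIntegral_count]

/-- Hölder if `r < p`; otherwise the supremum of `y` is taken out and `ℓ^p ⊂ ℓ^r` is used. -/
theorem setLIntegral_count_le_discreteNorm (hr : 0 < r) (hp : 0 < p) (t : α) (F : Set α)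
    (hFt : F ⊆ Set.Iic t) :
    ∫⁻ i in F, a i ^ r * y i ^ r ∂Measure.count ≤
      ((∫⁻ i in F, a i ^ p ∂Measure.count) ^ (1 / p) * discreteNorm p r y t) ^ r := by
  unfold discreteNorm
  split_ifs with h
  · refine (lintegral_rpow_mul_le (z := fun i => y i ^ r) hr h
      Measurable.of_discrete.aemeasurable Measurable.of_discrete.aemeasurable hFt).trans ?_
    rw [setLIntegral_count (Set.Iic t)]
    simp only [← ENNReal.rpow_mul]
    have : r * (p / (p - r)) = p * r / (p - r) := by ring
    rw [this]
  · rw [setLIntegral_count, setLIntegral_count, ENNReal.mul_rpow_of_nonneg _ _ hr.le,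
      ← ENNReal.rpow_mul, one_div_mul_eq_div]
    calc ∑' i : F, a i ^ r * y i ^ r
        ≤ ∑' i : F, a i ^ r * (⨆ i : Set.Iic t, y i) ^ r := by
          refine ENNReal.tsum_le_tsum fun i => ?_
          gcongr
          exact le_iSup (fun i : Set.Iic t => y i) ⟨i, hFt i.2⟩
      _ = (∑' i : F, (a i ^ p) ^ (r / p)) * (⨆ i : Set.Iic t, y i) ^ r := by
          rw [ENNReal.tsum_mul_right]
          congr 1
          refine tsum_congr fun i => ?_
          rw [← ENNReal.rpow_mul, mul_div_cancel₀ _ hp.ne']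
      _ ≤ _ := by
          gcongr
          exact tsum_rpow_le_rpow_tsum _ ((one_le_div hp).2 (not_lt.1 h))

theorem discrete_upper_of_le (hr : 0 < r) (hp : 0 < p) (hpq : p ≤ q) (he : ∑' i, a i ^ p ≠ ∞)
    {A : ℝ≥0∞} (hA : A ≠ ∞) (hAle : ∀ k, discreteNorm p r y k ^ q * ∑' j : Set.Ici k, U j ≤ A) :
    ∑' k, (∑' i : Set.Iic k, a i ^ r * y i ^ r) ^ (q / r) * U k ≤
      4 ^ (q / r) * 2 ^ (q / p) * 2 * (A * (∑' i, a i ^ p) ^ (q / p)) := by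
  have := hardy_upper_rpow_of_le (ν := Measure.count) (μ := Measure.count.withDensity U)
    (e := fun i => a i ^ p) hr hp hpq
    (fun t F _ hFt => setLIntegral_count_le_discreteNorm (a := a) (y := y) hr hp t F hFt)
    (by rwa [lintegral_count]) hA
    (Eventually.of_forall fun k => by rw [count_withDensity_Ici]; exact hAle k)
  simpa only [lintegral_count_withDensity, setLIntegral_count, lintegral_count] using this

theorem discrete_upper_of_lt (hr : 0 < r) (hq : 0 < q) (hqp : q < p) (he : ∑' i, a i ^ p ≠ ∞)
    (hA : ∑' k, discreteNorm p r y k ^ (p * q / (p - q)) *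
      (∑' j : Set.Ici k, U j) ^ (q / (p - q)) * U k ≠ ∞) :
    ∑' k, (∑' i : Set.Iic k, a i ^ r * y i ^ r) ^ (q / r) * U k ≤
      4 ^ (q / r) * 2 ^ (q / p) * 2 * ((∑' k, discreteNorm p r y k ^ (p * q / (p - q)) *
      (∑' j : Set.Ici k, U j) ^ (q / (p - q)) * U k) ^ ((p - q) / p) *
        (∑' i, a i ^ p) ^ (q / p)) := by
  have := hardy_upper_rpow_of_lt (ν := Measure.count) (μ := Measure.count.withDensity U)
    (e := fun i => a i ^ p) hr hq hqp (discreteNorm_mono hr y)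
    (fun t F _ hFt =>
      setLIntegral_count_le_discreteNorm (a := a) (y := y) hr (hq.trans hqp) t F hFt)
    (by rwa [lintegral_count])
    (by simpa only [lintegral_count_withDensity, count_withDensity_Ici] using hA)
  simpa only [lintegral_count_withDensity, setLIntegral_count, lintegral_count,
    count_withDensity_Ici] using this

theorem testBound_discrete (hr : 0 < r) (hp : 0 < p) (hq : 0 < q) (hy : ∀ i, y i ≠ ∞) {K : ℝ≥0}
    (hK : ∀ g : α → ℝ≥0∞, ∑' i, g i ^ p ≤ 1 →
      ∑' k, (∑' i : Set.Iic k, g i ^ r * y i ^ r) ^ (q / r) * U k ≤ K) :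
    TestBound (Measure.count.withDensity U) (discreteNorm p r y) p q K := by
  classical
  refine TestBound.of_forall (ν := Measure.count) (z := fun i => y i ^ r) hp hq hr
    (fun g _ hg1 => ?_) fun t l hl => ?_
  · rw [lintegral_count_withDensity]
    simp only [setLIntegral_count]
    exact hK g (by rwa [lintegral_count] at hg1)
  · unfold discreteNorm at hl
    split_ifs at hl with h
    · obtain ⟨g, hg, -, hg1, hgl⟩ := exists_lt_lintegral_rpow_mul (ν := (Measure.count : Measure α))
        (z := fun i => y i ^ r) hr h (S := Set.Iic t) (Set.to_countable _).measurableSet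
        (Eventually.of_forall fun i => ENNReal.rpow_ne_top_of_nonneg hr.le (hy i)) (l := l) (by
          rw [setLIntegral_count]
          have : r * (p / (p - r)) = p * r / (p - r) := by ring
          simpa only [← ENNReal.rpow_mul, this] using hl)
      exact ⟨g, hg, hg1, hgl⟩
    · obtain ⟨i, hi⟩ := lt_iSup_iff.1 hl
      -- For `p ≤ r` the norm is a supremum, nearly attained by a unit mass at one index.
      refine ⟨Pi.single (i : α) 1, Measurable.of_discrete, ?_, ?_⟩
      · rw [lintegral_count, tsum_eq_single (i : α)]
        · simp
        · intro j hj
          rw [Pi.single_eq_of_ne hj, ENNReal.zero_rpow_of_pos hp]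
      · rw [setLIntegral_count]
        refine le_trans ?_ (ENNReal.le_tsum i)
        rw [Pi.single_eq_same, ENNReal.one_rpow, one_mul]
        gcongr

theorem discrete_lower_of_le (hr : 0 < r) (hp : 0 < p) (hq : 0 < q) (hy : ∀ i, y i ≠ ∞) {K : ℝ≥0}
    (hK : ∀ g : α → ℝ≥0∞, ∑' i, g i ^ p ≤ 1 →
      ∑' k, (∑' i : Set.Iic k, g i ^ r * y i ^ r) ^ (q / r) * U k ≤ K) (k : α) :
    discreteNorm p r y k ^ q * ∑' j : Set.Ici k, U j ≤ K := by
  have := (testBound_discrete hr hp hq hy hK).rpow_mul_measure_le hq k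
  rwa [count_withDensity_Ici] at this

end Discrete

theorem exists_discrete_lower {p q : ℝ} (hq : 0 < q) (hqp : q < p) :
    ∃ c : ℝ≥0, ∀ (α : Type) [LinearOrder α] [MeasurableSpace α] [MeasurableSingletonClass α]
      [Countable α] (r : ℝ) (y U : α → ℝ≥0∞) (K : ℝ≥0), 0 < r → (∀ i, y i ≠ ∞) →
      (∀ g : α → ℝ≥0∞, ∑' i, g i ^ p ≤ 1 →
        ∑' k, (∑' i : Set.Iic k, g i ^ r * y i ^ r) ^ (q / r) * U k ≤ K) →
      ∑' k, discreteNorm p r y k ^ (p * q / (p - q)) *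
        (∑' j : Set.Ici k, U j) ^ (q / (p - q)) * U k ≤ c * (K : ℝ≥0∞) ^ (p / (p - q)) := by
  obtain ⟨c, hc⟩ := TestBound.exists_lintegral_le hq hqp
  refine ⟨c, fun α _ _ _ _ r y U K hr hy hK => ?_⟩
  have := hc α _ _ K (discreteNorm_mono hr y) (testBound_discrete hr (hq.trans hqp) hq hy hK)
  simpa only [lintegral_count_withDensity, count_withDensity_Ici] using this

/-! ### Geometry of the grid of cells -/

theorem idx_le_pred {N : WithBot ℤ} {k : ℤ} (h : N < (k : WithBot ℤ)) :
    N ≤ ((k - 1 : ℤ) : WithBot ℤ) := by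
  induction N with
  | bot => exact bot_le
  | coe M => exact WithBot.coe_le_coe.2 (Int.le_sub_one_of_lt (WithBot.coe_lt_coe.1 h))

theorem idx_le_trans {N : WithBot ℤ} {k l : ℤ} (h : N ≤ (k : WithBot ℤ)) (hkl : k ≤ l) :
    N ≤ (l : WithBot ℤ) := h.trans (WithBot.coe_le_coe.2 hkl)

theorem idx_lt_trans {N : WithBot ℤ} {k l : ℤ} (h : N < (k : WithBot ℤ)) (hkl : k ≤ l) :
    N < (l : WithBot ℤ) := h.trans_le (WithBot.coe_le_coe.2 hkl)

/-- The geometric properties of a discretizing sequence: an increasing sequence of points that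
partitions `(a, b)`. -/
structure IsGrid (a : ℝ) (b : EReal) (N : WithBot ℤ) (x : ℤ → ℝ) : Prop where
  strictMono : StrictMonoOn x {k : ℤ | N ≤ (k : WithBot ℤ)}
  a_le : ∀ k : ℤ, N ≤ (k : WithBot ℤ) → a ≤ x k
  lt_b : ∀ k : ℤ, N ≤ (k : WithBot ℤ) → (x k : EReal) < b
  start : ∀ M : ℤ, N = (M : WithBot ℤ) → x M = a
  start_bot : N = ⊥ → Tendsto x atBot (𝓝 a)
  cofinal : ∀ t : ℝ, (t : EReal) < b → ∃ k : ℤ, N ≤ (k : WithBot ℤ) ∧ t < x k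

theorem isOpen_interval (x : ℝ) (b : EReal) : IsOpen (interval x b) :=
  (isOpen_lt continuous_const continuous_id).inter
    (isOpen_lt continuous_coe_real_ereal continuous_const)

/-- A point `x k = b` would have zero tail, against the lower bound. If all `x k` stayed below some
`t < b`, the tail at `t` would be at most `D * 2 ^ (-k)` for all large `k`, hence zero, against
positivity. -/
theorem IsDiscretizing.isGrid {a : ℝ} {b : EReal} {w : ℝ → ℝ≥0∞} {D : ℝ≥0} {N : WithBot ℤ}
    {x : ℤ → ℝ} (h : IsDiscretizing a b w D N x)
    (hw : ∀ y ∈ interval a b, 0 < tail b w y) : IsGrid a b N x where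
  strictMono := h.strictMono
  a_le k hk := (h.mem k hk).1
  lt_b k hk := by
    refine lt_of_le_of_ne (h.mem k hk).2 fun heq => ?_
    have h1 := h.lower k hk
    have h2 : interval (x k) b = ∅ := by
      ext t
      simp only [interval, Set.mem_ofPred_eq, Set.mem_empty_iff_false, iff_false, not_and, not_lt,
        ← heq]
      exact fun ht => EReal.coe_le_coe_iff.2 ht.le
    rw [tail, h2, Measure.restrict_empty, lintegral_zero_measure, mul_zero,
      ← ENNReal.rpow_intCast] at h1
    exact two_rpow_ne_zero _ (le_antisymm h1 zero_le)
  start := h.start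
  start_bot := h.start_bot
  cofinal t ht := by
    by_contra! hcon
    obtain ⟨k₀, hk₀⟩ : ∃ k₀ : ℤ, N ≤ (k₀ : WithBot ℤ) := by
      induction N with
      | bot => exact ⟨0, bot_le⟩
      | coe M => exact ⟨M, le_rfl⟩
    -- Positivity of the tail is only assumed inside the interval; strict growth from `x k₀ ≥ a` to
    -- the next point puts `t` there.
    have hat : a < t := by
      refine (h.mem k₀ hk₀).1.trans_lt ((h.strictMono hk₀
        (idx_le_trans hk₀ (lt_add_one k₀).le) (lt_add_one k₀)).trans_le ?_)
      exact hcon _ (idx_le_trans hk₀ (lt_add_one k₀).le)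
    have hpos := hw t ⟨hat, ht⟩
    obtain ⟨n, hn⟩ := ENNReal.exists_inv_two_pow_lt (a := tail b w t / D)
      (ENNReal.div_pos hpos.ne' ENNReal.coe_ne_top).ne'
    have hk : N ≤ ((max k₀ n : ℤ) : WithBot ℤ) := idx_le_trans hk₀ (le_max_left _ _)
    have h1 : tail b w t ≤ tail b w (x (max k₀ n)) :=
      lintegral_mono_set fun s hs => ⟨(hcon _ hk).trans_lt hs.1, hs.2⟩
    have h2 : (2 : ℝ≥0∞) ^ (-(max k₀ n : ℤ)) ≤ 2⁻¹ ^ n := by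
      rw [← ENNReal.rpow_intCast, ← ENNReal.inv_pow, ← ENNReal.rpow_natCast, ← ENNReal.rpow_neg]
      refine two_rpow_mono ?_
      push_cast
      exact neg_le_neg (le_max_right _ _)
    have h3 := (h1.trans (h.upper _ hk)).trans_lt
      (lt_of_le_of_lt (mul_le_mul_right h2 _) (ENNReal.mul_lt_of_lt_div' hn))
    exact lt_irrefl _ h3

namespace IsGrid

variable {a : ℝ} {b : EReal} {N : WithBot ℤ} {x : ℤ → ℝ}

theorem mono (h : IsGrid a b N x) {k l : ℤ} (hk : N ≤ (k : WithBot ℤ)) (hkl : k ≤ l) :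
    x k ≤ x l := (h.strictMono.le_iff_le hk (idx_le_trans hk hkl)).2 hkl

/-- The cell is found through the least `k` with `t ≤ x k`. Such a least index exists because `x`
tends to `a < t` at `-∞`, or because the indices start at `N`; it exceeds `N` since `x N = a`. -/
theorem exists_cell (h : IsGrid a b N x) {t : ℝ} (ht : t ∈ interval a b) :
    ∃ k : Idx N, t ∈ Set.Ioc (x (k - 1)) (x k) := by
  obtain ⟨k₁, hk₁, htk₁⟩ := h.cofinal t ht.2
  have hbdd : ∃ c : ℤ, ∀ z : ℤ, (N ≤ (z : WithBot ℤ) ∧ t ≤ x z) → c ≤ z := by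
    induction N with
    | bot =>
      obtain ⟨k₀, hk₀⟩ := ((h.start_bot rfl).eventually_lt_const ht.1).exists
      refine ⟨k₀, fun z hz => ?_⟩
      by_contra! hlt
      exact absurd ((h.strictMono hz.1 (bot_le (a := (k₀ : WithBot ℤ))) hlt).trans hk₀)
        (not_lt.2 hz.2)
    | coe M => exact ⟨M, fun z hz => WithBot.coe_le_coe.1 hz.1⟩
  obtain ⟨k, ⟨hk, htk⟩, hmin⟩ := Int.exists_least_of_bdd hbdd ⟨k₁, hk₁, htk₁.le⟩
  have hNk : N < (k : WithBot ℤ) := by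
    refine lt_of_le_of_ne hk fun heq => ?_
    rw [h.start k heq] at htk
    exact absurd ht.1 (not_lt.2 htk)
  refine ⟨⟨k, hNk⟩, ?_, htk⟩
  by_contra! hle
  have := hmin (k - 1) ⟨idx_le_pred hNk, hle⟩
  lia

theorem disjoint_cell (h : IsGrid a b N x) :
    Pairwise (Function.onFun Disjoint fun k : Idx N => Set.Ioc (x (k - 1)) (x k)) := by
  have key : ∀ k l : Idx N, k < l → Disjoint (Set.Ioc (x (k - 1)) (x k))
      (Set.Ioc (x (l - 1)) (x l)) := by
    intro k l hkl
    have hkl' : (k : ℤ) < l := hkl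
    rw [Set.disjoint_left]
    intro t h1 h2
    have := h.mono (k := k) (l := l - 1) k.2.le (by lia)
    exact absurd (h2.1.trans_le (h1.2.trans this)) (lt_irrefl _)
  intro k l hkl
  rcases lt_or_gt_of_ne hkl with h' | h'
  exacts [key k l h', (key l k h').symm]

theorem cell_subset (h : IsGrid a b N x) (k : Idx N) :
    Set.Ioc (x (k - 1)) (x k) ⊆ interval a b := fun _ ht =>
  ⟨(h.a_le _ (idx_le_pred k.2)).trans_lt ht.1,
    (EReal.coe_le_coe_iff.2 ht.2).trans_lt (h.lt_b k k.2.le)⟩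

theorem open_cell_subset (h : IsGrid a b N x) (k : Idx N) :
    Set.Ioo (x (k - 1)) (x k) ⊆ interval a b :=
  Set.Ioo_subset_Ioc_self.trans (h.cell_subset k)

theorem lintegral_interval (h : IsGrid a b N x) (g : ℝ → ℝ≥0∞) :
    ∫⁻ t in interval a b, g t = ∑' k : Idx N, ∫⁻ t in Set.Ioo (x (k - 1)) (x k), g t := by
  have : interval a b = ⋃ k : Idx N, Set.Ioc (x (k - 1)) (x k) :=
    subset_antisymm (fun t ht => Set.mem_iUnion.2 (h.exists_cell ht))
      (Set.iUnion_subset h.cell_subset)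
  rw [this, lintegral_iUnion (fun _ => measurableSet_Ioc) h.disjoint_cell]
  exact tsum_congr fun k => setLIntegral_congr Ioo_ae_eq_Ioc.symm

theorem lintegral_tail (h : IsGrid a b N x) (g : ℝ → ℝ≥0∞) (k : Idx N) :
    tail b g (x k) = ∑' j : Set.Ici k,
      ∫⁻ t in Set.Ioo (x (j : Idx N)) (x ((j : Idx N) + 1)), g t := by
  let s : Idx N → Idx N := fun j => ⟨(j : ℤ) + 1, idx_lt_trans j.2 (lt_add_one _).le⟩
  have hs : Function.Injective s := fun i j hij => by
    have := congrArg (Subtype.val) hij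
    exact Subtype.ext (by simpa [s] using this)
  have : interval (x k) b = ⋃ j : Set.Ici k, Set.Ioc (x (j : Idx N)) (x ((j : Idx N) + 1)) := by
    ext t
    simp only [Set.mem_iUnion]
    constructor
    · intro ht
      obtain ⟨l, hl⟩ := h.exists_cell ⟨(h.a_le k k.2.le).trans_lt ht.1, ht.2⟩
      have hkl : (k : ℤ) ≤ l - 1 := by
        by_contra! hlt
        have := h.mono (k := l) (l := k) l.2.le (by lia)
        exact absurd (ht.1.trans_le (hl.2.trans this)) (lt_irrefl _)
      refine ⟨⟨⟨l - 1, idx_lt_trans k.2 hkl⟩, hkl⟩, ?_⟩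
      simpa using hl
    · rintro ⟨j, hj⟩
      exact ⟨(h.mono k.2.le j.2).trans_lt hj.1, (EReal.coe_le_coe_iff.2 hj.2).trans_lt
        (h.lt_b _ (s j).2.le)⟩
  rw [tail, this, lintegral_iUnion (fun _ => measurableSet_Ioc)]
  · exact tsum_congr fun k => setLIntegral_congr Ioo_ae_eq_Ioc.symm
  · intro i j hij
    have := h.disjoint_cell (fun heq => hij (Subtype.ext (hs heq)) : s i ≠ s j)
    simpa [Function.onFun, s] using this

theorem lintegral_Ioo_start (h : IsGrid a b N x) (g : ℝ → ℝ≥0∞) (k : Idx N) :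
    ∫⁻ t in Set.Ioo a (x k), g t =
      ∑' i : Set.Iic k, ∫⁻ t in Set.Ioo (x ((i : Idx N) - 1)) (x (i : Idx N)), g t := by
  have : Set.Ioc a (x k) = ⋃ i : Set.Iic k, Set.Ioc (x ((i : Idx N) - 1)) (x (i : Idx N)) := by
    ext t
    simp only [Set.mem_iUnion]
    constructor
    · intro ht
      obtain ⟨l, hl⟩ := h.exists_cell ⟨ht.1, (EReal.coe_le_coe_iff.2 ht.2).trans_lt
        (h.lt_b k k.2.le)⟩
      have hkl : (l : ℤ) ≤ k := by
        by_contra! hlt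
        have := h.mono (k := k) (l := l - 1) k.2.le (by lia)
        exact absurd (hl.1.trans_le (ht.2.trans this)) (lt_irrefl _)
      exact ⟨⟨l, hkl⟩, hl⟩
    · rintro ⟨i, hi⟩
      exact ⟨(h.a_le _ (idx_le_pred i.1.2)).trans_lt hi.1, hi.2.trans (h.mono i.1.2.le i.2)⟩
  rw [setLIntegral_congr Ioo_ae_eq_Ioc, this, lintegral_iUnion (fun _ => measurableSet_Ioc)]
  · exact tsum_congr fun k => setLIntegral_congr Ioo_ae_eq_Ioc.symm
  · exact fun i j hij => h.disjoint_cell fun heq => hij (Subtype.ext heq)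

end IsGrid

/-! ### Discretization of the right-hand side -/

/-- The normalized integral of `f` over the `k`-th cell of the grid. -/
noncomputable def coef (p : ℝ) {N : WithBot ℤ} (x : ℤ → ℝ) (f : ℝ → ℝ≥0∞) (k : Idx N) : ℝ≥0∞ :=
  (2 : ℝ≥0∞) ^ (-((k : ℝ) / p)) * ∫⁻ t in Set.Ioo (x (k - 1)) (x k), f t

theorem coef_rpow {p : ℝ} (hp : 0 < p) {N : WithBot ℤ} (x : ℤ → ℝ) (f : ℝ → ℝ≥0∞) (k : Idx N) :
    coef p x f k ^ p =
      (2 : ℝ≥0∞) ^ (-(k : ℝ)) * (∫⁻ t in Set.Ioo (x (k - 1)) (x k), f t) ^ p := by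
  rw [coef, ENNReal.mul_rpow_of_nonneg _ _ hp.le, ← ENNReal.rpow_mul]
  congr 2; field_simp

section Energy

variable {a : ℝ} {b : EReal} {w : ℝ → ℝ≥0∞} {D : ℝ≥0} {N : WithBot ℤ} {x : ℤ → ℝ}

/-- Blocks of `m` consecutive cells overlap at most `m` times. -/
theorem IsGrid.tsum_lintegral_Ioc_le (h : IsGrid a b N x) (g : ℝ → ℝ≥0∞) (m : ℕ) :
    ∑' k : Idx N, ∫⁻ t in Set.Ioc (x k) (x (k + m)), g t ≤ m * ∫⁻ t in interval a b, g t := by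
  induction m with
  | zero => simp
  | succ m ih =>
    have h1 : ∀ k : Idx N, ∫⁻ t in Set.Ioc (x k) (x (k + (m + 1 : ℕ))), g t ≤
        (∫⁻ t in Set.Ioc (x k) (x (k + m)), g t) +
          ∫⁻ t in Set.Ioc (x (k + m)) (x (k + m + 1)), g t := by
      intro k
      refine (lintegral_mono_set ?_).trans (lintegral_union_le _ _ _)
      push_cast
      rw [← add_assoc]
      exact Set.Ioc_subset_Ioc_union_Ioc
    have h2 : ∑' k : Idx N, ∫⁻ t in Set.Ioc (x (k + m)) (x (k + m + 1)), g t ≤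
        ∫⁻ t in interval a b, g t := by
      let s : Idx N → Idx N := fun j => ⟨(j : ℤ) + m + 1, idx_lt_trans j.2 (by lia)⟩
      have hs : Function.Injective s := fun i j hij => by
        have := congrArg (Subtype.val) hij
        exact Subtype.ext (by simpa [s] using this)
      rw [h.lintegral_interval]
      refine le_trans (le_of_eq (tsum_congr fun k => ?_)) (ENNReal.tsum_comp_le_tsum_of_injective hs
        fun k : Idx N => ∫⁻ t in Set.Ioo (x (k - 1)) (x k), g t)
      rw [setLIntegral_congr Ioo_ae_eq_Ioc.symm]
      simp [s]
    calc ∑' k : Idx N, ∫⁻ t in Set.Ioc (x k) (x (k + (m + 1 : ℕ))), g t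
        ≤ ∑' k : Idx N, ((∫⁻ t in Set.Ioc (x k) (x (k + m)), g t) +
          ∫⁻ t in Set.Ioc (x (k + m)) (x (k + m + 1)), g t) := ENNReal.tsum_le_tsum h1
      _ ≤ (m * ∫⁻ t in interval a b, g t) + ∫⁻ t in interval a b, g t := by
          rw [ENNReal.tsum_add]
          gcongr
      _ = _ := by push_cast; ring

/-- The tail of `w` at `x k` is at least `2 ^ (-k) / D`. After `m` steps it has dropped below half
of that, so at least half of it lies between `x k` and `x (k + m)`. Consecutive points need not
suffice when `D` is large. -/
theorem two_rpow_le_lintegral_Ioc (h : IsDiscretizing a b w D N x) {m : ℕ}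
    (hm : 2 * D * D ≤ 2 ^ m) (k : Idx N) :
    (2 : ℝ≥0∞) ^ (-(k : ℝ)) ≤ 2 * D * ∫⁻ t in Set.Ioc (x k) (x (k + m)), w t := by
  set I := ∫⁻ t in Set.Ioc (x k) (x (k + m)), w t with hI
  have hkm : N ≤ ((k + m : ℤ) : WithBot ℤ) := idx_le_trans k.2.le (by lia)
  have hlow := h.lower k k.2.le
  have hup := h.upper (k + m) hkm
  rw [← ENNReal.rpow_intCast] at hlow hup
  push_cast at hlow hup
  have hsplit : tail b w (x k) ≤ I + tail b w (x (k + m)) := by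
    refine (lintegral_mono_set ?_).trans (lintegral_union_le _ _ _)
    intro t ht
    rcases le_or_gt t (x (k + m)) with h1 | h1
    exacts [Or.inl ⟨ht.1, h1⟩, Or.inr ⟨h1, ht.2⟩]
  have hm' : 2 * (D : ℝ≥0∞) * D ≤ 2 ^ (m : ℝ) := by
    rw [ENNReal.rpow_natCast]
    exact_mod_cast hm
  set T := (2 : ℝ≥0∞) ^ (-(k : ℝ)) with hT
  have hTtop : T ≠ ∞ := two_rpow_ne_top _
  have h1 : 2 * T ≤ 2 * D * I + T := by
    calc 2 * T ≤ 2 * (D * (I + D * 2 ^ (-((k : ℝ) + m)))) := by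
          gcongr
          refine hlow.trans ?_
          gcongr
          refine hsplit.trans ?_
          gcongr
      _ = 2 * D * I + (2 * D * D) * 2 ^ (-((k : ℝ) + m)) := by ring
      _ ≤ 2 * D * I + 2 ^ (m : ℝ) * 2 ^ (-((k : ℝ) + m)) := by gcongr
      _ = 2 * D * I + T := by
          rw [← two_rpow_add, hT]
          congr 2; ring
  rw [two_mul] at h1
  exact (ENNReal.add_le_add_iff_right hTtop).1 h1

/-- The integral of `f` over the `k`-th cell is at most its integral over `(a, t)` for every `t > x
k`, and `w` has mass comparable to `2 ^ (-k)` on the next `m` cells, with `m` depending only on `D`.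
-/
theorem exists_energy_le {p : ℝ} (hp : 0 < p) (D : ℝ≥0) :
    ∃ c : ℝ≥0, ∀ (a : ℝ) (b : EReal) (w : ℝ → ℝ≥0∞) (N : WithBot ℤ) (x : ℤ → ℝ),
      IsGrid a b N x → IsDiscretizing a b w D N x → ∀ f : ℝ → ℝ≥0∞,
      ∑' k : Idx N, coef p x f k ^ p ≤
        c * ∫⁻ t in interval a b, (∫⁻ s in Set.Ioo a t, f s) ^ p * w t := by
  obtain ⟨m, hm⟩ := pow_unbounded_of_one_lt (2 * D * D) (one_lt_two (α := ℝ≥0))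
  refine ⟨2 * D * m, fun a b w N x hg h f => ?_⟩
  calc ∑' k : Idx N, coef p x f k ^ p
      ≤ ∑' k : Idx N, 2 * D * ∫⁻ t in Set.Ioc (x k) (x (k + m)),
          (∫⁻ s in Set.Ioo a t, f s) ^ p * w t := by
        refine ENNReal.tsum_le_tsum fun k => ?_
        rw [coef_rpow hp]
        calc (2 : ℝ≥0∞) ^ (-(k : ℝ)) * (∫⁻ t in Set.Ioo (x (k - 1)) (x k), f t) ^ p
            ≤ (2 * D * ∫⁻ t in Set.Ioc (x k) (x (k + m)), w t) *
              (∫⁻ t in Set.Ioo a (x k), f t) ^ p := by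
              gcongr
              · exact two_rpow_le_lintegral_Ioc h hm.le k
              · exact hg.a_le _ (idx_le_pred k.2)
          _ = 2 * D * ((∫⁻ t in Set.Ioo a (x k), f t) ^ p *
                ∫⁻ t in Set.Ioc (x k) (x (k + m)), w t) := by ring
          _ ≤ 2 * D * ∫⁻ t in Set.Ioc (x k) (x (k + m)),
                (∫⁻ t in Set.Ioo a (x k), f t) ^ p * w t := by
              gcongr
              exact lintegral_const_mul_le _ _
          _ ≤ _ := by
              gcongr 2 * D * ?_
              refine setLIntegral_mono' measurableSet_Ioc fun t ht => ?_
              gcongr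
              exact ht.1.le
    _ ≤ 2 * D * (m * ∫⁻ t in interval a b, (∫⁻ s in Set.Ioo a t, f s) ^ p * w t) := by
        rw [ENNReal.tsum_mul_left]
        gcongr
        exact hg.tsum_lintegral_Ioc_le _ m
    _ = _ := by push_cast; ring

/-- On the `k`-th cell the integral of `f` up to `t` is bounded by the sum of its cell integrals up
to `k`, and `w` has mass at most `D * 2 ^ (1 - k)`; the geometric Hardy inequality removes the
partial sums. -/
theorem exists_le_energy {p : ℝ} (hp : 0 < p) (D : ℝ≥0) :
    ∃ c : ℝ≥0, ∀ (a : ℝ) (b : EReal) (w : ℝ → ℝ≥0∞) (N : WithBot ℤ) (x : ℤ → ℝ),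
      IsGrid a b N x → AEMeasurable w (volume.restrict (interval a b)) →
      IsDiscretizing a b w D N x → ∀ f : ℝ → ℝ≥0∞,
      ∫⁻ t in interval a b, (∫⁻ s in Set.Ioo a t, f s) ^ p * w t ≤
        c * ∑' k : Idx N, coef p x f k ^ p := by
  obtain ⟨c, hc⟩ := exists_tsum_geometric_hardy one_pos hp
  refine ⟨2 * D * c, fun a b w N x hg hw h f => ?_⟩
  set φ : ℤ → ℝ≥0∞ := fun k => ∫⁻ t in Set.Ioo (x (k - 1)) (x k), f t with hφ
  -- The reflection `k ↦ -k`, with value 0 outside the index set, turns sums over `i ≤ k` into the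
  -- forward sums over `j + n` of the geometric Hardy inequality.
  set e : ℤ → ℝ≥0∞ := fun j => {k : ℤ | N < (k : WithBot ℤ)}.indicator φ (-j) with he
  have hF : ∀ k : Idx N, ∫⁻ t in Set.Ioo a (x k), f t ≤ ∑' n : ℕ, e (-(k : ℤ) + n) := by
    intro k
    rw [hg.lintegral_Ioo_start]
    let s : Set.Iic k → ℕ := fun i => ((k : ℤ) - (i : Idx N)).toNat
    have hs' : ∀ i : Set.Iic k, ((s i : ℕ) : ℤ) = k - (i : Idx N) := fun i =>
      Int.toNat_of_nonneg (sub_nonneg.2 i.2)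
    have hs : Function.Injective s := fun i j hij => by
      have h1 := hs' i
      rw [hij, hs' j] at h1
      exact Subtype.ext (Subtype.ext (by lia))
    refine le_trans (le_of_eq (tsum_congr fun i => ?_))
      (ENNReal.tsum_comp_le_tsum_of_injective hs fun n => e (-(k : ℤ) + n))
    have h2 : -(-(k : ℤ) + (s i : ℕ)) = (i : Idx N) := by rw [hs']; ring
    simp only [he, h2]
    rw [Set.indicator_of_mem (show ((i : Idx N) : ℤ) ∈ {k : ℤ | N < (k : WithBot ℤ)} from i.1.2)]
  have hterm : ∀ k : Idx N, ∫⁻ t in Set.Ioo (x (k - 1)) (x k),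
      (∫⁻ s in Set.Ioo a t, f s) ^ p * w t ≤
        2 * D * ((2 : ℝ≥0∞) ^ ((1 : ℝ) * ((-(k : ℤ) : ℤ) : ℝ)) *
          (∑' n : ℕ, e (-(k : ℤ) + n)) ^ p) := by
    intro k
    have hwk : AEMeasurable w (volume.restrict (Set.Ioo (x (k - 1)) (x k))) :=
      hw.mono_measure (Measure.restrict_mono (hg.open_cell_subset k) le_rfl)
    calc ∫⁻ t in Set.Ioo (x (k - 1)) (x k), (∫⁻ s in Set.Ioo a t, f s) ^ p * w t
        ≤ ∫⁻ t in Set.Ioo (x (k - 1)) (x k), (∑' n : ℕ, e (-(k : ℤ) + n)) ^ p * w t := by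
          refine setLIntegral_mono' measurableSet_Ioo fun t ht => ?_
          gcongr
          refine le_trans (lintegral_mono_set (Set.Ioo_subset_Ioo_right ht.2.le)) (hF k)
      _ = (∑' n : ℕ, e (-(k : ℤ) + n)) ^ p * ∫⁻ t in Set.Ioo (x (k - 1)) (x k), w t :=
          lintegral_const_mul'' _ hwk
      _ ≤ (∑' n : ℕ, e (-(k : ℤ) + n)) ^ p * (D * 2 ^ (-((k : ℤ) - 1))) := by
          gcongr
          refine le_trans (lintegral_mono_set fun t ht => ?_) (h.upper _ (idx_le_pred k.2))
          exact ⟨ht.1, (hg.open_cell_subset k ht).2⟩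
      _ = _ := by
          rw [← ENNReal.rpow_intCast]
          have : (2 : ℝ≥0∞) ^ (((-((k : ℤ) - 1) : ℤ)) : ℝ) =
              2 * 2 ^ ((1 : ℝ) * ((-(k : ℤ) : ℤ) : ℝ)) := by
            conv_rhs => enter [1]; rw [← ENNReal.rpow_one 2]
            rw [← two_rpow_add]
            congr 1; push_cast; ring
          rw [this]; ring
  rw [hg.lintegral_interval]
  refine (ENNReal.tsum_le_tsum hterm).trans ?_
  rw [ENNReal.tsum_mul_left, ENNReal.coe_mul, ENNReal.coe_mul, ENNReal.coe_ofNat,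
    mul_assoc (2 * (D : ℝ≥0∞))]
  gcongr
  have hinj : Function.Injective fun k : Idx N => -(k : ℤ) := fun i j hij =>
    Subtype.ext (neg_injective hij)
  refine (ENNReal.tsum_comp_le_tsum_of_injective hinj fun j : ℤ =>
    (2 : ℝ≥0∞) ^ ((1 : ℝ) * (j : ℝ)) * (∑' n : ℕ, e (j + n)) ^ p).trans ((hc e).trans ?_)
  gcongr
  refine le_of_eq ?_
  rw [← (Equiv.neg ℤ).tsum_eq]
  have hsub := tsum_subtype {k : ℤ | N < (k : WithBot ℤ)}
    fun k => (2 : ℝ≥0∞) ^ (-(k : ℝ)) * φ k ^ p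
  calc ∑' j : ℤ, (2 : ℝ≥0∞) ^ ((1 : ℝ) * (((Equiv.neg ℤ) j : ℤ) : ℝ)) * e ((Equiv.neg ℤ) j) ^ p
      = ∑' j : ℤ, {k : ℤ | N < (k : WithBot ℤ)}.indicator
          (fun k => (2 : ℝ≥0∞) ^ (-(k : ℝ)) * φ k ^ p) j := by
        refine tsum_congr fun j => ?_
        by_cases hj : j ∈ {k : ℤ | N < (k : WithBot ℤ)}
        · simp [he, Set.indicator_of_mem hj]
        · simp [he, Set.indicator_of_notMem hj, ENNReal.zero_rpow_of_pos hp]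
    _ = _ := by
        rw [← hsub]
        exact tsum_congr fun k => (coef_rpow hp x f k).symm

end Energy

/-! ### Splitting the left-hand side into discrete and local parts -/

/-- The power of the left-hand side of the inequality on `(a, b)`. -/
noncomputable def hardyLHS (q r a : ℝ) (b : EReal) (u v f : ℝ → ℝ≥0∞) : ℝ≥0∞ :=
  ∫⁻ t in interval a b, (∫⁻ s in Set.Ioo a t, f s ^ r * v s) ^ (q / r) * u t

/-- The weight of the `k`-th cell in the discrete Hardy inequality. -/
noncomputable def cellV (p r : ℝ) (v : ℝ → ℝ≥0∞) {N : WithBot ℤ} (x : ℤ → ℝ) (k : Idx N) : ℝ≥0∞ :=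
  (2 : ℝ≥0∞) ^ ((k : ℝ) / p) * V r v (x (k - 1)) (x k)

/-- The integral of `u` over the cell following the `k`-th one. -/
noncomputable def cellU (u : ℝ → ℝ≥0∞) {N : WithBot ℤ} (x : ℤ → ℝ) (k : Idx N) : ℝ≥0∞ :=
  ∫⁻ t in Set.Ioo (x k) (x (k + 1)), u t

theorem add_rpow_le_two_rpow_mul (x y : ℝ≥0∞) {s : ℝ} (hs : 0 < s) :
    (x + y) ^ s ≤ 2 ^ s * (x ^ s + y ^ s) := by
  calc (x + y) ^ s ≤ (2 * max x y) ^ s := by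
        gcongr
        rw [two_mul]
        exact add_le_add (le_max_left _ _) (le_max_right _ _)
    _ = 2 ^ s * max x y ^ s := ENNReal.mul_rpow_of_nonneg _ _ hs.le
    _ ≤ _ := by
        gcongr
        rcases le_total x y with h | h
        · rw [max_eq_right h]; exact le_add_self
        · rw [max_eq_left h]; exact le_self_add

theorem localHardy_const_mul {q r : ℝ} (hq : 0 < q) (hr : 0 < r) {u v f g : ℝ → ℝ≥0∞} {y z : ℝ}
    {c : ℝ≥0∞} (hc : c ≠ ∞) (hfg : ∀ s ∈ Set.Ioo y z, f s = c * g s) :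
    localHardy q r u v f y z = c ^ q * localHardy q r u v g y z := by
  unfold localHardy
  rw [← lintegral_const_mul' _ _ (ENNReal.rpow_ne_top_of_nonneg hq.le hc)]
  refine setLIntegral_congr_fun measurableSet_Ioo fun t ht => ?_
  have : ∫⁻ s in Set.Ioo y t, f s ^ r * v s = c ^ r * ∫⁻ s in Set.Ioo y t, g s ^ r * v s := by
    rw [← lintegral_const_mul' _ _ (ENNReal.rpow_ne_top_of_nonneg hr.le hc)]
    refine setLIntegral_congr_fun measurableSet_Ioo fun s hs => ?_
    simp only [hfg s ⟨hs.1, hs.2.trans ht.2⟩, ENNReal.mul_rpow_of_nonneg _ _ hr.le, mul_assoc]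
  simp only [this]
  rw [ENNReal.mul_rpow_of_nonneg _ _ (by positivity), ← ENNReal.rpow_mul,
    mul_div_cancel₀ _ hr.ne', mul_assoc]

section Grid

variable {p q r a : ℝ} {b : EReal} {u v f : ℝ → ℝ≥0∞} {N : WithBot ℤ} {x : ℤ → ℝ}

theorem IsGrid.restrict_le (h : IsGrid a b N x) (k : Idx N) :
    volume.restrict (Set.Ioo (x (k - 1)) (x k)) ≤ volume.restrict (interval a b) :=
  Measure.restrict_mono (h.open_cell_subset k) le_rfl

theorem setLIntegral_cell_le (h : IsGrid a b N x) (hr : 0 < r) (hr1 : r ≤ 1)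
    (hv : AEMeasurable v (volume.restrict (interval a b)))
    (hf : AEMeasurable f (volume.restrict (interval a b))) (k : Idx N) :
    ∫⁻ s in Set.Ioo (x (k - 1)) (x k), f s ^ r * v s ≤ coef p x f k ^ r * cellV p r v x k ^ r := by
  have h1 := lintegral_le_V hr hr1 (hv.mono_measure (h.restrict_le k))
    (hf.mono_measure (h.restrict_le k)) (x k) (Set.Iic (x k)) subset_rfl
  have h2 : (volume.restrict (Set.Ioo (x (k - 1)) (x k))).restrict (Set.Iic (x k)) =
      volume.restrict (Set.Ioo (x (k - 1)) (x k)) := by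
    rw [Measure.restrict_restrict measurableSet_Iic]
    congr 1
    exact Set.inter_eq_right.2 fun s hs => hs.2.le
  rw [h2, min_self, div_one, ENNReal.rpow_one] at h1
  refine h1.trans (le_of_eq ?_)
  rw [← ENNReal.mul_rpow_of_nonneg _ _ hr.le, coef, cellV, mul_mul_mul_comm, ← two_rpow_add,
    neg_add_cancel, ENNReal.rpow_zero, one_mul]

/-- For `t` in the `k`-th cell the inner integral is split at `x (k - 1)`. The first piece is
constant on the cell and is bounded cell by cell through `V`; the second is the local Hardy
operator. -/
theorem hardyLHS_le (h : IsGrid a b N x) (hr : 0 < r) (hr1 : r ≤ 1) (hq : 0 < q)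
    (hu : AEMeasurable u (volume.restrict (interval a b)))
    (hv : AEMeasurable v (volume.restrict (interval a b)))
    (hf : AEMeasurable f (volume.restrict (interval a b))) :
    hardyLHS q r a b u v f ≤ 2 ^ (q / r) *
      ((∑' k : Idx N, (∑' i : Set.Iic k, coef p x f (i : Idx N) ^ r *
        cellV p r v x (i : Idx N) ^ r) ^ (q / r) *
          cellU u x k) +
        ∑' k : Idx N, localHardy q r u v f (x (k - 1)) (x k)) := by
  have hs : 0 < q / r := by positivity
  set G : ℝ → ℝ≥0∞ := fun t => ∫⁻ s in Set.Ioo a t, f s ^ r * v s with hG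
  set X : ℤ → ℝ≥0∞ := fun k => G (x k) ^ (q / r) * ∫⁻ t in Set.Ioo (x k) (x (k + 1)), u t with hX
  have hcell : ∀ k : Idx N, ∫⁻ t in Set.Ioo (x (k - 1)) (x k), G t ^ (q / r) * u t ≤
      2 ^ (q / r) * (X (k - 1) + localHardy q r u v f (x (k - 1)) (x k)) := by
    intro k
    have huk := hu.mono_measure (h.restrict_le k)
    calc ∫⁻ t in Set.Ioo (x (k - 1)) (x k), G t ^ (q / r) * u t
        ≤ ∫⁻ t in Set.Ioo (x (k - 1)) (x k), 2 ^ (q / r) * (G (x (k - 1)) ^ (q / r) * u t +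
            (∫⁻ s in Set.Ioo (x (k - 1)) t, f s ^ r * v s) ^ (q / r) * u t) := by
          refine setLIntegral_mono' measurableSet_Ioo fun t ht => ?_
          have hGt : G t ≤ G (x (k - 1)) + ∫⁻ s in Set.Ioo (x (k - 1)) t, f s ^ r * v s := by
            simp only [hG]
            rw [setLIntegral_congr (Ioo_ae_eq_Ioc (a := a) (b := x (k - 1)))]
            refine (lintegral_mono_set fun s hs => ?_).trans (lintegral_union_le _ _ _)
            rcases le_or_gt s (x (k - 1)) with h1 | h1
            exacts [Or.inl ⟨hs.1, h1⟩, Or.inr ⟨h1, hs.2⟩]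
          rw [← add_mul, ← mul_assoc]
          gcongr
          exact (ENNReal.rpow_le_rpow hGt hs.le).trans (add_rpow_le_two_rpow_mul _ _ hs)
      _ = _ := by
          rw [lintegral_const_mul' _ _ (ENNReal.rpow_ne_top_of_nonneg hs.le (by norm_num)),
            lintegral_add_left' (huk.const_mul _), lintegral_const_mul'' _ huk]
          simp only [hX, localHardy, sub_add_cancel]
  have hshift : ∑' k : Idx N, X (k - 1) ≤ ∑' k : Idx N, X k := by
    have h1 := tsum_subtype {k : ℤ | N < (k : WithBot ℤ)} X
    have h2 := tsum_subtype {k : ℤ | N < (k : WithBot ℤ)} fun k => X (k - 1)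
    calc ∑' k : Idx N, X (k - 1)
        = ∑' k : ℤ, {k : ℤ | N < (k : WithBot ℤ)}.indicator (fun k => X (k - 1)) k := h2
      _ ≤ ∑' k : ℤ, {k : ℤ | N < (k : WithBot ℤ)}.indicator X (k - 1) := by
          refine ENNReal.tsum_le_tsum fun k => ?_
          by_cases hk : N < (k : WithBot ℤ)
          · rw [Set.indicator_of_mem (show k ∈ {k : ℤ | N < (k : WithBot ℤ)} from hk)]
            by_cases hk' : N < ((k - 1 : ℤ) : WithBot ℤ)
            · rw [Set.indicator_of_mem (show k - 1 ∈ {k : ℤ | N < (k : WithBot ℤ)} from hk')]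
            -- At the first cell `k - 1 = N` and `x N = a`, so nothing precedes the cell and the
            -- shifted term vanishes.
            · have heq : N = ((k - 1 : ℤ) : WithBot ℤ) :=
                le_antisymm (idx_le_pred hk) (not_lt.1 hk')
              have : X (k - 1) = 0 := by
                simp only [hX, hG]
                rw [h.start _ heq, Set.Ioo_self, Measure.restrict_empty, lintegral_zero_measure,
                  ENNReal.zero_rpow_of_pos hs, zero_mul]
              rw [this]
              exact zero_le
          · rw [Set.indicator_of_notMem (show k ∉ {k : ℤ | N < (k : WithBot ℤ)} from hk)]
            exact zero_le
      _ = ∑' k : ℤ, {k : ℤ | N < (k : WithBot ℤ)}.indicator X k :=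
          (Equiv.subRight (1 : ℤ)).tsum_eq fun k => {k : ℤ | N < (k : WithBot ℤ)}.indicator X k
      _ = _ := h1.symm
  calc hardyLHS q r a b u v f
      = ∑' k : Idx N, ∫⁻ t in Set.Ioo (x (k - 1)) (x k), G t ^ (q / r) * u t :=
        h.lintegral_interval _
    _ ≤ ∑' k : Idx N, 2 ^ (q / r) * (X (k - 1) + localHardy q r u v f (x (k - 1)) (x k)) :=
        ENNReal.tsum_le_tsum hcell
    _ ≤ 2 ^ (q / r) * ((∑' k : Idx N, X k) +
          ∑' k : Idx N, localHardy q r u v f (x (k - 1)) (x k)) := by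
        rw [ENNReal.tsum_mul_left, ENNReal.tsum_add]
        gcongr
    _ ≤ _ := by
        gcongr with k
        simp only [hX, hG]
        gcongr
        · rw [h.lintegral_Ioo_start]
          exact ENNReal.tsum_le_tsum fun i => setLIntegral_cell_le h hr hr1 hv hf _
        · exact le_rfl

/-! ### Gluing and the necessity of the two parts -/

/-- Gluing of functions on the cells of the grid. -/
noncomputable def glue (p : ℝ) (x : ℤ → ℝ) (c : Idx N → ℝ≥0∞) (g : Idx N → ℝ → ℝ≥0∞) (s : ℝ) :
    ℝ≥0∞ :=
  ∑' k : Idx N, (Set.Ioo (x (k - 1)) (x k)).indicator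
    (fun s => (2 : ℝ≥0∞) ^ ((k : ℝ) / p) * c k * g k s) s

theorem glue_eq (h : IsGrid a b N x) (c : Idx N → ℝ≥0∞) (g : Idx N → ℝ → ℝ≥0∞) (k : Idx N)
    {s : ℝ} (hs : s ∈ Set.Ioo (x (k - 1)) (x k)) :
    glue p x c g s = (2 : ℝ≥0∞) ^ ((k : ℝ) / p) * c k * g k s := by
  rw [glue, tsum_eq_single k, Set.indicator_of_mem hs]
  intro j hj
  refine Set.indicator_of_notMem (fun hj' => ?_) _
  exact Set.disjoint_left.1 (h.disjoint_cell hj) (Set.Ioo_subset_Ioc_self hj')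
    (Set.Ioo_subset_Ioc_self hs)

theorem measurable_glue (c : Idx N → ℝ≥0∞) {g : Idx N → ℝ → ℝ≥0∞} (hg : ∀ k, Measurable (g k)) :
    Measurable (glue p x c g) :=
  Measurable.tsum fun k => ((hg k).const_mul _).indicator measurableSet_Ioo

theorem coef_glue_le (h : IsGrid a b N x) {c : Idx N → ℝ≥0∞} {g : Idx N → ℝ → ℝ≥0∞}
    (hg : ∀ k, Measurable (g k)) (hg1 : ∀ k : Idx N, ∫⁻ s in Set.Ioo (x (k - 1)) (x k), g k s ≤ 1)
    (k : Idx N) : coef p x (glue p x c g) k ≤ c k := by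
  rw [coef, setLIntegral_congr_fun measurableSet_Ioo fun s hs => glue_eq h c g k hs,
    lintegral_const_mul _ (hg k), ← mul_assoc, ← mul_assoc, ← two_rpow_add, neg_add_cancel,
    ENNReal.rpow_zero, one_mul]
  exact mul_le_of_le_one_right' (hg1 k)

theorem ne_top_of_tsum_rpow_le_one (hp : 0 < p) {c : Idx N → ℝ≥0∞} (hc : ∑' k, c k ^ p ≤ 1)
    (k : Idx N) : (2 : ℝ≥0∞) ^ ((k : ℝ) / p) * c k ≠ ∞ := by
  refine ENNReal.mul_ne_top (two_rpow_ne_top _) fun htop => ?_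
  have := (ENNReal.le_tsum k).trans hc
  rw [htop, ENNReal.top_rpow_of_pos hp] at this
  exact absurd this (by simp)

variable {K : ℝ≥0}

/-- For `t` in the cell after the `k`-th one the inner integral contains all cells up to `k`, and
the cells that follow are disjoint. -/
theorem tsum_cellU_le (h : IsGrid a b N x) (hp : 0 < p) (hq : 0 < q) (hr : 0 < r)
    (hK : ∀ f : ℝ → ℝ≥0∞, Measurable f → ∑' k : Idx N, coef p x f k ^ p ≤ 1 →
      hardyLHS q r a b u v f ≤ K)
    {c : Idx N → ℝ≥0∞} (hc : ∑' k, c k ^ p ≤ 1) {g : Idx N → ℝ → ℝ≥0∞}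
    (hg : ∀ k, Measurable (g k)) (hg1 : ∀ k : Idx N, ∫⁻ s in Set.Ioo (x (k - 1)) (x k), g k s ≤ 1) :
    ∑' k : Idx N, (∑' i : Set.Iic k, ((2 : ℝ≥0∞) ^ (((i : Idx N) : ℝ) / p) * c i) ^ r *
      ∫⁻ s in Set.Ioo (x ((i : Idx N) - 1)) (x (i : Idx N)), g i s ^ r * v s) ^ (q / r) *
        cellU u x k ≤ K := by
  have hs : 0 < q / r := by positivity
  refine le_trans ?_ (hK (glue p x c g) (measurable_glue c hg) ((ENNReal.tsum_le_tsum fun k =>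
    ENNReal.rpow_le_rpow (coef_glue_le h hg hg1 k) hp.le).trans hc))
  have h1 := h.tsum_lintegral_Ioc_le
    (fun t => (∫⁻ s in Set.Ioo a t, glue p x c g s ^ r * v s) ^ (q / r) * u t) 1
  simp only [Nat.cast_one, one_mul] at h1
  refine le_trans (ENNReal.tsum_le_tsum fun k => ?_) h1
  rw [cellU, setLIntegral_congr Ioo_ae_eq_Ioc]
  refine (lintegral_const_mul_le _ _).trans (setLIntegral_mono' measurableSet_Ioc fun t ht => ?_)
  gcongr
  refine le_trans (le_of_eq ?_) (lintegral_mono_set (Set.Ioo_subset_Ioo_right ht.1.le))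
  rw [h.lintegral_Ioo_start]
  refine tsum_congr fun i => ?_
  have hfin := ne_top_of_tsum_rpow_le_one hp hc (i : Idx N)
  rw [← lintegral_const_mul' _ _ (ENNReal.rpow_ne_top_of_nonneg hr.le hfin)]
  refine setLIntegral_congr_fun measurableSet_Ioo fun s hs => ?_
  simp only [glue_eq h c g i hs, ENNReal.mul_rpow_of_nonneg _ _ hr.le, mul_assoc]

theorem tsum_localHardy_le (h : IsGrid a b N x) (hp : 0 < p) (hq : 0 < q) (hr : 0 < r)
    (hK : ∀ f : ℝ → ℝ≥0∞, Measurable f → ∑' k : Idx N, coef p x f k ^ p ≤ 1 →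
      hardyLHS q r a b u v f ≤ K)
    {c : Idx N → ℝ≥0∞} (hc : ∑' k, c k ^ p ≤ 1) {g : Idx N → ℝ → ℝ≥0∞}
    (hg : ∀ k, Measurable (g k)) (hg1 : ∀ k : Idx N, ∫⁻ s in Set.Ioo (x (k - 1)) (x k), g k s ≤ 1) :
    ∑' k : Idx N, ((2 : ℝ≥0∞) ^ ((k : ℝ) / p) * c k) ^ q *
      localHardy q r u v (g k) (x (k - 1)) (x k) ≤ K := by
  refine le_trans ?_ (hK (glue p x c g) (measurable_glue c hg) ((ENNReal.tsum_le_tsum fun k =>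
    ENNReal.rpow_le_rpow (coef_glue_le h hg hg1 k) hp.le).trans hc))
  rw [hardyLHS, h.lintegral_interval]
  refine ENNReal.tsum_le_tsum fun k => ?_
  rw [← localHardy_const_mul hq hr (ne_top_of_tsum_rpow_le_one hp hc k)
    fun s hs => glue_eq h c g k hs]
  refine setLIntegral_mono' measurableSet_Ioo fun t ht => ?_
  gcongr
  exact h.a_le _ (idx_le_pred k.2)

theorem tail_pos (hu : IsWeight a b u) {y : ℝ} (hay : a ≤ y) (hyb : (y : EReal) < b) :
    0 < tail b u y := by
  have hsub : interval y b ⊆ interval a b := fun t ht => ⟨hay.trans_lt ht.1, ht.2⟩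
  have hle : volume.restrict (interval y b) ≤ volume.restrict (interval a b) :=
    Measure.restrict_mono hsub le_rfl
  rw [pos_iff_ne_zero, tail, Ne, lintegral_eq_zero_iff' (hu.1.mono_measure hle)]
  intro h0
  have hne : (interval y b).Nonempty := by
    obtain ⟨t, h1, h2⟩ := EReal.exists_between_coe_real hyb
    exact ⟨t, EReal.coe_lt_coe_iff.1 h1, h2⟩
  have h1 : ∀ᵐ _ ∂(volume.restrict (interval y b)), False := by
    filter_upwards [h0, ae_mono hle hu.2] with t ht ht'
    exact ht'.1.ne' ht
  rw [Filter.eventually_false_iff_eq_bot, ae_eq_bot, Measure.restrict_eq_zero] at h1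
  exact ((isOpen_interval y b).measure_pos volume hne).ne' h1

/-- Gluing functions that realize half of `V` in each cell gives the discrete inequality, and the
half gives the factor `2 ^ q`. Choosing them requires `V` finite, which is obtained first by testing
a single cell. -/
theorem discrete_of_hardyLHS_le (h : IsGrid a b N x) (hp : 0 < p) (hq : 0 < q) (hr : 0 < r)
    (hr1 : r ≤ 1) (hu : IsWeight a b u) (hv : IsWeight a b v)
    (hK : ∀ f : ℝ → ℝ≥0∞, Measurable f → ∑' k : Idx N, coef p x f k ^ p ≤ 1 →
      hardyLHS q r a b u v f ≤ K) :
    (∀ k : Idx N, cellV p r v x k ≠ ∞) ∧ ∀ c : Idx N → ℝ≥0∞, ∑' k, c k ^ p ≤ 1 →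
      ∑' k : Idx N, (∑' i : Set.Iic k, c i ^ r * cellV p r v x (i : Idx N) ^ r) ^ (q / r) *
        cellU u x k ≤ (2 ^ q * K : ℝ≥0) := by
  classical
  have hs : 0 < q / r := by positivity
  have hext : ∀ (k : Idx N) (l : ℝ≥0), (l : ℝ≥0∞) < V r v (x (k - 1)) (x k) →
      ∃ g : ℝ → ℝ≥0∞, Measurable g ∧ ∫⁻ s in Set.Ioo (x (k - 1)) (x k), g s ≤ 1 ∧
        (l : ℝ≥0∞) ^ r ≤ ∫⁻ s in Set.Ioo (x (k - 1)) (x k), g s ^ r * v s := by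
    intro k l hl
    obtain ⟨g, hg, -, hg1, hgl⟩ := exists_lt_V hr hr1 (hv.1.mono_measure (h.restrict_le k))
      (ae_mono (h.restrict_le k) (hv.2.mono fun s hs => hs.2.ne)) hl
    exact ⟨g, hg, (setLIntegral_le_lintegral _ _).trans hg1, hgl⟩
  -- Testing on the `k`-th cell alone bounds `V ^ q` times a power of 2 times the tail of `u` at `x
  -- k`; the tail is positive because `u` is a weight.
  have hVfin : ∀ k : Idx N, V r v (x (k - 1)) (x k) ≠ ∞ := by
    intro k
    have htail : 0 < tail b u (x k) := tail_pos hu (h.a_le _ k.2.le) (h.lt_b _ k.2.le)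
    have hbd : V r v (x (k - 1)) (x k) ^ q * (((2 : ℝ≥0∞) ^ ((k : ℝ) / p)) ^ q * tail b u (x k)) ≤
        K := by
      refine rpow_mul_le_of_forall_lt hq ENNReal.coe_ne_top fun l hl => ?_
      obtain ⟨g, hg, hg1, hgl⟩ := hext k l hl
      have hsing : ∑' j, (Pi.single k (1 : ℝ≥0∞) : Idx N → ℝ≥0∞) j ^ p ≤ 1 := by
        rw [tsum_eq_single k]
        · simp
        · intro j hj
          rw [Pi.single_eq_of_ne hj, ENNReal.zero_rpow_of_pos hp]
      have hmain := tsum_cellU_le h hp hq hr hK hsing (g := fun j => if j = k then g else 0)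
        (by
          intro j
          by_cases hj : j = k
          · simpa [hj] using hg
          · simpa [hj] using measurable_zero)
        (by intro j; by_cases hj : j = k <;> simp [hj, hg1])
      refine le_trans ?_ hmain
      rw [h.lintegral_tail, ← ENNReal.tsum_mul_left, ← ENNReal.tsum_mul_left]
      refine le_trans (ENNReal.tsum_le_tsum fun j => ?_)
        (ENNReal.tsum_comp_le_tsum_of_injective (Subtype.val_injective (p := (· ∈ Set.Ici k))) _)
      rw [← mul_assoc, ← ENNReal.mul_rpow_of_nonneg _ _ hq.le, cellU]
      gcongr
      have h1 : ((l : ℝ≥0∞) * 2 ^ ((k : ℝ) / p)) ^ q =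
          (((l : ℝ≥0∞) * 2 ^ ((k : ℝ) / p)) ^ r) ^ (q / r) := by
        rw [← ENNReal.rpow_mul, mul_div_cancel₀ _ hr.ne']
      rw [h1]
      gcongr
      refine le_trans ?_ (ENNReal.le_tsum (⟨k, j.2⟩ : Set.Iic (j : Idx N)))
      simp only [Pi.single_eq_same, mul_one, if_true]
      rw [ENNReal.mul_rpow_of_nonneg _ _ hr.le, mul_comm]
      gcongr
    intro htop
    rw [htop, ENNReal.top_rpow_of_pos hq, ENNReal.top_mul] at hbd
    · exact ENNReal.coe_ne_top (top_le_iff.1 hbd)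
    · refine mul_ne_zero ?_ htail.ne'
      rw [← ENNReal.rpow_mul]; exact two_rpow_ne_zero _
  refine ⟨fun k => ENNReal.mul_ne_top (two_rpow_ne_top _) (hVfin k), fun c hc => ?_⟩
  have hex : ∀ k : Idx N, ∃ g : ℝ → ℝ≥0∞, Measurable g ∧
      ∫⁻ s in Set.Ioo (x (k - 1)) (x k), g s ≤ 1 ∧
        (V r v (x (k - 1)) (x k) / 2) ^ r ≤ ∫⁻ s in Set.Ioo (x (k - 1)) (x k), g s ^ r * v s := by
    intro k
    by_cases h0 : V r v (x (k - 1)) (x k) = 0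
    · refine ⟨0, measurable_zero, by simp, ?_⟩
      rw [h0, ENNReal.zero_div, ENNReal.zero_rpow_of_pos hr]
      exact zero_le
    · have hlt := ENNReal.half_lt_self h0 (hVfin k)
      have hl : ((V r v (x (k - 1)) (x k) / 2).toNNReal : ℝ≥0∞) = V r v (x (k - 1)) (x k) / 2 :=
        ENNReal.coe_toNNReal hlt.ne_top
      have := hext k _ (hl.symm ▸ hlt)
      rwa [hl] at this
  choose g hg hg1 hgl using hex
  have hmain := tsum_cellU_le h hp hq hr hK hc hg hg1
  rw [ENNReal.coe_mul, ENNReal.coe_rpow_of_nonneg _ hq.le, ENNReal.coe_ofNat]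
  refine le_trans ?_ (mul_le_mul_right hmain _)
  rw [← ENNReal.tsum_mul_left]
  refine ENNReal.tsum_le_tsum fun k => ?_
  rw [← mul_assoc]
  gcongr
  have h2 : (2 : ℝ≥0∞) ^ q = (2 ^ r) ^ (q / r) := by
    rw [← ENNReal.rpow_mul, mul_div_cancel₀ _ hr.ne']
  rw [h2, ← ENNReal.mul_rpow_of_nonneg _ _ hs.le, ← ENNReal.tsum_mul_left]
  refine ENNReal.rpow_le_rpow (ENNReal.tsum_le_tsum fun i => ?_) hs.le
  refine le_trans (le_of_eq ?_) (mul_le_mul_right (mul_le_mul_right (hgl i) _) _)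
  rw [← ENNReal.mul_rpow_of_nonneg _ _ hr.le, ← ENNReal.mul_rpow_of_nonneg _ _ hr.le,
    ← ENNReal.mul_rpow_of_nonneg _ _ hr.le, cellV]
  congr 1
  calc c i * (2 ^ (((i : Idx N) : ℝ) / p) * V r v (x ((i : Idx N) - 1)) (x (i : Idx N)))
      = 2 ^ (((i : Idx N) : ℝ) / p) * c i *
          (2 * (V r v (x ((i : Idx N) - 1)) (x (i : Idx N)) / 2)) := by
        rw [ENNReal.mul_div_cancel (by norm_num) (by norm_num)]; ring
    _ = _ := by ring

/-- The best constant of the Hardy inequality localized to `(y, z)`. -/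
noncomputable def localConst (q r : ℝ) (u v : ℝ → ℝ≥0∞) (y z : ℝ) : ℝ≥0∞ :=
  ⨆ (g : ℝ → ℝ≥0∞) (_ : Measurable g ∧ ∫⁻ s in Set.Ioo y z, g s ≤ 1), localHardy q r u v g y z

/-- Near-optimal functions for the cells in `J` are glued with coefficients `c`. This is the test
form from which the supremum (`p ≤ q`) and the `ℓ^{p/(p-q)}` bound (`q < p`) follow. -/
theorem sum_localConst_le (h : IsGrid a b N x) (hp : 0 < p) (hq : 0 < q) (hr : 0 < r)
    (hK : ∀ f : ℝ → ℝ≥0∞, Measurable f → ∑' k : Idx N, coef p x f k ^ p ≤ 1 →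
      hardyLHS q r a b u v f ≤ K)
    (J : Finset (Idx N)) (c l : Idx N → ℝ≥0)
    (hl : ∀ k ∈ J, (l k : ℝ≥0∞) <
      (2 : ℝ≥0∞) ^ ((k : ℝ) * q / p) * localConst q r u v (x (k - 1)) (x k))
    (hc : ∑ k ∈ J, c k ^ p ≤ 1) : ∑ k ∈ J, c k ^ q * l k ≤ K := by
  classical
  have hex : ∀ k : Idx N, ∃ g : ℝ → ℝ≥0∞, Measurable g ∧
      ∫⁻ s in Set.Ioo (x (k - 1)) (x k), g s ≤ 1 ∧ (k ∈ J → (l k : ℝ≥0∞) ≤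
        (2 : ℝ≥0∞) ^ ((k : ℝ) * q / p) * localHardy q r u v g (x (k - 1)) (x k)) := by
    intro k
    by_cases hk : k ∈ J
    · have h1 := hl k hk
      rw [localConst, ENNReal.mul_iSup] at h1
      obtain ⟨g, hg⟩ := lt_iSup_iff.1 h1
      rw [ENNReal.mul_iSup] at hg
      obtain ⟨hg', hlt⟩ := lt_iSup_iff.1 hg
      exact ⟨g, hg'.1, hg'.2, fun _ => hlt.le⟩
    · exact ⟨0, measurable_zero, by simp, fun h => absurd h hk⟩
  choose g hg hg1 hgl using hex
  have hc' : ∑' k, (if k ∈ J then (c k : ℝ≥0∞) else 0) ^ p ≤ 1 := by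
    rw [tsum_eq_sum (s := J)]
    · have := ENNReal.coe_le_coe.2 hc
      rw [ENNReal.ofNNReal_finsetSum] at this
      refine le_trans (le_of_eq (Finset.sum_congr rfl fun k hk => ?_)) this
      rw [if_pos hk, ENNReal.coe_rpow_of_nonneg _ hp.le]
    · intro k hk
      rw [if_neg hk, ENNReal.zero_rpow_of_pos hp]
  have hmain := (ENNReal.sum_le_tsum J).trans (tsum_localHardy_le h hp hq hr hK hc' hg hg1)
  have : ((∑ k ∈ J, c k ^ q * l k : ℝ≥0) : ℝ≥0∞) ≤ K := by
    refine le_trans ?_ hmain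
    rw [ENNReal.ofNNReal_finsetSum]
    refine Finset.sum_le_sum fun k hk => ?_
    rw [if_pos hk, ENNReal.coe_mul, ENNReal.coe_rpow_of_nonneg _ hq.le,
      ENNReal.mul_rpow_of_nonneg _ _ hq.le, ← ENNReal.rpow_mul, mul_comm (2 ^ _) ((c k : ℝ≥0∞) ^ q),
      mul_assoc, div_mul_eq_mul_div]
    gcongr
    exact hgl k hk
  exact_mod_cast this

theorem localConst_le (h : IsGrid a b N x) (hp : 0 < p) (hq : 0 < q) (hr : 0 < r)
    (hK : ∀ f : ℝ → ℝ≥0∞, Measurable f → ∑' k : Idx N, coef p x f k ^ p ≤ 1 →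
      hardyLHS q r a b u v f ≤ K) (k : Idx N) :
    (2 : ℝ≥0∞) ^ ((k : ℝ) * q / p) * localConst q r u v (x (k - 1)) (x k) ≤ K := by
  refine ENNReal.le_of_forall_nnreal_lt fun l hl => ?_
  have := sum_localConst_le h hp hq hr hK {k} (fun _ => 1) (fun _ => l) (by simpa using hl)
    (by simp)
  simpa using this

theorem tsum_localConst_le (h : IsGrid a b N x) (hq : 0 < q) (hqp : q < p) (hr : 0 < r)
    (hK : ∀ f : ℝ → ℝ≥0∞, Measurable f → ∑' k : Idx N, coef p x f k ^ p ≤ 1 →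
      hardyLHS q r a b u v f ≤ K) :
    ∑' k : Idx N, ((2 : ℝ≥0∞) ^ ((k : ℝ) * q / p) *
      localConst q r u v (x (k - 1)) (x k)) ^ (p / (p - q)) ≤ (2 * (K : ℝ≥0∞)) ^ (p / (p - q)) :=
  tsum_rpow_le_of_test hq hqp _ K fun J c l hl hc =>
    sum_localConst_le h (hq.trans hqp) hq hr hK J c l hl hc

end Grid

/-! ### The discrete quantities -/

/-- The quantity `A` is, uniformly in all data, equivalent to the best constant of the discrete
part of the inequality. -/
def DiscreteChar (p q r : ℝ)
    (A : EReal → (ℝ → ℝ≥0∞) → (ℝ → ℝ≥0∞) → WithBot ℤ → (ℤ → ℝ) → ℝ≥0∞) : Prop :=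
  ∃ c : ℝ≥0, ∀ (a : ℝ) (b : EReal) (u v : ℝ → ℝ≥0∞) (N : WithBot ℤ) (x : ℤ → ℝ),
    IsGrid a b N x → IsWeight a b u → IsWeight a b v →
    (∀ f : ℝ → ℝ≥0∞, A b u v N x ≠ ∞ → ∑' k : Idx N, coef p x f k ^ p ≠ ∞ →
      ∑' k : Idx N, (∑' i : Set.Iic k, coef p x f (i : Idx N) ^ r *
        cellV p r v x (i : Idx N) ^ r) ^ (q / r) * cellU u x k ≤
        c * (A b u v N x ^ q * (∑' k : Idx N, coef p x f k ^ p) ^ (q / p))) ∧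
    ∀ K : ℝ≥0, (∀ f : ℝ → ℝ≥0∞, Measurable f → ∑' k : Idx N, coef p x f k ^ p ≤ 1 →
      hardyLHS q r a b u v f ≤ K) → A b u v N x ≤ c * (K : ℝ≥0∞) ^ (1 / q)

/-- The quantity `B` is, uniformly in all data, equivalent to the best constant of the local
part of the inequality. -/
def LocalChar (p q r : ℝ)
    (B : (ℝ → ℝ≥0∞) → (ℝ → ℝ≥0∞) → WithBot ℤ → (ℤ → ℝ) → ℝ≥0∞) : Prop :=
  ∃ c : ℝ≥0, ∀ (a : ℝ) (b : EReal) (u v : ℝ → ℝ≥0∞) (N : WithBot ℤ) (x : ℤ → ℝ),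
    IsGrid a b N x → IsWeight a b u → IsWeight a b v →
    (∀ f : ℝ → ℝ≥0∞, AEMeasurable f (volume.restrict (interval a b)) → B u v N x ≠ ∞ →
      ∑' k : Idx N, coef p x f k ^ p ≠ ∞ →
      ∑' k : Idx N, localHardy q r u v f (x (k - 1)) (x k) ≤
        c * (B u v N x ^ q * (∑' k : Idx N, coef p x f k ^ p) ^ (q / p))) ∧
    ∀ K : ℝ≥0, (∀ f : ℝ → ℝ≥0∞, Measurable f → ∑' k : Idx N, coef p x f k ^ p ≤ 1 →
      hardyLHS q r a b u v f ≤ K) → B u v N x ≤ c * (K : ℝ≥0∞) ^ (1 / q)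

section DiscreteQuantities

variable {p q r a : ℝ} {b : EReal} {u v : ℝ → ℝ≥0∞} {N : WithBot ℤ} {x : ℤ → ℝ}

/-- The two ways to index by `N + 1 ≤ i ≤ k`. -/
def idxLEEquiv (k : Idx N) : IdxLE N k ≃ Set.Iic k where
  toFun i := ⟨⟨i, i.2.1⟩, i.2.2⟩
  invFun i := ⟨i.1, i.1.2, i.2⟩
  left_inv _ := rfl
  right_inv _ := rfl

theorem cellV_rpow {s : ℝ} (hs : 0 ≤ s) (k : Idx N) :
    cellV p r v x k ^ s =
      (2 : ℝ≥0∞) ^ ((k : ℝ) * (s / p)) * V r v (x (k - 1)) (x k) ^ s := by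
  rw [cellV, ENNReal.mul_rpow_of_nonneg _ _ hs, ← ENNReal.rpow_mul]
  congr 2; ring

theorem discreteNorm_eq_of_lt (hr : 0 < r) (hrp : r < p) (k : Idx N) :
    discreteNorm p r (cellV p r v x) k =
      (∑' i : IdxLE N k, (2 : ℝ≥0∞) ^ ((i : ℝ) * (r / (p - r))) *
        V r v (x (i - 1)) (x i) ^ (p * r / (p - r))) ^ ((p - r) / (p * r)) := by
  have hp : 0 < p := hr.trans hrp
  have hd : 0 < p - r := sub_pos.2 hrp
  rw [discreteNorm, if_pos hrp, ← (idxLEEquiv k).tsum_eq]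
  congr 1
  refine tsum_congr fun i => ?_
  rw [cellV_rpow (by positivity)]
  congr 3
  field_simp

theorem discreteNorm_rpow_eq_of_le (hpr : p ≤ r) {s : ℝ} (hs : 0 < s) (k : Idx N) :
    discreteNorm p r (cellV p r v x) k ^ s =
      ⨆ i : IdxLE N k, (2 : ℝ≥0∞) ^ ((i : ℝ) * (s / p)) * V r v (x (i - 1)) (x i) ^ s := by
  rw [discreteNorm, if_neg (not_lt.2 hpr), iSup_rpow _ hs, ← (idxLEEquiv k).iSup_comp]
  refine iSup_congr fun i => ?_
  rw [cellV_rpow hs.le]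
  rfl

theorem rpow_mul_rpow_one_div (hq : 0 < q) (y m : ℝ≥0∞) : (y * m ^ (1 / q)) ^ q = y ^ q * m := by
  rw [ENNReal.mul_rpow_of_nonneg _ _ hq.le, ← ENNReal.rpow_mul, one_div_mul_cancel hq.ne',
    ENNReal.rpow_one]

theorem le_const_mul_of_rpow_le (hq : 0 < q) {A : ℝ≥0∞} {c K : ℝ≥0}
    (h : A ^ q ≤ (c ^ q * K : ℝ≥0)) :
    A ≤ c * (K : ℝ≥0∞) ^ (1 / q) := by
  rw [← ENNReal.rpow_le_rpow_iff hq, rpow_mul_rpow_one_div hq]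
  refine h.trans (le_of_eq ?_)
  rw [ENNReal.coe_mul, ENNReal.coe_rpow_of_nonneg _ hq.le]

theorem discreteConst_coe (p q r : ℝ) (hp : 0 < p) (hq : 0 < q) (hr : 0 < r) :
    ((4 ^ (q / r) * 2 ^ (q / p) * 2 : ℝ≥0) : ℝ≥0∞) = 4 ^ (q / r) * 2 ^ (q / p) * 2 := by
  push_cast [ENNReal.coe_rpow_of_nonneg _ (show 0 ≤ q / r by positivity),
    ENNReal.coe_rpow_of_nonneg _ (show 0 ≤ q / p by positivity)]
  rfl

theorem discreteChar_of_le (hp : 0 < p) (hpq : p ≤ q) (hr : 0 < r) (hr1 : r ≤ 1)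
    {A : EReal → (ℝ → ℝ≥0∞) → (ℝ → ℝ≥0∞) → WithBot ℤ → (ℤ → ℝ) → ℝ≥0∞}
    (hA : ∀ (a : ℝ) (b : EReal) (u v : ℝ → ℝ≥0∞) (N : WithBot ℤ) (x : ℤ → ℝ), IsGrid a b N x →
      A b u v N x =
        ⨆ k : Idx N, discreteNorm p r (cellV p r v x) k * tail b u (x k) ^ (1 / q)) :
    DiscreteChar p q r A := by
  have hq : 0 < q := hp.trans_le hpq
  refine ⟨max (4 ^ (q / r) * 2 ^ (q / p) * 2) 2, fun a b u v N x h hu hv => ?_⟩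
  rw [hA a b u v N x h]
  refine ⟨fun f hAt he => ?_, fun K hK => ?_⟩
  · have := discrete_upper_of_le (a := coef p x f) (y := cellV p r v x) (U := cellU u x)
      hr hp hpq he (ENNReal.rpow_ne_top_of_nonneg hq.le hAt) (fun k => by
        have h1 := h.lintegral_tail u k
        simp only [cellU]
        rw [← h1, ← rpow_mul_rpow_one_div hq]
        gcongr
        exact le_iSup (fun k : Idx N =>
          discreteNorm p r (cellV p r v x) k * tail b u (x k) ^ (1 / q)) k)
    refine this.trans ?_
    rw [← discreteConst_coe p q r hp hq hr]
    gcongr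
    exact le_max_left _ _
  · obtain ⟨h1, h2⟩ := discrete_of_hardyLHS_le h hp hq hr hr1 hu hv hK
    refine (iSup_le fun k => ?_).trans (mul_le_mul_left
      (ENNReal.coe_le_coe.2 (le_max_right _ _)) _)
    refine le_const_mul_of_rpow_le hq ?_
    have h3 := discrete_lower_of_le hr hp hq h1 h2 k
    have h4 := h.lintegral_tail u k
    simp only [cellU] at h3
    rwa [← h4, ← rpow_mul_rpow_one_div hq] at h3

theorem discreteChar_of_lt (hq : 0 < q) (hqp : q < p) (hr : 0 < r) (hr1 : r ≤ 1)
    {A : EReal → (ℝ → ℝ≥0∞) → (ℝ → ℝ≥0∞) → WithBot ℤ → (ℤ → ℝ) → ℝ≥0∞}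
    (hA : ∀ (a : ℝ) (b : EReal) (u v : ℝ → ℝ≥0∞) (N : WithBot ℤ) (x : ℤ → ℝ), IsGrid a b N x →
      A b u v N x = (∑' k : Idx N, cellU u x k * tail b u (x k) ^ (q / (p - q)) *
        discreteNorm p r (cellV p r v x) k ^ (p * q / (p - q))) ^ ((p - q) / (p * q))) :
    DiscreteChar p q r A := by
  have hp : 0 < p := hq.trans hqp
  have hd : 0 < p - q := sub_pos.2 hqp
  obtain ⟨c, hc⟩ := exists_discrete_lower hq hqp
  refine ⟨max (4 ^ (q / r) * 2 ^ (q / p) * 2) (c ^ ((p - q) / (p * q)) * 2),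
    fun a b u v N x h hu hv => ?_⟩
  set S := ∑' k : Idx N, cellU u x k * tail b u (x k) ^ (q / (p - q)) *
        discreteNorm p r (cellV p r v x) k ^ (p * q / (p - q)) with hS
  have hSeq : ∑' k : Idx N, discreteNorm p r (cellV p r v x) k ^ (p * q / (p - q)) *
      (∑' j : Set.Ici k, cellU u x (j : Idx N)) ^ (q / (p - q)) * cellU u x k = S := by
    refine tsum_congr fun k => ?_
    have h1 := h.lintegral_tail u k
    rw [h1]
    simp only [cellU]
    ring
  have hpow : 0 < (p - q) / (p * q) := by positivity
  rw [hA a b u v N x h, ← hS]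
  refine ⟨fun f hAt he => ?_, fun K hK => ?_⟩
  · have hSt : S ≠ ∞ := fun htop => hAt (by rw [htop, ENNReal.top_rpow_of_pos hpow])
    have := discrete_upper_of_lt (a := coef p x f) (y := cellV p r v x) (U := cellU u x)
      hr hq hqp he (by rwa [hSeq])
    rw [hSeq] at this
    refine this.trans ?_
    rw [← discreteConst_coe p q r hp hq hr, ← ENNReal.rpow_mul,
      show (p - q) / (p * q) * q = (p - q) / p by field_simp]
    gcongr
    exact le_max_left _ _
  · obtain ⟨h1, h2⟩ := discrete_of_hardyLHS_le h hp hq hr hr1 hu hv hK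
    have h3 := hc (Idx N) r _ _ _ hr h1 h2
    rw [hSeq] at h3
    calc S ^ ((p - q) / (p * q))
        ≤ (c * ((2 ^ q * K : ℝ≥0) : ℝ≥0∞) ^ (p / (p - q))) ^ ((p - q) / (p * q)) := by gcongr
      _ = ((c ^ ((p - q) / (p * q)) * 2 : ℝ≥0) : ℝ≥0∞) * (K : ℝ≥0∞) ^ (1 / q) := by
          rw [ENNReal.mul_rpow_of_nonneg _ _ hpow.le, ← ENNReal.rpow_mul,
            show p / (p - q) * ((p - q) / (p * q)) = 1 / q by field_simp,
            ENNReal.coe_mul, ENNReal.mul_rpow_of_nonneg _ _ (by positivity),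
            ENNReal.coe_rpow_of_nonneg _ hq.le, ← ENNReal.rpow_mul, mul_one_div_cancel hq.ne',
            ENNReal.rpow_one, ENNReal.coe_mul, ENNReal.coe_rpow_of_nonneg _ hpow.le]
          ring
      _ ≤ _ := by
          gcongr
          exact le_max_right _ _

/-- For `p ≤ r` the norm up to `k` is the supremum of the terms with `i ≤ k`. As the tail of `u`
decreases, moving from `k` back to `i` only increases the product, so the double supremum collapses
to the diagonal. -/
theorem discreteChar_A₁ (hp : 0 < p) (hpq : p ≤ q) (hr : 0 < r) (hr1 : r ≤ 1) (hpr : p ≤ r) :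
    DiscreteChar p q r (A₁ p q r) := by
  have hq : 0 < q := hp.trans_le hpq
  refine discreteChar_of_le hp hpq hr hr1 fun a b u v N x h => ?_
  rw [A₁]
  refine le_antisymm (iSup_mono fun k => ?_) (iSup_le fun k => ?_)
  · rw [discreteNorm, if_neg (not_lt.2 hpr)]
    gcongr
    exact le_iSup (fun i : Set.Iic k => cellV p r v x (i : Idx N)) ⟨k, Set.self_mem_Iic⟩
  · rw [discreteNorm, if_neg (not_lt.2 hpr), ENNReal.iSup_mul]
    refine iSup_le fun i => ?_
    refine le_trans ?_ (le_iSup (fun k : Idx N => (2 : ℝ≥0∞) ^ ((k : ℝ) / p) *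
      V r v (x (k - 1)) (x k) * tail b u (x k) ^ (1 / q)) (i : Idx N))
    rw [cellV]
    refine mul_le_mul_right (ENNReal.rpow_le_rpow ?_ (by positivity)) _
    exact lintegral_mono_set (show interval (x k) b ⊆ interval (x (i : Idx N)) b from
      fun t ht => ⟨(h.mono i.1.2.le i.2).trans_lt ht.1, ht.2⟩)

theorem discreteChar_A₂ (hp : 0 < p) (hpq : p ≤ q) (hr : 0 < r) (hr1 : r ≤ 1) (hrp : r < p) :
    DiscreteChar p q r (A₂ p q r) := by
  refine discreteChar_of_le hp hpq hr hr1 fun a b u v N x h => ?_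
  rw [A₂]
  refine iSup_congr fun k => ?_
  rw [discreteNorm_eq_of_lt hr hrp, mul_comm]

theorem discreteChar_A₃ (hq : 0 < q) (hqp : q < p) (hr : 0 < r) (hr1 : r ≤ 1) (hpr : p ≤ r) :
    DiscreteChar p q r (A₃ p q r) := by
  have hp : 0 < p := hq.trans hqp
  have hd : 0 < p - q := sub_pos.2 hqp
  refine discreteChar_of_lt hq hqp hr hr1 fun a b u v N x h => ?_
  rw [A₃]
  congr 1
  refine tsum_congr fun k => ?_
  rw [discreteNorm_rpow_eq_of_le hpr (by positivity),
    show p * q / (p - q) / p = q / (p - q) by field_simp, cellU]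

theorem discreteChar_A₄ (hq : 0 < q) (hqp : q < p) (hr : 0 < r) (hr1 : r ≤ 1) (hrp : r < p) :
    DiscreteChar p q r (A₄ p q r) := by
  have hp : 0 < p := hq.trans hqp
  have hd : 0 < p - q := sub_pos.2 hqp
  have hd' : 0 < p - r := sub_pos.2 hrp
  refine discreteChar_of_lt hq hqp hr hr1 fun a b u v N x h => ?_
  rw [A₄]
  congr 1
  refine tsum_congr fun k => ?_
  rw [discreteNorm_eq_of_lt hr hrp, ← ENNReal.rpow_mul,
    show (p - r) / (p * r) * (p * q / (p - q)) = q * (p - r) / (r * (p - q)) by field_simp, cellU]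

end DiscreteQuantities

/-! ### The local quantities -/

section LocalQuantities

variable {p q r a : ℝ} {b : EReal} {u v f : ℝ → ℝ≥0∞} {N : WithBot ℤ} {x : ℤ → ℝ}

theorem mul_lintegral_rpow_eq (hp : 0 < p) (hq : 0 < q) (T : ℝ≥0∞) (k : Idx N) :
    T * (∫⁻ s in Set.Ioo (x (k - 1)) (x k), f s) ^ q =
      ((2 : ℝ≥0∞) ^ ((k : ℝ) * q / p) * T) * (coef p x f k ^ p) ^ (q / p) := by
  rw [← ENNReal.rpow_mul, mul_div_cancel₀ _ hp.ne', coef, ENNReal.mul_rpow_of_nonneg _ _ hq.le,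
    ← ENNReal.rpow_mul, mul_right_comm, ← mul_assoc ((2 : ℝ≥0∞) ^ ((k : ℝ) * q / p)),
    ← two_rpow_add, show (k : ℝ) * q / p + -((k : ℝ) / p) * q = 0 by ring, ENNReal.rpow_zero,
    one_mul, mul_comm]

theorem tsum_localHardy_le_of_le (hp : 0 < p) (hpq : p ≤ q) {T : Idx N → ℝ≥0∞} {c S : ℝ≥0∞}
    (hT : ∀ k : Idx N, localHardy q r u v f (x (k - 1)) (x k) ≤
      c * (T k * (∫⁻ s in Set.Ioo (x (k - 1)) (x k), f s) ^ q))
    (hS : ∀ k : Idx N, (2 : ℝ≥0∞) ^ ((k : ℝ) * q / p) * T k ≤ S) :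
    ∑' k : Idx N, localHardy q r u v f (x (k - 1)) (x k) ≤
      c * (S * (∑' k : Idx N, coef p x f k ^ p) ^ (q / p)) := by
  have hq : 0 < q := hp.trans_le hpq
  calc ∑' k : Idx N, localHardy q r u v f (x (k - 1)) (x k)
      ≤ ∑' k : Idx N, c * (S * (coef p x f k ^ p) ^ (q / p)) := by
        refine ENNReal.tsum_le_tsum fun k => (hT k).trans ?_
        rw [mul_lintegral_rpow_eq hp hq]
        gcongr
        exact hS k
    _ ≤ _ := by
        rw [ENNReal.tsum_mul_left, ENNReal.tsum_mul_left]
        gcongr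
        exact tsum_rpow_le_rpow_tsum _ ((one_le_div hp).2 hpq)

theorem tsum_localHardy_le_of_lt (hq : 0 < q) (hqp : q < p) {T : Idx N → ℝ≥0∞} {c : ℝ≥0∞}
    (hT : ∀ k : Idx N, localHardy q r u v f (x (k - 1)) (x k) ≤
      c * (T k * (∫⁻ s in Set.Ioo (x (k - 1)) (x k), f s) ^ q)) :
    ∑' k : Idx N, localHardy q r u v f (x (k - 1)) (x k) ≤
      c * ((∑' k : Idx N, ((2 : ℝ≥0∞) ^ ((k : ℝ) * q / p) * T k) ^ (p / (p - q))) ^ ((p - q) / p) *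
        (∑' k : Idx N, coef p x f k ^ p) ^ (q / p)) := by
  have hp : 0 < p := hq.trans hqp
  have hd : 0 < p - q := sub_pos.2 hqp
  calc ∑' k : Idx N, localHardy q r u v f (x (k - 1)) (x k)
      ≤ ∑' k : Idx N, c *
          ((((2 : ℝ≥0∞) ^ ((k : ℝ) * q / p) * T k) ^ (p / (p - q))) ^ ((p - q) / p) *
          (coef p x f k ^ p) ^ (q / p)) := by
        refine ENNReal.tsum_le_tsum fun k => (hT k).trans ?_
        rw [mul_lintegral_rpow_eq hp hq, ← ENNReal.rpow_mul _ (p / (p - q)),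
          div_mul_div_cancel₀ hd.ne', div_self hp.ne', ENNReal.rpow_one]
    _ ≤ _ := by
        rw [ENNReal.tsum_mul_left]
        gcongr
        exact tsum_rpow_mul_rpow_le _ _ (by positivity) (by positivity) (by field_simp; ring)

theorem lintegral_cell_ne_top (hp : 0 < p) (he : ∑' k : Idx N, coef p x f k ^ p ≠ ∞) (k : Idx N) :
    ∫⁻ s in Set.Ioo (x (k - 1)) (x k), f s ≠ ∞ := by
  intro htop
  have := ENNReal.ne_top_of_tsum_ne_top he k
  rw [coef, htop, ENNReal.mul_top (two_rpow_ne_zero _), ENNReal.top_rpow_of_pos hp] at this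
  exact this rfl

theorem localHardy_le_localConst {y z : ℝ} {g : ℝ → ℝ≥0∞} (hg : Measurable g)
    (hg1 : ∫⁻ s in Set.Ioo y z, g s ≤ 1) :
    localHardy q r u v g y z ≤ localConst q r u v y z :=
  le_iSup₂ (f := fun (g : ℝ → ℝ≥0∞) (_ : Measurable g ∧ ∫⁻ s in Set.Ioo y z, g s ≤ 1) =>
    localHardy q r u v g y z) g ⟨hg, hg1⟩

theorem rpow_V_mul_le_localConst (h : IsGrid a b N x) (hr : 0 < r) (hr1 : r ≤ 1) (hq : 0 < q)
    (hu : IsWeight a b u) (hv : IsWeight a b v) (k : Idx N)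
    (hfin : localConst q r u v (x (k - 1)) (x k) ≠ ∞) {t : ℝ}
    (ht : t ∈ Set.Ioo (x (k - 1)) (x k)) :
    V r v (x (k - 1)) t ^ q * ∫⁻ s in Set.Ioo t (x k), u s ≤
      localConst q r u v (x (k - 1)) (x k) := by
  have := rpow_V_mul_le_of_localHardy_le hr hr1 hq (hu.1.mono_measure (h.restrict_le k))
    (hv.1.mono_measure (h.restrict_le k))
    (ae_mono (h.restrict_le k) (hv.2.mono fun s hs => hs.2.ne))
    (K := (localConst q r u v (x (k - 1)) (x k)).toNNReal)
    (fun g hg hg1 => by rw [ENNReal.coe_toNNReal hfin]; exact localHardy_le_localConst hg hg1) ht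
  rwa [ENNReal.coe_toNNReal hfin] at this

theorem localConst_ne_top (h : IsGrid a b N x) (hp : 0 < p) (hq : 0 < q) (hr : 0 < r) {K : ℝ≥0}
    (hK : ∀ f : ℝ → ℝ≥0∞, Measurable f → ∑' k : Idx N, coef p x f k ^ p ≤ 1 →
      hardyLHS q r a b u v f ≤ K) (k : Idx N) :
    localConst q r u v (x (k - 1)) (x k) ≠ ∞ := by
  intro htop
  have := localConst_le h hp hq hr hK k
  rw [htop, ENNReal.mul_top (two_rpow_ne_zero _)] at this
  exact ENNReal.coe_ne_top (top_le_iff.1 this)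

/-- The integral over the `k`-th cell occurring in `B₂` and `B₃`. -/
noncomputable def cellInt (q r : ℝ) (u v : ℝ → ℝ≥0∞) (y z : ℝ) : ℝ≥0∞ :=
  ∫⁻ t in Set.Ioo y z, (∫⁻ s in Set.Ioo t z, u s) ^ (q / (1 - q)) * u t *
    V r v y t ^ (q / (1 - q))

/-- The constant precedes the cell in the quantifiers, so that it survives summation over all cells.
-/
theorem exists_cellInt_le_localConst (hq : 0 < q) (hq1 : q < 1) :
    ∃ c : ℝ≥0, ∀ (r a : ℝ) (b : EReal) (u v : ℝ → ℝ≥0∞) (N : WithBot ℤ) (x : ℤ → ℝ),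
      0 < r → r ≤ 1 → IsGrid a b N x → IsWeight a b u → IsWeight a b v → ∀ k : Idx N,
      localConst q r u v (x (k - 1)) (x k) ≠ ∞ →
      cellInt q r u v (x (k - 1)) (x k) ≤
        c * localConst q r u v (x (k - 1)) (x k) ^ (1 / (1 - q)) := by
  obtain ⟨c, hc⟩ := exists_local_lower hq hq1
  refine ⟨c, fun r a b u v N x hr hr1 h hu hv k hfin => ?_⟩
  have := hc r u v (x (k - 1)) (x k) (localConst q r u v (x (k - 1)) (x k)).toNNReal hr hr1
    (hu.1.mono_measure (h.restrict_le k)) (hv.1.mono_measure (h.restrict_le k))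
    (ae_mono (h.restrict_le k) (hv.2.mono fun s hs => hs.2.ne))
    (fun g hg hg1 => by rw [ENNReal.coe_toNNReal hfin]; exact localHardy_le_localConst hg hg1)
  rwa [ENNReal.coe_toNNReal hfin] at this

theorem localConst_coe (q r : ℝ) (hq : 0 < q) (hr : 0 < r) :
    ((4 ^ (q / r) * 2 ^ q * 2 : ℝ≥0) : ℝ≥0∞) = 4 ^ (q / r) * 2 ^ q * 2 := by
  push_cast [ENNReal.coe_rpow_of_nonneg _ (show 0 ≤ q / r by positivity),
    ENNReal.coe_rpow_of_nonneg _ hq.le]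
  rfl

theorem two_rpow_mul_rpow_one_div_le (hq : 0 < q) {β K : ℝ≥0∞} {k : ℝ}
    (h : (2 : ℝ≥0∞) ^ (k * q / p) * β ≤ K) : (2 : ℝ≥0∞) ^ (k / p) * β ^ (1 / q) ≤ K ^ (1 / q) := by
  refine le_trans (le_of_eq ?_) (ENNReal.rpow_le_rpow h (by positivity))
  rw [ENNReal.mul_rpow_of_nonneg _ _ (by positivity), ← ENNReal.rpow_mul]
  congr 2; field_simp

theorem two_rpow_mul_rpow (hq : 0 < q) (T : ℝ≥0∞) {s : ℝ} :
    ((2 : ℝ≥0∞) ^ (s / p) * T) ^ q = (2 : ℝ≥0∞) ^ (s * q / p) * T ^ q := by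
  rw [ENNReal.mul_rpow_of_nonneg _ _ hq.le, ← ENNReal.rpow_mul]
  congr 2; ring

theorem localChar_B₁ (hp : 0 < p) (hpq : p ≤ q) (hr : 0 < r) (hr1 : r ≤ 1) (hq1 : 1 ≤ q) :
    LocalChar p q r (B₁ p q r) := by
  have hq : 0 < q := hp.trans_le hpq
  refine ⟨max (4 ^ (q / r) * 2 ^ q * 2) 1, fun a b u v N x h hu hv =>
    ⟨fun f hf hB he => ?_, fun K hK => ?_⟩⟩
  · set β : Idx N → ℝ≥0∞ := fun k =>
      essSup (fun t => (∫⁻ s in Set.Ioo t (x k), u s) ^ (1 / q) * V r v (x (k - 1)) t)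
        (volume.restrict (Set.Ioo (x (k - 1)) (x k))) with hβ
    have hβB : ∀ k : Idx N, (2 : ℝ≥0∞) ^ ((k : ℝ) / p) * β k ≤ B₁ p q r u v N x := fun k =>
      le_iSup (fun k : Idx N => (2 : ℝ≥0∞) ^ ((k : ℝ) / p) * β k) k
    have hβt : ∀ k, β k ≠ ∞ := fun k htop => by
      have := hβB k
      rw [htop, ENNReal.mul_top (two_rpow_ne_zero _)] at this
      exact hB (top_le_iff.1 this)
    refine (tsum_localHardy_le_of_le (T := fun k => β k ^ q) (c := 4 ^ (q / r) * 2 ^ q * 2)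
      (S := B₁ p q r u v N x ^ q) hp hpq (fun k => ?_) fun k => ?_).trans ?_
    · refine localHardy_le_of_le hr hr1 hq1 (hu.1.mono_measure (h.restrict_le k))
        (hv.1.mono_measure (h.restrict_le k)) (hf.mono_measure (h.restrict_le k))
        (lintegral_cell_ne_top hp he k) (ENNReal.rpow_ne_top_of_nonneg hq.le (hβt k)) ?_
      filter_upwards [ENNReal.ae_le_essSup (μ := volume.restrict (Set.Ioo (x (k - 1)) (x k)))
        (fun t => (∫⁻ s in Set.Ioo t (x k), u s) ^ (1 / q) * V r v (x (k - 1)) t)] with t ht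
      rw [← rpow_mul_rpow_one_div hq, mul_comm]
      gcongr
    · rw [← two_rpow_mul_rpow hq]
      gcongr
      exact hβB k
    · rw [← localConst_coe q r hq hr]
      gcongr
      exact le_max_left _ _
  · have h1 : B₁ p q r u v N x ≤ (K : ℝ≥0∞) ^ (1 / q) := by
      refine iSup_le fun k => ?_
      refine le_trans ?_ (two_rpow_mul_rpow_one_div_le hq (localConst_le h hp hq hr hK k))
      gcongr
      refine essSup_le_of_ae_le _ ?_
      filter_upwards [ae_restrict_mem measurableSet_Ioo] with t ht
      have h2 := rpow_V_mul_le_localConst h hr hr1 hq hu hv k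
        (localConst_ne_top h hp hq hr hK k) ht
      rw [← rpow_mul_rpow_one_div hq, mul_comm] at h2
      rwa [one_div, ENNReal.le_rpow_inv_iff hq, ← one_div]
    refine h1.trans (le_mul_of_one_le_left' ?_)
    exact_mod_cast le_max_right _ _

theorem localChar_B₂ (hp : 0 < p) (hpq : p ≤ q) (hr : 0 < r) (hr1 : r ≤ 1) (hq1 : q < 1) :
    LocalChar p q r (B₂ p q r) := by
  have hq : 0 < q := hp.trans_le hpq
  have hd : 0 < 1 - q := sub_pos.2 hq1
  have hs : 0 < (1 - q) / q := by positivity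
  obtain ⟨c, hc⟩ := exists_cellInt_le_localConst hq hq1
  refine ⟨max (4 ^ (q / r) * 2 ^ q * 2) (c ^ ((1 - q) / q)), fun a b u v N x h hu hv =>
    ⟨fun f hf hB he => ?_, fun K hK => ?_⟩⟩
  · set Z : Idx N → ℝ≥0∞ := fun k => cellInt q r u v (x (k - 1)) (x k) with hZ
    have hZB : ∀ k : Idx N, (2 : ℝ≥0∞) ^ ((k : ℝ) / p) * Z k ^ ((1 - q) / q) ≤ B₂ p q r u v N x :=
      fun k => le_iSup (fun k : Idx N => (2 : ℝ≥0∞) ^ ((k : ℝ) / p) * Z k ^ ((1 - q) / q)) k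
    have hZt : ∀ k, Z k ≠ ∞ := fun k htop => by
      have := hZB k
      rw [htop, ENNReal.top_rpow_of_pos hs, ENNReal.mul_top (two_rpow_ne_zero _)] at this
      exact hB (top_le_iff.1 this)
    refine (tsum_localHardy_le_of_le (T := fun k => Z k ^ (1 - q)) (c := 4 ^ (q / r) * 2 ^ q * 2)
      (S := B₂ p q r u v N x ^ q) hp hpq (fun k => ?_) fun k => ?_).trans ?_
    · exact localHardy_le_of_lt hr hr1 hq hq1 (hu.1.mono_measure (h.restrict_le k))
        (hv.1.mono_measure (h.restrict_le k)) (hf.mono_measure (h.restrict_le k))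
        (lintegral_cell_ne_top hp he k) (hZt k)
    · have : Z k ^ (1 - q) = (Z k ^ ((1 - q) / q)) ^ q := by
        rw [← ENNReal.rpow_mul, div_mul_cancel₀ _ hq.ne']
      simp only [this]
      rw [← two_rpow_mul_rpow hq]
      gcongr
      exact hZB k
    · rw [← localConst_coe q r hq hr]
      gcongr
      exact le_max_left _ _
  · refine iSup_le fun k => ?_
    have h1 := hc r a b u v N x hr hr1 h hu hv k (localConst_ne_top h hp hq hr hK k)
    calc (2 : ℝ≥0∞) ^ ((k : ℝ) / p) * cellInt q r u v (x (k - 1)) (x k) ^ ((1 - q) / q)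
        ≤ (2 : ℝ≥0∞) ^ ((k : ℝ) / p) *
            (c * localConst q r u v (x (k - 1)) (x k) ^ (1 / (1 - q))) ^ ((1 - q) / q) := by
          gcongr
      _ = (c ^ ((1 - q) / q) : ℝ≥0) *
            ((2 : ℝ≥0∞) ^ ((k : ℝ) / p) * localConst q r u v (x (k - 1)) (x k) ^ (1 / q)) := by
          rw [ENNReal.mul_rpow_of_nonneg _ _ hs.le, ← ENNReal.rpow_mul,
            show 1 / (1 - q) * ((1 - q) / q) = 1 / q by field_simp,
            ENNReal.coe_rpow_of_nonneg _ hs.le]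
          ring
      _ ≤ _ := by
          gcongr
          · exact le_max_right _ _
          · exact two_rpow_mul_rpow_one_div_le hq (localConst_le h hp hq hr hK k)

theorem two_rpow_mul_rpow_div (hq : 0 < q) (hqp : q < p) (s : ℝ) (T : ℝ≥0∞) :
    ((2 : ℝ≥0∞) ^ (s * q / p) * T) ^ (p / (p - q)) =
      (2 : ℝ≥0∞) ^ (s * (q / (p - q))) * T ^ (p / (p - q)) := by
  have hp : 0 < p := hq.trans hqp
  have hd : 0 < p - q := sub_pos.2 hqp
  rw [ENNReal.mul_rpow_of_nonneg _ _ (by positivity), ← ENNReal.rpow_mul]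
  congr 2; field_simp

/-- Common summation step for `q < p`: when `T` is two-sidedly comparable to the local constant of
each cell, Hölder gives the upper bound and the dual form of the glued inequality gives the lower
one. -/
theorem localChar_of_lt (hq : 0 < q) (hqp : q < p) (hr : 0 < r) (c₁ c₂ : ℝ≥0)
    {B : (ℝ → ℝ≥0∞) → (ℝ → ℝ≥0∞) → WithBot ℤ → (ℤ → ℝ) → ℝ≥0∞}
    {T : (ℝ → ℝ≥0∞) → (ℝ → ℝ≥0∞) → ℝ → ℝ → ℝ≥0∞}
    (hB : ∀ u v N x, B u v N x = (∑' k : Idx N, (2 : ℝ≥0∞) ^ ((k : ℝ) * (q / (p - q))) *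
      T u v (x (k - 1)) (x k) ^ (p / (p - q))) ^ ((p - q) / (p * q)))
    (hup : ∀ (a : ℝ) (b : EReal) (u v f : ℝ → ℝ≥0∞) (N : WithBot ℤ) (x : ℤ → ℝ),
      IsGrid a b N x → IsWeight a b u → IsWeight a b v →
      AEMeasurable f (volume.restrict (interval a b)) → ∀ k : Idx N,
      ∫⁻ s in Set.Ioo (x (k - 1)) (x k), f s ≠ ∞ → T u v (x (k - 1)) (x k) ≠ ∞ →
      localHardy q r u v f (x (k - 1)) (x k) ≤
        c₁ * (T u v (x (k - 1)) (x k) * (∫⁻ s in Set.Ioo (x (k - 1)) (x k), f s) ^ q))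
    (hlow : ∀ (a : ℝ) (b : EReal) (u v : ℝ → ℝ≥0∞) (N : WithBot ℤ) (x : ℤ → ℝ),
      IsGrid a b N x → IsWeight a b u → IsWeight a b v → ∀ k : Idx N,
      localConst q r u v (x (k - 1)) (x k) ≠ ∞ →
      T u v (x (k - 1)) (x k) ≤ c₂ * localConst q r u v (x (k - 1)) (x k)) :
    LocalChar p q r B := by
  have hp : 0 < p := hq.trans hqp
  have hd : 0 < p - q := sub_pos.2 hqp
  have hs : 0 < (p - q) / (p * q) := by positivity
  have hκ : 0 < p / (p - q) := by positivity
  refine ⟨max c₁ ((c₂ * 2) ^ (1 / q)), fun a b u v N x h hu hv => ?_⟩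
  rw [hB]
  set S := ∑' k : Idx N, (2 : ℝ≥0∞) ^ ((k : ℝ) * (q / (p - q))) *
      T u v (x (k - 1)) (x k) ^ (p / (p - q)) with hS
  refine ⟨fun f hf hBt he => ?_, fun K hK => ?_⟩
  · have hSt : S ≠ ∞ := fun htop => hBt (by rw [htop, ENNReal.top_rpow_of_pos hs])
    have hTt : ∀ k : Idx N, T u v (x (k - 1)) (x k) ≠ ∞ := fun k htop => by
      have := ENNReal.ne_top_of_tsum_ne_top hSt k
      rw [htop, ENNReal.top_rpow_of_pos hκ, ENNReal.mul_top (two_rpow_ne_zero _)] at this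
      exact this rfl
    refine (tsum_localHardy_le_of_lt hq hqp fun k =>
      hup a b u v f N x h hu hv hf k (lintegral_cell_ne_top hp he k) (hTt k)).trans ?_
    simp only [two_rpow_mul_rpow_div hq hqp]
    rw [← hS, ← ENNReal.rpow_mul, show (p - q) / (p * q) * q = (p - q) / p by field_simp]
    gcongr
    exact le_max_left _ _
  · have h1 : S ≤ (c₂ : ℝ≥0∞) ^ (p / (p - q)) * (2 * (K : ℝ≥0∞)) ^ (p / (p - q)) := by
      refine le_trans ?_ (mul_le_mul_right (tsum_localConst_le h hq hqp hr hK) _)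
      rw [← ENNReal.tsum_mul_left]
      refine ENNReal.tsum_le_tsum fun k => ?_
      rw [← two_rpow_mul_rpow_div hq hqp, ← ENNReal.mul_rpow_of_nonneg _ _ hκ.le, mul_left_comm]
      gcongr
      exact hlow a b u v N x h hu hv k (localConst_ne_top h hp hq hr hK k)
    calc S ^ ((p - q) / (p * q))
        ≤ ((c₂ : ℝ≥0∞) ^ (p / (p - q)) * (2 * (K : ℝ≥0∞)) ^ (p / (p - q))) ^
            ((p - q) / (p * q)) := by gcongr
      _ = (((c₂ * 2) ^ (1 / q) : ℝ≥0) : ℝ≥0∞) * (K : ℝ≥0∞) ^ (1 / q) := by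
          rw [← ENNReal.mul_rpow_of_nonneg _ _ hκ.le, ← ENNReal.rpow_mul,
            show p / (p - q) * ((p - q) / (p * q)) = 1 / q by field_simp, ← mul_assoc,
            ENNReal.mul_rpow_of_nonneg _ _ (by positivity),
            ENNReal.coe_rpow_of_nonneg _ (by positivity), ENNReal.coe_mul, ENNReal.coe_ofNat]
      _ ≤ _ := by
          gcongr
          exact le_max_right _ _

theorem localChar_B₃ (hq : 0 < q) (hqp : q < p) (hr : 0 < r) (hr1 : r ≤ 1) (hq1 : q < 1) :
    LocalChar p q r (B₃ p q r) := by
  have hp : 0 < p := hq.trans hqp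
  have hd : 0 < p - q := sub_pos.2 hqp
  have hd1 : 0 < 1 - q := sub_pos.2 hq1
  obtain ⟨c, hc⟩ := exists_cellInt_le_localConst hq hq1
  refine localChar_of_lt hq hqp hr (4 ^ (q / r) * 2 ^ q * 2) (c ^ (1 - q))
    (T := fun u v y z => cellInt q r u v y z ^ (1 - q)) (fun u v N x => ?_)
    (fun a b u v f N x h hu hv hf k hfin hT => ?_) fun a b u v N x h hu hv k hfin => ?_
  · rw [B₃]
    congr 1
    refine tsum_congr fun k => ?_
    rw [← ENNReal.rpow_mul, show (1 - q) * (p / (p - q)) = p * (1 - q) / (p - q) by ring, cellInt]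
  · rw [localConst_coe q r hq hr]
    refine localHardy_le_of_lt hr hr1 hq hq1 (hu.1.mono_measure (h.restrict_le k))
        (hv.1.mono_measure (h.restrict_le k)) (hf.mono_measure (h.restrict_le k)) hfin ?_
    intro htop
    refine hT ?_
    simp only [cellInt]
    rw [htop, ENNReal.top_rpow_of_pos hd1]
  · refine (ENNReal.rpow_le_rpow (hc r a b u v N x hr hr1 h hu hv k hfin) hd1.le).trans
      (le_of_eq ?_)
    rw [ENNReal.mul_rpow_of_nonneg _ _ hd1.le, ← ENNReal.rpow_mul, one_div_mul_cancel hd1.ne',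
      ENNReal.rpow_one, ENNReal.coe_rpow_of_nonneg _ hd1.le]

/-- Taking the power `(p - q) / p` of the essential supremum makes `T` the optimal bound for `V ^ q`
times the integral of `u`, as the local estimate for `q ≥ 1` requires. -/
theorem localChar_B₄ (hq1 : 1 ≤ q) (hqp : q < p) (hr : 0 < r) (hr1 : r ≤ 1) :
    LocalChar p q r (B₄ p q r) := by
  have hq : 0 < q := by linarith
  have hp : 0 < p := hq.trans hqp
  have hd : 0 < p - q := sub_pos.2 hqp
  have hκ : 0 < (p - q) / p := by positivity
  have hpow : ∀ U W : ℝ≥0∞,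
      U ^ (p / (p - q)) * W ^ (p * q / (p - q)) = (W ^ q * U) ^ (p / (p - q)) := by
    intro U W
    rw [ENNReal.mul_rpow_of_nonneg _ _ (by positivity), ← ENNReal.rpow_mul, mul_comm]
    congr 2; ring
  have hinv : (p - q) / p = (p / (p - q))⁻¹ := (inv_div _ _).symm
  refine localChar_of_lt hq hqp hr (4 ^ (q / r) * 2 ^ q * 2) 1
    (T := fun u v y z => essSup (fun t => (∫⁻ s in Set.Ioo t z, u s) ^ (p / (p - q)) *
      V r v y t ^ (p * q / (p - q))) (volume.restrict (Set.Ioo y z)) ^ ((p - q) / p))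
    (fun u v N x => ?_)
    (fun a b u v f N x h hu hv hf k hfin hT => ?_) fun a b u v N x h hu hv k hfin => ?_
  · rw [B₄]
    congr 1
    refine tsum_congr fun k => ?_
    rw [← ENNReal.rpow_mul, div_mul_div_cancel₀ hp.ne', div_self hd.ne', ENNReal.rpow_one]
  · rw [localConst_coe q r hq hr]
    refine localHardy_le_of_le hr hr1 hq1 (hu.1.mono_measure (h.restrict_le k))
        (hv.1.mono_measure (h.restrict_le k)) (hf.mono_measure (h.restrict_le k)) hfin hT ?_
    filter_upwards [ENNReal.ae_le_essSup (μ := volume.restrict (Set.Ioo (x (k - 1)) (x k)))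
      (fun t => (∫⁻ s in Set.Ioo t (x k), u s) ^ (p / (p - q)) *
        V r v (x (k - 1)) t ^ (p * q / (p - q)))] with t ht
    rw [hinv, ENNReal.le_rpow_inv_iff (by positivity), ← hpow]
    exact ht
  · rw [ENNReal.coe_one, one_mul, hinv, ENNReal.rpow_inv_le_iff (by positivity)]
    refine essSup_le_of_ae_le _ ?_
    filter_upwards [ae_restrict_mem measurableSet_Ioo] with t ht
    rw [hpow]
    gcongr
    exact rpow_V_mul_le_localConst h hr hr1 hq hu hv k hfin ht

end LocalQuantities

/-! ### Assembly -/

theorem CharacterizedBy.mono {p q r a : ℝ} {b : EReal} {u v w : ℝ → ℝ≥0∞} {c c' : ℝ≥0}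
    {A B : ℝ≥0∞} (h : CharacterizedBy p q r a b u v w c A B) (hc : c ≤ c') :
    CharacterizedBy p q r a b u v w c' A B := by
  have hc' : (c : ℝ≥0∞) ≤ c' := ENNReal.coe_le_coe.2 hc
  exact ⟨h.1, h.2.1.trans (mul_le_mul_left hc' _), h.2.2.trans (mul_le_mul_left hc' _)⟩

theorem characterizedBy_of_mainInequality {p q r a : ℝ} {b : EReal} {u v w : ℝ → ℝ≥0∞}
    {c₁ c₂ : ℝ≥0} {A B : ℝ≥0∞} (h0 : 0 < c₁)
    (hup : ∀ C : ℝ≥0, 0 < C → c₁ * (A + B) ≤ C → MainInequality p q r a b u v w C)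
    (hlow : ∀ C : ℝ≥0, MainInequality p q r a b u v w C → A + B ≤ c₂ * C) :
    CharacterizedBy p q r a b u v w (c₁ + c₂) A B := by
  have hmax : max A B < ∞ ↔ A + B ≠ ∞ := by
    rw [max_lt_iff, ENNReal.add_ne_top, lt_top_iff_ne_top, lt_top_iff_ne_top]
  refine ⟨⟨fun ⟨C, _, hC⟩ => hmax.2 ?_, fun h => ?_⟩, ?_, ?_⟩
  · exact ne_top_of_le_ne_top (ENNReal.mul_ne_top ENNReal.coe_ne_top ENNReal.coe_ne_top) (hlow C hC)
  · have hfin : (c₁ : ℝ≥0∞) * (A + B) ≠ ∞ := ENNReal.mul_ne_top ENNReal.coe_ne_top (hmax.1 h)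
    refine ⟨((c₁ : ℝ≥0∞) * (A + B)).toNNReal + 1, by positivity, hup _ (by positivity) ?_⟩
    rw [ENNReal.coe_add, ENNReal.coe_toNNReal hfin]
    exact le_self_add
  · refine le_trans ?_ (mul_le_mul_left (ENNReal.coe_le_coe.2 (le_add_right (le_refl c₁))) _)
    -- Admissible constants are positive while `A + B` may be zero, hence the added `ε`.
    refine ENNReal.le_of_forall_pos_le_add fun ε hε hlt => ?_
    have heq : ((((c₁ : ℝ≥0∞) * (A + B)).toNNReal + ε : ℝ≥0) : ℝ≥0∞) = c₁ * (A + B) + ε := by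
      rw [ENNReal.coe_add, ENNReal.coe_toNNReal hlt.ne]
    rw [← heq]
    have hpos : 0 < ((c₁ : ℝ≥0∞) * (A + B)).toNNReal + ε := by positivity
    exact iInf₂_le _ ⟨hpos, hup _ hpos (by rw [heq]; exact le_self_add)⟩
  · have hcpos : (((c₁ + c₂ : ℝ≥0) : ℝ≥0∞)) ≠ 0 :=
      ENNReal.coe_ne_zero.2 (add_pos_of_pos_of_nonneg h0 zero_le).ne'
    rw [mul_comm, ← ENNReal.div_le_iff hcpos ENNReal.coe_ne_top]
    refine le_iInf₂ fun C hC => ?_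
    rw [ENNReal.div_le_iff hcpos ENNReal.coe_ne_top, mul_comm]
    exact (hlow C hC.2).trans (mul_le_mul_left (ENNReal.coe_le_coe.2 (le_add_left (le_refl c₂))) _)

/-- The equivalence constant does not depend on the interval, the weights, or the grid. -/
theorem exists_characterizedBy {p q r : ℝ}
    {A : EReal → (ℝ → ℝ≥0∞) → (ℝ → ℝ≥0∞) → WithBot ℤ → (ℤ → ℝ) → ℝ≥0∞}
    {B : (ℝ → ℝ≥0∞) → (ℝ → ℝ≥0∞) → WithBot ℤ → (ℤ → ℝ) → ℝ≥0∞}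
    (hp : 0 < p) (hq : 0 < q) (hr : 0 < r) (hr1 : r ≤ 1) (D : ℝ≥0)
    (hA : DiscreteChar p q r A) (hB : LocalChar p q r B) :
    ∃ c : ℝ≥0, ∀ (a : ℝ) (b : EReal) (u v w : ℝ → ℝ≥0∞) (N : WithBot ℤ) (x : ℤ → ℝ),
      IsWeight a b u → IsWeight a b v → IsWeight a b w →
      (∀ y ∈ interval a b, 0 < tail b w y ∧ tail b w y < ∞) → IsDiscretizing a b w D N x →
      CharacterizedBy p q r a b u v w c (A b u v N x) (B u v N x) := by
  obtain ⟨cA, hA⟩ := hA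
  obtain ⟨cB, hB⟩ := hB
  obtain ⟨c₁, h₁⟩ := exists_energy_le hp D
  obtain ⟨c₂, h₂⟩ := exists_le_energy hp D
  obtain ⟨M, hM⟩ : ∃ M : ℝ≥0, M = 2 ^ (q / r) * (cA + cB) := ⟨_, rfl⟩
  -- The summand 1 keeps the upper constant positive, so that its product with `A + B` being finite
  -- forces `A + B` to be finite.
  refine ⟨(M ^ (1 / q) * c₁ ^ (1 / p) + 1) + (cA + cB) * c₂ ^ (1 / p),
    fun a b u v w N x hu hv hw hW hd => ?_⟩
  have h : IsGrid a b N x := hd.isGrid fun y hy => (hW y hy).1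
  obtain ⟨hAup, hAlow⟩ := hA a b u v N x h hu hv
  obtain ⟨hBup, hBlow⟩ := hB a b u v N x h hu hv
  have hq' : 0 < 1 / q := by positivity
  have hp' : 0 < 1 / p := by positivity
  refine characterizedBy_of_mainInequality (by positivity) (fun C hC hle f hf => ?_)
    fun C hC => ?_
  · set R := ∫⁻ t in interval a b, (∫⁻ s in Set.Ioo a t, f s) ^ p * w t with hR
    set E := ∑' k : Idx N, coef p x f k ^ p with hE
    have hER : E ≤ c₁ * R := h₁ a b w N x h hd f
    -- With an infinite right-hand side the claim is trivial since `C > 0`; the upper bounds need a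
    -- finite energy.
    rcases eq_or_ne R ∞ with hRt | hRt
    · rw [hRt, ENNReal.top_rpow_of_pos hp', ENNReal.mul_top (ENNReal.coe_ne_zero.2 hC.ne')]
      exact le_top
    have hEt : E ≠ ∞ := ne_top_of_le_ne_top (ENNReal.mul_ne_top ENNReal.coe_ne_top hRt) hER
    have hS : A b u v N x + B u v N x ≠ ∞ := by
      intro htop
      rw [htop, ENNReal.mul_top (ENNReal.coe_ne_zero.2 (by positivity))] at hle
      exact ENNReal.coe_ne_top (top_le_iff.1 hle)
    set S := A b u v N x + B u v N x with hSdef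
    have hAS : A b u v N x ≤ S := le_self_add
    have hBS : B u v N x ≤ S := le_add_self
    have key : hardyLHS q r a b u v f ≤ M * (S ^ q * E ^ (q / p)) := by
      refine (hardyLHS_le (p := p) h hr hr1 hq hu.1 hv.1 hf).trans ?_
      calc (2 : ℝ≥0∞) ^ (q / r) * _
          ≤ 2 ^ (q / r) * (cA * (S ^ q * E ^ (q / p)) + cB * (S ^ q * E ^ (q / p))) := by
            gcongr
            · refine (hAup f (ne_top_of_le_ne_top hS hAS) hEt).trans ?_
              gcongr
            · refine (hBup f hf (ne_top_of_le_ne_top hS hBS) hEt).trans ?_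
              gcongr
        _ = _ := by
            rw [hM, ENNReal.coe_mul, ENNReal.coe_add,
              ENNReal.coe_rpow_of_nonneg _ (show 0 ≤ q / r by positivity), ENNReal.coe_ofNat]
            ring
    calc hardyLHS q r a b u v f ^ (1 / q)
        ≤ (M * (S ^ q * (c₁ * R) ^ (q / p))) ^ (1 / q) := by
          gcongr
          exact key.trans (by gcongr)
      _ = ((M ^ (1 / q) * c₁ ^ (1 / p) : ℝ≥0) : ℝ≥0∞) * S * R ^ (1 / p) := by
          rw [ENNReal.mul_rpow_of_nonneg _ _ hq'.le, ENNReal.mul_rpow_of_nonneg _ _ hq'.le,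
            ← ENNReal.rpow_mul, ← ENNReal.rpow_mul, mul_one_div_cancel hq.ne', ENNReal.rpow_one,
            show q / p * (1 / q) = 1 / p by field_simp, ENNReal.mul_rpow_of_nonneg _ _ hp'.le,
            ENNReal.coe_mul, ENNReal.coe_rpow_of_nonneg _ hq'.le,
            ENNReal.coe_rpow_of_nonneg _ hp'.le]
          ring
      _ ≤ C * R ^ (1 / p) := by
          gcongr
          refine le_trans ?_ hle
          gcongr
          exact le_self_add
  · have hlow : ∀ f : ℝ → ℝ≥0∞, Measurable f → ∑' k : Idx N, coef p x f k ^ p ≤ 1 →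
        hardyLHS q r a b u v f ≤ (((C * c₂ ^ (1 / p)) ^ q : ℝ≥0) : ℝ≥0∞) := by
      intro f hf hE
      have hR := h₂ a b w N x h hw.1 hd f
      rw [ENNReal.coe_rpow_of_nonneg _ hq.le, ← ENNReal.rpow_inv_le_iff hq, ← one_div]
      refine (hC f hf.aemeasurable).trans ?_
      rw [ENNReal.coe_mul, ENNReal.coe_rpow_of_nonneg _ hp'.le]
      gcongr
      exact hR.trans (mul_le_of_le_one_right' hE)
    have e : ((((C * c₂ ^ (1 / p)) ^ q : ℝ≥0) : ℝ≥0∞)) ^ (1 / q) = C * (c₂ ^ (1 / p) : ℝ≥0) := by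
      rw [ENNReal.coe_rpow_of_nonneg _ hq.le, ← ENNReal.rpow_mul, mul_one_div_cancel hq.ne',
        ENNReal.rpow_one, ENNReal.coe_mul]
    have h1 := hAlow _ hlow
    have h2 := hBlow _ hlow
    rw [e] at h1 h2
    refine (add_le_add h1 h2).trans (le_of_eq ?_)
    push_cast
    ring

end TwoHardy

theorem theorem4 (p q r : ℝ) (hp : 0 < p) (hq : 0 < q) (hr : 0 < r) (hr1 : r ≤ 1)
    (D : ℝ≥0) (hD : 0 < D) :
    ∃ c : ℝ≥0, 0 < c ∧
      ∀ (a : ℝ) (b : EReal) (u v w : ℝ → ℝ≥0∞) (N : WithBot ℤ) (x : ℤ → ℝ),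
        0 ≤ a → (a : EReal) < b →
        TwoHardy.IsWeight a b u → TwoHardy.IsWeight a b v → TwoHardy.IsWeight a b w →
        (∀ y ∈ TwoHardy.interval a b, 0 < TwoHardy.tail b w y ∧ TwoHardy.tail b w y < ∞) →
        TwoHardy.IsDiscretizing a b w D N x →
        (p ≤ r ∧ 1 ≤ q → TwoHardy.CharacterizedBy p q r a b u v w c
          (TwoHardy.A₁ p q r b u v N x) (TwoHardy.B₁ p q r u v N x)) ∧
        (p ≤ q ∧ q < 1 ∧ p ≤ r → TwoHardy.CharacterizedBy p q r a b u v w c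
          (TwoHardy.A₁ p q r b u v N x) (TwoHardy.B₂ p q r u v N x)) ∧
        (r < p ∧ p ≤ q ∧ 1 ≤ q → TwoHardy.CharacterizedBy p q r a b u v w c
          (TwoHardy.A₂ p q r b u v N x) (TwoHardy.B₁ p q r u v N x)) ∧
        (r < p ∧ p ≤ q ∧ q < 1 → TwoHardy.CharacterizedBy p q r a b u v w c
          (TwoHardy.A₂ p q r b u v N x) (TwoHardy.B₂ p q r u v N x)) ∧
        (q < p ∧ p ≤ r → TwoHardy.CharacterizedBy p q r a b u v w c
          (TwoHardy.A₃ p q r b u v N x) (TwoHardy.B₃ p q r u v N x)) ∧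
        (q < p ∧ q < 1 ∧ r < p → TwoHardy.CharacterizedBy p q r a b u v w c
          (TwoHardy.A₄ p q r b u v N x) (TwoHardy.B₃ p q r u v N x)) ∧
        (1 ≤ q ∧ q < p → TwoHardy.CharacterizedBy p q r a b u v w c
          (TwoHardy.A₄ p q r b u v N x) (TwoHardy.B₄ p q r u v N x)) := by
  open TwoHardy in
  -- The constant must be fixed before the interval, weights and grid. The case conditions involve
  -- only the exponents, so each case supplies a constant in advance, with 0 when its condition
  -- fails, and the sum of all of them serves every case.
  have aux : ∀ (P : Prop) (A : EReal → (ℝ → ℝ≥0∞) → (ℝ → ℝ≥0∞) → WithBot ℤ → (ℤ → ℝ) → ℝ≥0∞)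
      (B : (ℝ → ℝ≥0∞) → (ℝ → ℝ≥0∞) → WithBot ℤ → (ℤ → ℝ) → ℝ≥0∞),
      (P → DiscreteChar p q r A ∧ LocalChar p q r B) →
      ∃ c : ℝ≥0, ∀ (a : ℝ) (b : EReal) (u v w : ℝ → ℝ≥0∞) (N : WithBot ℤ) (x : ℤ → ℝ),
        IsWeight a b u → IsWeight a b v → IsWeight a b w →
        (∀ y ∈ interval a b, 0 < tail b w y ∧ tail b w y < ∞) → IsDiscretizing a b w D N x →
        ∀ c', c ≤ c' → P → CharacterizedBy p q r a b u v w c' (A b u v N x) (B u v N x) := by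
    intro P A B hP
    by_cases h : P
    · obtain ⟨c, hc⟩ := exists_characterizedBy hp hq hr hr1 D (hP h).1 (hP h).2
      exact ⟨c, fun a b u v w N x hu hv hw hW hd c' hc' _ =>
        (hc a b u v w N x hu hv hw hW hd).mono hc'⟩
    · exact ⟨0, fun _ _ _ _ _ _ _ _ _ _ _ _ _ _ h' => absurd h' h⟩
  -- The relations not listed in a case follow from `r ≤ 1`: here `p ≤ q`, in the fifth case `q <
  -- 1`, in the seventh `r < p`.
  obtain ⟨c₁, h₁⟩ := aux (p ≤ r ∧ 1 ≤ q) _ _ fun h =>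
    ⟨TwoHardy.discreteChar_A₁ hp (by linarith) hr hr1 h.1,
      TwoHardy.localChar_B₁ hp (by linarith) hr hr1 h.2⟩
  obtain ⟨c₂, h₂⟩ := aux (p ≤ q ∧ q < 1 ∧ p ≤ r) _ _ fun h =>
    ⟨TwoHardy.discreteChar_A₁ hp h.1 hr hr1 h.2.2, TwoHardy.localChar_B₂ hp h.1 hr hr1 h.2.1⟩
  obtain ⟨c₃, h₃⟩ := aux (r < p ∧ p ≤ q ∧ 1 ≤ q) _ _ fun h =>
    ⟨TwoHardy.discreteChar_A₂ hp h.2.1 hr hr1 h.1, TwoHardy.localChar_B₁ hp h.2.1 hr hr1 h.2.2⟩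
  obtain ⟨c₄, h₄⟩ := aux (r < p ∧ p ≤ q ∧ q < 1) _ _ fun h =>
    ⟨TwoHardy.discreteChar_A₂ hp h.2.1 hr hr1 h.1, TwoHardy.localChar_B₂ hp h.2.1 hr hr1 h.2.2⟩
  obtain ⟨c₅, h₅⟩ := aux (q < p ∧ p ≤ r) _ _ fun h =>
    ⟨TwoHardy.discreteChar_A₃ hq h.1 hr hr1 h.2,
      TwoHardy.localChar_B₃ hq h.1 hr hr1 (by linarith)⟩
  obtain ⟨c₆, h₆⟩ := aux (q < p ∧ q < 1 ∧ r < p) _ _ fun h =>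
    ⟨TwoHardy.discreteChar_A₄ hq h.1 hr hr1 h.2.2, TwoHardy.localChar_B₃ hq h.1 hr hr1 h.2.1⟩
  obtain ⟨c₇, h₇⟩ := aux (1 ≤ q ∧ q < p) _ _ fun h =>
    ⟨TwoHardy.discreteChar_A₄ hq h.2 hr hr1 (by linarith),
      TwoHardy.localChar_B₄ h.1 h.2 hr hr1⟩
  refine ⟨c₁ + c₂ + c₃ + c₄ + c₅ + c₆ + c₇ + 1, by positivity,
    fun a b u v w N x _ _ hu hv hw hW hd => ?_⟩
  have hle : ∀ i : Fin 7, ![c₁, c₂, c₃, c₄, c₅, c₆, c₇] i ≤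
      c₁ + c₂ + c₃ + c₄ + c₅ + c₆ + c₇ + 1 := fun i =>
    (Finset.single_le_sum (f := ![c₁, c₂, c₃, c₄, c₅, c₆, c₇]) (fun _ _ => zero_le)
      (Finset.mem_univ i)).trans (by simp [Fin.sum_univ_succ, add_assoc])
  exact ⟨h₁ a b u v w N x hu hv hw hW hd _ (hle 0), h₂ a b u v w N x hu hv hw hW hd _ (hle 1),
    h₃ a b u v w N x hu hv hw hW hd _ (hle 2), h₄ a b u v w N x hu hv hw hW hd _ (hle 3),
    h₅ a b u v w N x hu hv hw hW hd _ (hle 4), h₆ a b u v w N x hu hv hw hW hd _ (hle 5),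
    h₇ a b u v w N x hu hv hw hW hd _ (hle 6)⟩
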